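/- For $\tau,w\in\mathbb{C}$ with $\operatorname{Im}\tau>0$ put $q=e^{2\pi i\tau}$, $\zeta=e^{2\pi i w}$, and let $$\eta(\tau)=q^{1/24}\prod_{n\ge1}(1-q^n),\qquad \vartheta(w;\tau)=i\,\zeta^{1/2}q^{1/8}\prod_{n\ge1}(1-q^n)(1-\zeta q^n)(1-\zeta^{-1}q^{n-1}),$$ $$g(w;\tau)=\frac{i\,(\zeta^{1/2}-\zeta^{-1/2})\,\eta(\tau)^3}{\vartheta(w;\tau)},\qquad f_k(w;\tau)=\frac{g(w;\tau)^2}{\eta(\tau)^k}.$$ For an integer $k\ge1$ let $a_{m,k}(n)$ ($m\in\mathbb{Z}$, $n\ge0$) be the coefficients of the expansion $$f_k(w;\tau)=\sum_{m\in\mathbb{Z},\,n\ge0}a_{m,k}(n)\,\zeta^m q^{\,n-k/24},$$ which converges absolutely for $|q|<|\zeta|<|q|^{-1}$ (with the removable singularity of $f_k$ at $\zeta=1$ excluded). Let $p_k(n)$ be the number of partitions of $n$ in $k$ colors, $\beta_k=\pi\sqrt{k/(6n)}$, and $$P(m,\beta)=\frac{d^2}{dm^2}\left(\frac m2\coth\left(\frac{\beta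 m}{2}\right)\right).$$ **Theorem.** Fix an integer $k\ge1$. As $n\to\infty$, $$\frac{a_{m,k}(n)}{p_k(n)}=P(m,\beta_k)\left(1+O\!\left(\beta_k^{1/2}|m|^{1/3}\right)\right)$$ uniformly for all nonzero integers $m$ with $|m|\le\sqrt{\frac{n}{6k}}\,\frac{\log n}{\pi}$; that is, the implied constant and the threshold for $n$ depend only on $k$. -/

import Mathlib

namespace ChiGenus

noncomputable section

/-- `ζ = e^{2π i w}`. -/
def zeta (w : ℂ) : ℂ := Complex.exp (2 * Real.pi * Complex.I * w)

/-- `q = e^{2π i τ}`. -/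
def nome (τ : ℂ) : ℂ := Complex.exp (2 * Real.pi * Complex.I * τ)

/-- The Jacobi theta function
`ϑ(w; τ) = i ζ^{1/2} q^{1/8} ∏_{n ≥ 1} (1 - q^n) (1 - ζ q^n) (1 - ζ⁻¹ q^{n-1})`,
where `ζ^{1/2} = e^{π i w}` and `q^{1/8} = e^{2π i τ / 8}`.
(The product index below starts at `0`.) -/
def theta (w τ : ℂ) : ℂ :=
  Complex.I * Complex.exp (Real.pi * Complex.I * w) *
    Complex.exp (2 * Real.pi * Complex.I * τ / 8) *
    ∏' n : ℕ, (1 - nome τ ^ (n + 1)) * (1 - zeta w * nome τ ^ (n + 1)) *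
      (1 - (zeta w)⁻¹ * nome τ ^ n)

/-- `g(w; τ) = i (ζ^{1/2} - ζ^{-1/2}) η(τ)^3 / ϑ(w; τ)`, with the Dedekind eta function
`η(τ) = q^{1/24} ∏_{n ≥ 1} (1 - q^n)` of Mathlib. -/
def g (w τ : ℂ) : ℂ :=
  Complex.I *
    (Complex.exp (Real.pi * Complex.I * w) - Complex.exp (-(Real.pi * Complex.I * w))) *
    ModularForm.eta τ ^ 3 / theta w τ

/-- `f_k(w; τ) = g(w; τ)^2 / η(τ)^k`. -/
def f (k : ℕ) (w τ : ℂ) : ℂ := g w τ ^ 2 / ModularForm.eta τ ^ k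

open scoped LaurentPolynomial PowerSeries in
/-- The partial product, over `1 ≤ j ≤ N`, of the formal expansion
`∏_{j ≥ 1} (1 - q^j)^4 / ((1 - q^j)^k (1 - ζ q^j)^2 (1 - ζ⁻¹ q^j)^2)` of `q^{k/24} f_k`, as a power
series in `q` (`PowerSeries.X`) whose coefficients are Laurent polynomials in `ζ`
(`LaurentPolynomial.T 1`). -/
def partialProd (k N : ℕ) : ℤ[T;T⁻¹]⟦X⟧ :=
  ∏ j ∈ Finset.Icc 1 N,
    (1 - PowerSeries.X ^ j) ^ 4 *
      PowerSeries.invOfUnit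
        ((1 - PowerSeries.X ^ j) ^ k *
          (1 - PowerSeries.C (LaurentPolynomial.T 1) * PowerSeries.X ^ j) ^ 2 *
          (1 - PowerSeries.C (LaurentPolynomial.T (-1)) * PowerSeries.X ^ j) ^ 2) 1

/-- `a_{m,k}(n)`: the coefficient of `ζ^m q^{n - k/24}` in `f_k(w; τ)`. The factors with `j > n`
are `1 + O(q^{n+1})` and do not affect the coefficient of `q^n`. -/
def a (m : ℤ) (k n : ℕ) : ℤ := (PowerSeries.coeff n (partialProd k n)).coeff m

/-- `p_k(n)`: the number of partitions of `n` in `k` colors. Such a partition consists of a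
splitting `n = n_1 + ⋯ + n_k` and, for each color `i`, a partition of `n_i` (the parts of
color `i`). -/
def p (k n : ℕ) : ℕ :=
  ∑ x ∈ Finset.Nat.antidiagonalTuple k n, ∏ i : Fin k, Fintype.card (Nat.Partition (x i))

/-- `β_k = π √(k / (6 n))`. -/
def betaK (k n : ℕ) : ℝ := Real.pi * Real.sqrt ((k : ℝ) / (6 * n))

/-- The function `x ↦ (x / 2) coth (β x / 2)`, with its removable singularity at `x = 0` filled
in by the limit `1 / β`. -/
def halfCoth (β x : ℝ) : ℝ :=
  if x = 0 then 1 / β else x / 2 * (Real.cosh (β * x / 2) / Real.sinh (β * x / 2))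

/-- The profile `P(m, β) = d²/dm² ((m / 2) coth (β m / 2))`. -/
def P (m β : ℝ) : ℝ := iteratedDeriv 2 (halfCoth β) m

end

end ChiGenus

/-! Write `A 0 m q` for the coefficient of ζ^m in g² and (q)_∞ for `eul 1 q`. Because η does not
involve ζ, the generating function of n ↦ a_{m,k}(n) is (q)_∞^{-k} `A 0 m q` (`A_eq`), while that of
p_k is (q)_∞^{-k}. So a_{m,k}(n) - P·p_k(n) is a Cauchy integral of (A - P)(q)_∞^{-k}, and it
suffices that A is close to P(m, β) on the part of the circle |q| = e^{-β} that carries the mass.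

Exact formula. ζ(1-ζ)^{-2}g² is, up to a factor free of ζ, the inverse square of a theta function.
Let H(r) be its Laurent coefficients for |q| < |ζ| < 1. The shift ζ → ζq gives H(-r) = q^{r+1}H(r+2)
(`H_neg`), and the symmetry ζ → 1/ζ together with g² = 1 at ζ = 1 gives H(r) - H(-r) = r
(`H_sub_H_neg`). Iterating the two yields the partial theta series H(r) = Σ_j (r+2j)q^{j²+jr}
(`hasSum_H`), and A is a second difference of H.

Kernel. With q = e^{-z} the second difference becomes A = -Σ_j w'(j), where w(x) =
z^{-1}(e^{zx}+e^{-zx}-2)e^{-zx²-zmx}. Near 0, w resembles z x² e^{-zmx}, whose derivatives sum to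
exactly -P(m, β) at z = β. Euler–Maclaurin bounds the sum of differences by the L¹ norm of a higher
derivative, uniformly in m, which gives A = P + O(β^{3/2} + |y|) at z = β + iy, |y| ≤ β
(`kernel_estimate`).

Circle. β_k is the saddle point of (q)_∞^{-k}q^{-n}. Let R(y) be the quotient of (q)_∞^{-1} at
e^{-(β+iy)} by its value at e^{-β}. An elementary inequality bounds |R| by exp(-y²/(56β³)) for |y| ≤
β and by exp(-1/(56β)) beyond, and the η-transformation gives a Gaussian limit on the scale y =
β^{3/2}u. Hence the normalised integral for p_k(n) is at least cβ^{3/2} and the one for a - P·p is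
O(β³). The normalisation cancels, so no asymptotic formula for p_k(n) is needed, and a/p = P +
O(β^{3/2}).

Finally P ≥ (β/6)e^{-β|m|} (`P_lower`), so the relative error is O(β^{1/2}e^{β|m|}), and e^{β|m|} ≪
|m|^{1/3} in the stated range (`exp_betaK_mul_le`). -/

namespace ChiGenus
noncomputable section
open scoped LaurentPolynomial PowerSeries
open Filter Topology

/-! ### Series in q over Laurent polynomials in ζ: evaluation and domination -/

/-- The coefficient of `ζ^m q^n`, indexed by the pair `(m, n)`. -/
def cf (Φ : ℤ[T;T⁻¹]⟦X⟧) (x : ℤ × ℕ) : ℤ := (PowerSeries.coeff x.2 Φ).coeff x.1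

/-- `Φ` converges absolutely at `(ζ, q)`, with sum `v`. -/
def Ev (ζ q : ℂ) (Φ : ℤ[T;T⁻¹]⟦X⟧) (v : ℂ) : Prop :=
  HasSum (fun x : ℤ × ℕ => (cf Φ x : ℂ) * (ζ ^ x.1 * q ^ x.2)) v

lemma hasSum_of_eq {ι : Type*} {f g : ι → ℂ} {v : ℂ} (h : ∀ x, f x = g x) (hf : HasSum f v) :
    HasSum g v :=
  (funext h : f = g) ▸ hf

lemma laurent_coeff_mul (a b : ℤ[T;T⁻¹]) (m : ℤ) (S : Finset ℤ) (hS : a.coeff.support ⊆ S) :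
    (a * b).coeff m = ∑ l ∈ S, a.coeff l * b.coeff (m - l) := by
  classical
  rw [AddMonoidAlgebra.coeff_mul, Finsupp.sum, Finset.sum_subset hS]
  · refine Finset.sum_congr rfl fun l _ => ?_
    rw [Finsupp.sum]
    have : ∀ x : ℤ, (l + x = m) = (x = m - l) := fun x => by
      rw [eq_iff_iff]; constructor <;> intro h <;> omega
    simp only [this, Finset.sum_ite_eq']
    split_ifs with h
    · rfl
    · simp [Finsupp.notMem_support_iff.1 h]
  · intro x _ hx
    simp [Finsupp.notMem_support_iff.1 hx, Finsupp.sum]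

/-- The finite set S is left free so that one set can serve two different products, as the
comparison in `Dom.mul` requires. -/
lemma cf_mul (Φ Ψ : ℤ[T;T⁻¹]⟦X⟧) (x : ℤ × ℕ) (S : Finset ℤ)
    (hS : ∀ i ≤ x.2, (PowerSeries.coeff i Φ).coeff.support ⊆ S) :
    cf (Φ * Ψ) x = ∑ y ∈ Finset.HasAntidiagonal.antidiagonal x.2, ∑ l ∈ S, cf Φ (l, y.1) * cf Ψ (x.1 - l, y.2) := by
  rw [cf, PowerSeries.coeff_mul, AddMonoidAlgebra.coeff_sum, Finsupp.finsetSum_apply]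
  refine Finset.sum_congr rfl fun y hy => ?_
  rw [laurent_coeff_mul _ _ _ S (hS _ (by have := Finset.HasAntidiagonal.mem_antidiagonal.1 hy; omega))]
  rfl

lemma exists_support_bound (Φ : ℤ[T;T⁻¹]⟦X⟧) (n : ℕ) :
    ∃ S : Finset ℤ, ∀ i ≤ n, (PowerSeries.coeff i Φ).coeff.support ⊆ S := by
  classical
  refine ⟨(Finset.range (n + 1)).biUnion fun i => (PowerSeries.coeff i Φ).coeff.support,
    fun i hi => ?_⟩
  exact Finset.subset_biUnion_of_mem (fun i => (PowerSeries.coeff i Φ).coeff.support)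
    (Finset.mem_range.2 (Nat.lt_succ_of_le hi))

/-- This is the Cauchy product: absolute convergence allows the double sum to be regrouped by the
sum of the two index pairs. -/
lemma Ev.mul {ζ q : ℂ} (hζ : ζ ≠ 0) {Φ Ψ : ℤ[T;T⁻¹]⟦X⟧} {v w : ℂ} (h1 : Ev ζ q Φ v)
    (h2 : Ev ζ q Ψ w) : Ev ζ q (Φ * Ψ) (v * w) := by
  classical
  unfold Ev at *
  have hs := summable_mul_of_summable_norm h1.summable.norm h2.summable.norm
  have hp := h1.mul h2 hs
  have hf := hp.tsum_fiberwise (fun b : (ℤ × ℕ) × (ℤ × ℕ) => b.1 + b.2)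
  refine hasSum_of_eq (fun s => ?_) hf
  obtain ⟨S, hS⟩ := exists_support_bound Φ s.2
  rw [tsum_subtype ((fun b : (ℤ × ℕ) × (ℤ × ℕ) => b.1 + b.2) ⁻¹' {s})
    (fun b : (ℤ × ℕ) × (ℤ × ℕ) => ((cf Φ b.1 : ℂ) * (ζ ^ b.1.1 * q ^ b.1.2)) *
      ((cf Ψ b.2 : ℂ) * (ζ ^ b.2.1 * q ^ b.2.2)))]
  -- The fibre over s is infinite in the ζ-exponent, but each coefficient of Φ is a Laurent
  -- polynomial, so only finitely many terms of the fibre are nonzero.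
  rw [tsum_eq_sum (s := (Finset.HasAntidiagonal.antidiagonal s.2 ×ˢ S).image
    (fun u : (ℕ × ℕ) × ℤ => (((u.2, u.1.1), (s.1 - u.2, u.1.2)) : (ℤ × ℕ) × (ℤ × ℕ))))]
  · rw [Finset.sum_image, Finset.sum_product, cf_mul Φ Ψ s S hS]
    · push_cast
      rw [Finset.sum_mul]
      refine Finset.sum_congr rfl fun y hy => ?_
      rw [Finset.sum_mul]
      refine Finset.sum_congr rfl fun l _ => ?_
      have hy' := Finset.HasAntidiagonal.mem_antidiagonal.1 hy
      rw [Set.indicator_of_mem (by simp [hy']), ← hy', pow_add, zpow_sub₀ hζ]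
      have := zpow_ne_zero l hζ
      field_simp
    · rintro ⟨⟨i, j⟩, l⟩ - ⟨⟨i', j'⟩, l'⟩ - h
      simp only [Prod.mk.injEq] at h
      simp [h]
  · rintro ⟨⟨m₁, i⟩, ⟨m₂, j⟩⟩ hb
    rw [Set.indicator_apply_eq_zero]
    intro hm
    simp only [Set.mem_preimage, Prod.mk_add_mk, Set.mem_singleton_iff] at hm
    have hm1 : m₁ + m₂ = s.1 := by rw [← hm]
    have hm2 : i + j = s.2 := by rw [← hm]
    have hl : m₁ ∉ S := fun hl => hb (Finset.mem_image.2 ⟨((i, j), m₁), by simp [hl, hm2], by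
      simp [← hm1]⟩)
    have : cf Φ (m₁, i) = 0 := Finsupp.notMem_support_iff.1 fun h => hl (hS i (by omega) h)
    simp [this]

/-- Coefficientwise domination. -/
def Dom (Φ Ψ : ℤ[T;T⁻¹]⟦X⟧) : Prop := ∀ x, |cf Φ x| ≤ cf Ψ x

lemma Dom.mul {Φ Φ' Ψ Ψ' : ℤ[T;T⁻¹]⟦X⟧} (h : Dom Φ Φ') (h' : Dom Ψ Ψ') :
    Dom (Φ * Ψ) (Φ' * Ψ') := by
  classical
  intro x
  obtain ⟨S, hS⟩ := exists_support_bound Φ x.2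
  obtain ⟨S', hS'⟩ := exists_support_bound Φ' x.2
  rw [cf_mul Φ Ψ x (S ∪ S') fun i hi => (hS i hi).trans Finset.subset_union_left,
    cf_mul Φ' Ψ' x (S ∪ S') fun i hi => (hS' i hi).trans Finset.subset_union_right]
  refine (Finset.abs_sum_le_sum_abs _ _).trans (Finset.sum_le_sum fun y _ => ?_)
  refine (Finset.abs_sum_le_sum_abs _ _).trans (Finset.sum_le_sum fun l _ => ?_)
  rw [abs_mul]
  exact mul_le_mul (h _) (h' _) (abs_nonneg _) ((abs_nonneg _).trans (h _))

lemma cf_one (x : ℤ × ℕ) : cf 1 x = if x = 0 then 1 else 0 := by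
  obtain ⟨m, n⟩ := x
  rw [cf, PowerSeries.coeff_one]
  by_cases hn : n = 0
  · subst hn
    simp only [if_true, Prod.mk_eq_zero, and_true]
    rw [← LaurentPolynomial.T_zero, LaurentPolynomial.T_apply]
    simp [eq_comm]
  · simp [hn]

lemma Dom.one : Dom 1 1 := fun x => by rw [cf_one]; split_ifs <;> simp

lemma Dom.pow {Φ Φ' : ℤ[T;T⁻¹]⟦X⟧} (h : Dom Φ Φ') (n : ℕ) : Dom (Φ ^ n) (Φ' ^ n) := by
  induction n with
  | zero => simpa using Dom.one
  | succ n ih => rw [pow_succ, pow_succ]; exact ih.mul h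

lemma Dom.prod {s : Finset ℕ} {Φ Φ' : ℕ → ℤ[T;T⁻¹]⟦X⟧} (h : ∀ j ∈ s, Dom (Φ j) (Φ' j)) :
    Dom (∏ j ∈ s, Φ j) (∏ j ∈ s, Φ' j) := by
  classical
  induction s using Finset.induction_on with
  | empty => simpa using Dom.one
  | insert j s hj ih =>
    rw [Finset.prod_insert hj, Finset.prod_insert hj]
    exact (h j (by simp)).mul (ih fun i hi => h i (by simp [hi]))

lemma Ev.one (ζ q : ℂ) : Ev ζ q 1 1 := by
  unfold Ev
  convert hasSum_single (0 : ℤ × ℕ) (f := fun x : ℤ × ℕ => (cf 1 x : ℂ) * (ζ ^ x.1 * q ^ x.2)) ?_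
  · simp [cf_one]
  · intro x hx
    simp [cf_one, hx]

lemma Ev.pow {ζ q : ℂ} (hζ : ζ ≠ 0) {Φ : ℤ[T;T⁻¹]⟦X⟧} {v : ℂ} (h : Ev ζ q Φ v) (n : ℕ) :
    Ev ζ q (Φ ^ n) (v ^ n) := by
  induction n with
  | zero => simpa using Ev.one ζ q
  | succ n ih => rw [pow_succ, pow_succ]; exact ih.mul hζ h

lemma Ev.prod {ζ q : ℂ} (hζ : ζ ≠ 0) {s : Finset ℕ} {Φ : ℕ → ℤ[T;T⁻¹]⟦X⟧} {v : ℕ → ℂ}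
    (h : ∀ j ∈ s, Ev ζ q (Φ j) (v j)) : Ev ζ q (∏ j ∈ s, Φ j) (∏ j ∈ s, v j) := by
  classical
  induction s using Finset.induction_on with
  | empty => simpa using Ev.one ζ q
  | insert j s hj ih =>
    rw [Finset.prod_insert hj, Finset.prod_insert hj]
    exact (h j (by simp)).mul hζ (ih fun i hi => h i (by simp [hi]))

lemma Ev.sub {ζ q : ℂ} {Φ Ψ : ℤ[T;T⁻¹]⟦X⟧} {v w : ℂ} (h1 : Ev ζ q Φ v)
    (h2 : Ev ζ q Ψ w) : Ev ζ q (Φ - Ψ) (v - w) := by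
  unfold Ev at *
  refine hasSum_of_eq (fun x => ?_) (HasSum.sub h1 h2)
  rw [← sub_mul, ← Int.cast_sub]
  simp [cf, map_sub]

/-! ### Geometric series and the factors of the product -/

/-- The geometric series `∑ᵢ (ζ^s q^j)^i`. -/
def geo (s : ℤ) (j : ℕ) : ℤ[T;T⁻¹]⟦X⟧ :=
  PowerSeries.mk fun n => if j ∣ n then LaurentPolynomial.T (s * (n / j : ℕ)) else 0

lemma one_sub_mul_geo (s : ℤ) {j : ℕ} (hj : 1 ≤ j) :
    (1 - PowerSeries.C (LaurentPolynomial.T s) * PowerSeries.X ^ j) * geo s j = 1 := by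
  ext1 n
  rw [sub_mul, one_mul, map_sub, mul_assoc, PowerSeries.coeff_C_mul, PowerSeries.coeff_X_pow_mul',
    PowerSeries.coeff_one, geo, PowerSeries.coeff_mk, PowerSeries.coeff_mk]
  by_cases hn : j ≤ n
  · have h0 : n ≠ 0 := by omega
    have hd : j ∣ n - j ↔ j ∣ n := by
      rw [Nat.dvd_sub_self_right]
      exact or_iff_left_of_imp fun h => by
        obtain rfl : n = j := by omega
        exact dvd_refl n
    simp only [hn, if_true, h0, if_false, hd]
    split_ifs with h
    · rw [← LaurentPolynomial.T_add]
      obtain ⟨c, rfl⟩ := h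
      have hc : c ≠ 0 := by rintro rfl; simp at h0
      have e1 : j * c / j = c := Nat.mul_div_cancel_left _ (by omega)
      have e2 : (j * c - j) / j = c - 1 := by
        rw [← Nat.mul_sub_one]; exact Nat.mul_div_cancel_left _ (by omega)
      rw [e1, e2, Nat.cast_sub (by omega)]
      rw [sub_eq_zero]
      congr 1
      push_cast
      ring
    · simp
  · have : j ∣ n ↔ n = 0 := ⟨fun h => by
      by_contra h0
      exact hn (Nat.le_of_dvd (by omega) h), fun h => by simp [h]⟩
    simp only [hn, if_false, this, mul_zero, sub_zero]
    split_ifs with h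
    · simp [h]
    · rfl

open Classical in
lemma cf_geo (s : ℤ) {j : ℕ} (hj : 1 ≤ j) (m : ℤ) (n : ℕ) :
    cf (geo s j) (m, n) = if ∃ i : ℕ, m = s * i ∧ n = j * i then 1 else 0 := by
  rw [cf, geo, PowerSeries.coeff_mk]
  by_cases h : j ∣ n
  · obtain ⟨c, rfl⟩ := h
    have e1 : j * c / j = c := Nat.mul_div_cancel_left _ (by omega)
    have : (∃ i : ℕ, m = s * i ∧ j * c = j * i) ↔ s * c = m := by
      constructor
      · rintro ⟨i, rfl, h⟩
        rw [Nat.eq_of_mul_eq_mul_left (by omega) h]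
      · rintro rfl
        exact ⟨c, rfl, rfl⟩
    simp only [dvd_mul_right, if_true, e1, this, LaurentPolynomial.T_apply]
  · rw [if_neg h, if_neg]
    · simp
    · rintro ⟨i, -, rfl⟩
      exact h (dvd_mul_right _ _)

lemma Ev.geo {ζ q : ℂ} (s : ℤ) {j : ℕ} (hj : 1 ≤ j) (h : ‖ζ ^ s * q ^ j‖ < 1) :
    Ev ζ q (geo s j) (1 - ζ ^ s * q ^ j)⁻¹ := by
  have hi : Function.Injective (fun i : ℕ => ((s * i, j * i) : ℤ × ℕ)) := by
    intro a b hab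
    simp only [Prod.mk.injEq] at hab
    exact Nat.eq_of_mul_eq_mul_left (by omega) hab.2
  unfold Ev
  rw [← hi.hasSum_iff]
  · refine hasSum_of_eq (fun i => ?_) (hasSum_geometric_of_norm_lt_one h)
    symm
    change (cf (ChiGenus.geo s j) (s * i, j * i) : ℂ) * (ζ ^ (s * (i : ℤ)) * q ^ (j * i)) = _
    rw [cf_geo s hj, if_pos ⟨i, rfl, rfl⟩, mul_pow, zpow_mul, pow_mul]
    simp
  · rintro ⟨m, n⟩ hx
    rw [cf_geo s hj, if_neg]
    · simp
    · rintro ⟨i, rfl, rfl⟩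
      exact hx ⟨i, rfl⟩

lemma Dom.geo_self (s : ℤ) {j : ℕ} (hj : 1 ≤ j) : Dom (geo s j) (geo s j) := by
  rintro ⟨m, n⟩
  rw [cf_geo s hj]
  split_ifs <;> simp

lemma C_T_zero_mul (j : ℕ) : (PowerSeries.C (LaurentPolynomial.T 0) * PowerSeries.X ^ j :
    ℤ[T;T⁻¹]⟦X⟧) = PowerSeries.X ^ j := by
  simp [LaurentPolynomial.T_zero]

lemma cf_X_pow (j : ℕ) (m : ℤ) (n : ℕ) :
    cf (PowerSeries.X ^ j) (m, n) = if m = 0 ∧ n = j then 1 else 0 := by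
  rw [cf, PowerSeries.coeff_X_pow]
  by_cases h : n = j
  · simp only [h, if_true, and_true]
    rw [← LaurentPolynomial.T_zero, LaurentPolynomial.T_apply]
    simp [eq_comm]
  · simp [h]

/-- A crude majorant, but it has the same shape as the denominators: the majorant of the whole
product is again a product of geometric series and converges in the same annulus. -/
lemma Dom.one_sub_X_pow {j : ℕ} (hj : 1 ≤ j) : Dom (1 - PowerSeries.X ^ j) (ChiGenus.geo 0 j) := by
  rintro ⟨m, n⟩
  have : cf (1 - PowerSeries.X ^ j) (m, n) = cf 1 (m, n) - cf (PowerSeries.X ^ j) (m, n) := by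
    simp [cf, map_sub]
  rw [this, cf_one, cf_X_pow, cf_geo 0 hj]
  by_cases hm : m = 0
  · subst hm
    by_cases h0 : n = 0
    · subst h0
      rw [if_pos (by rfl), if_neg (by omega), if_pos ⟨0, by simp, by simp⟩]
      simp
    · by_cases h1 : n = j
      · subst h1
        rw [if_neg (by simp [h0]), if_pos ⟨rfl, rfl⟩, if_pos ⟨1, by simp, by simp⟩]
        simp
      · rw [if_neg (by simp [h0]), if_neg (by simp [h1])]
        split_ifs <;> simp
  · rw [if_neg (by simp [hm]), if_neg (by simp [hm])]
    split_ifs <;> simp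

lemma Ev.X_pow (ζ q : ℂ) (j : ℕ) : Ev ζ q (PowerSeries.X ^ j) (q ^ j) := by
  unfold Ev
  convert hasSum_single ((0, j) : ℤ × ℕ)
    (f := fun x : ℤ × ℕ => (cf (PowerSeries.X ^ j) x : ℂ) * (ζ ^ x.1 * q ^ x.2)) ?_
  · simp [cf_X_pow]
  · rintro ⟨m, n⟩ hx
    simp only [ne_eq, Prod.mk.injEq] at hx
    simp [cf_X_pow, hx]

/-- The `j`-th factor of `partialProd`. -/
def fac (k j : ℕ) : ℤ[T;T⁻¹]⟦X⟧ :=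
  (1 - PowerSeries.X ^ j) ^ 4 * (geo 0 j ^ k * geo 1 j ^ 2 * geo (-1) j ^ 2)

/-- A majorant of `fac`. -/
def majFac (k j : ℕ) : ℤ[T;T⁻¹]⟦X⟧ :=
  geo 0 j ^ 4 * (geo 0 j ^ k * geo 1 j ^ 2 * geo (-1) j ^ 2)

lemma Dom.fac (k : ℕ) {j : ℕ} (hj : 1 ≤ j) : Dom (fac k j) (majFac k j) :=
  ((Dom.one_sub_X_pow hj).pow 4).mul
    ((((Dom.geo_self 0 hj).pow k).mul ((Dom.geo_self 1 hj).pow 2)).mul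
      ((Dom.geo_self (-1) hj).pow 2))

lemma partialProd_eq (k N : ℕ) : partialProd k N = ∏ j ∈ Finset.Icc 1 N, fac k j := by
  refine Finset.prod_congr rfl fun j hj => ?_
  have hj1 : 1 ≤ j := (Finset.mem_Icc.1 hj).1
  rw [fac]
  congr 1
  set D : ℤ[T;T⁻¹]⟦X⟧ := (1 - PowerSeries.X ^ j) ^ k *
    (1 - PowerSeries.C (LaurentPolynomial.T 1) * PowerSeries.X ^ j) ^ 2 *
    (1 - PowerSeries.C (LaurentPolynomial.T (-1)) * PowerSeries.X ^ j) ^ 2 with hD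
  have hc : PowerSeries.constantCoeff D = ((1 : ℤ[T;T⁻¹]ˣ) : ℤ[T;T⁻¹]) := by
    have : j ≠ 0 := by omega
    simp [hD, this]
  have h1 := PowerSeries.mul_invOfUnit D 1 hc
  have h2 : D * (geo 0 j ^ k * geo 1 j ^ 2 * geo (-1) j ^ 2) = 1 := by
    have e0 := one_sub_mul_geo 0 hj1
    rw [C_T_zero_mul] at e0
    have e1 := one_sub_mul_geo 1 hj1
    have e2 := one_sub_mul_geo (-1) hj1
    rw [hD]
    generalize (1 - PowerSeries.X ^ j : ℤ[T;T⁻¹]⟦X⟧) = A at *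
    calc _ = (A * geo 0 j) ^ k *
          ((1 - PowerSeries.C (LaurentPolynomial.T 1) * PowerSeries.X ^ j) * geo 1 j) ^ 2 *
          ((1 - PowerSeries.C (LaurentPolynomial.T (-1)) * PowerSeries.X ^ j) * geo (-1) j) ^ 2 := by
          rw [mul_pow, mul_pow, mul_pow]; ring
      _ = 1 := by rw [e0, e1, e2]; simp
  calc PowerSeries.invOfUnit D 1
      = PowerSeries.invOfUnit D 1 * (D * (geo 0 j ^ k * geo 1 j ^ 2 * geo (-1) j ^ 2)) := by
        rw [h2, mul_one]
    _ = (D * PowerSeries.invOfUnit D 1) * (geo 0 j ^ k * geo 1 j ^ 2 * geo (-1) j ^ 2) := by ring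
    _ = _ := by rw [h1, one_mul]

lemma X_pow_dvd_mul_sub_one {j : ℕ} {Φ Ψ : ℤ[T;T⁻¹]⟦X⟧} (h : PowerSeries.X ^ j ∣ Φ - 1)
    (h' : PowerSeries.X ^ j ∣ Ψ - 1) : PowerSeries.X ^ j ∣ Φ * Ψ - 1 := by
  have : Φ * Ψ - 1 = (Φ - 1) * Ψ + (Ψ - 1) := by ring
  rw [this]
  exact dvd_add (h.mul_right _) h'

lemma X_pow_dvd_pow_sub_one {j : ℕ} {Φ : ℤ[T;T⁻¹]⟦X⟧} (h : PowerSeries.X ^ j ∣ Φ - 1) (n : ℕ) :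
    PowerSeries.X ^ j ∣ Φ ^ n - 1 := by
  induction n with
  | zero => simp
  | succ n ih => rw [pow_succ]; exact X_pow_dvd_mul_sub_one ih h

lemma X_pow_dvd_geo_sub_one (s : ℤ) {j : ℕ} (hj : 1 ≤ j) : PowerSeries.X ^ j ∣ geo s j - 1 :=
  ⟨PowerSeries.C (LaurentPolynomial.T s) * geo s j, by
    have := one_sub_mul_geo s hj
    linear_combination this⟩

lemma X_pow_dvd_fac_sub_one (k : ℕ) {j : ℕ} (hj : 1 ≤ j) : PowerSeries.X ^ j ∣ fac k j - 1 :=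
  X_pow_dvd_mul_sub_one (X_pow_dvd_pow_sub_one ⟨-1, by ring⟩ 4)
    (X_pow_dvd_mul_sub_one (X_pow_dvd_mul_sub_one
      (X_pow_dvd_pow_sub_one (X_pow_dvd_geo_sub_one 0 hj) k)
      (X_pow_dvd_pow_sub_one (X_pow_dvd_geo_sub_one 1 hj) 2))
      (X_pow_dvd_pow_sub_one (X_pow_dvd_geo_sub_one (-1) hj) 2))

lemma X_pow_dvd_majFac_sub_one (k : ℕ) {j : ℕ} (hj : 1 ≤ j) :
    PowerSeries.X ^ j ∣ majFac k j - 1 :=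
  X_pow_dvd_mul_sub_one (X_pow_dvd_pow_sub_one (X_pow_dvd_geo_sub_one 0 hj) 4)
    (X_pow_dvd_mul_sub_one (X_pow_dvd_mul_sub_one
      (X_pow_dvd_pow_sub_one (X_pow_dvd_geo_sub_one 0 hj) k)
      (X_pow_dvd_pow_sub_one (X_pow_dvd_geo_sub_one 1 hj) 2))
      (X_pow_dvd_pow_sub_one (X_pow_dvd_geo_sub_one (-1) hj) 2))

/-- A factor that is 1 modulo X^{N+1} does not change coefficients of q^n with n ≤ N. This is why
truncating the product at j = n loses nothing in the definition of `a`. -/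
lemma cf_prod_stable {Φ : ℕ → ℤ[T;T⁻¹]⟦X⟧} (h : ∀ j, 1 ≤ j → PowerSeries.X ^ j ∣ Φ j - 1)
    (x : ℤ × ℕ) {N : ℕ} (hN : x.2 ≤ N) :
    cf (∏ j ∈ Finset.Icc 1 N, Φ j) x = cf (∏ j ∈ Finset.Icc 1 x.2, Φ j) x := by
  induction N, hN using Nat.le_induction with
  | base => rfl
  | succ N hN ih =>
    rw [← ih, Finset.prod_Icc_succ_top (by omega)]
    obtain ⟨Ψ, hΨ⟩ := h (N + 1) (by omega)
    have : Φ (N + 1) = 1 + PowerSeries.X ^ (N + 1) * Ψ := by linear_combination hΨ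
    rw [this, mul_add, mul_one, mul_left_comm, cf, cf, map_add, PowerSeries.coeff_X_pow_mul',
      if_neg (by omega), add_zero]

lemma Dom.one_geo (s : ℤ) {j : ℕ} (hj : 1 ≤ j) : Dom 1 (geo s j) := by
  rintro ⟨m, n⟩
  rw [cf_one, cf_geo s hj]
  by_cases h : (m, n) = 0
  · rw [if_pos h, if_pos ⟨0, by simp_all⟩]
    simp
  · rw [if_neg h]
    split_ifs <;> simp

lemma Dom.one_majFac (k : ℕ) {j : ℕ} (hj : 1 ≤ j) : Dom 1 (majFac k j) := by
  have := ((Dom.one_geo 0 hj).pow 4).mul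
    ((((Dom.one_geo 0 hj).pow k).mul ((Dom.one_geo 1 hj).pow 2)).mul
      ((Dom.one_geo (-1) hj).pow 2))
  simpa only [majFac, one_pow, mul_one] using this

lemma norm_zpow_mul_pow_lt_one {ζ q : ℂ} (h1 : ‖ζ‖ * ‖q‖ < 1) (h2 : ‖q‖ < ‖ζ‖) {s : ℤ}
    (hs : s = 0 ∨ s = 1 ∨ s = -1) {j : ℕ} (hj : 1 ≤ j) : ‖ζ ^ s * q ^ j‖ < 1 := by
  have hz : 0 < ‖ζ‖ := (norm_nonneg _).trans_lt h2
  have hq : ‖q‖ < 1 := by nlinarith [norm_nonneg q]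
  have hqj : ‖q‖ ^ j ≤ ‖q‖ := pow_le_of_le_one (norm_nonneg _) hq.le (by omega)
  rw [norm_mul, norm_pow, norm_zpow]
  have h0 := zpow_pos hz s
  refine (mul_le_mul_of_nonneg_left hqj h0.le).trans_lt ?_
  rcases hs with rfl | rfl | rfl
  · simpa using hq
  · simpa using h1
  · rw [zpow_neg_one, inv_mul_lt_iff₀ hz, mul_one]
    exact h2

/-- The value of `geo 0 j ^ l * geo 1 j ^ 2 * geo (-1) j ^ 2`. -/
def den (l : ℕ) (ζ q : ℂ) (j : ℕ) : ℂ :=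
  (1 - q ^ j)⁻¹ ^ l * (1 - ζ * q ^ j)⁻¹ ^ 2 * (1 - ζ⁻¹ * q ^ j)⁻¹ ^ 2

lemma Ev.den {ζ q : ℂ} (h1 : ‖ζ‖ * ‖q‖ < 1) (h2 : ‖q‖ < ‖ζ‖) (l : ℕ) {j : ℕ} (hj : 1 ≤ j) :
    Ev ζ q (ChiGenus.geo 0 j ^ l * ChiGenus.geo 1 j ^ 2 * ChiGenus.geo (-1) j ^ 2)
      (den l ζ q j) := by
  have hz : ζ ≠ 0 := norm_pos_iff.1 ((norm_nonneg _).trans_lt h2)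
  have e0 := Ev.geo 0 hj (norm_zpow_mul_pow_lt_one h1 h2 (by simp) hj)
  have e1 := Ev.geo 1 hj (norm_zpow_mul_pow_lt_one h1 h2 (by simp) hj)
  have e2 := Ev.geo (-1) hj (norm_zpow_mul_pow_lt_one h1 h2 (by simp) hj)
  rw [zpow_zero, one_mul] at e0
  rw [zpow_one] at e1
  rw [zpow_neg_one] at e2
  exact (((e0.pow hz l).mul hz (e1.pow hz 2)).mul hz (e2.pow hz 2))

lemma Ev.fac {ζ q : ℂ} (h1 : ‖ζ‖ * ‖q‖ < 1) (h2 : ‖q‖ < ‖ζ‖) (k : ℕ) {j : ℕ} (hj : 1 ≤ j) :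
    Ev ζ q (fac k j) ((1 - q ^ j) ^ 4 * ChiGenus.den k ζ q j) := by
  have hz : ζ ≠ 0 := norm_pos_iff.1 ((norm_nonneg _).trans_lt h2)
  exact (((Ev.one ζ q).sub (Ev.X_pow ζ q j)).pow hz 4).mul hz (Ev.den h1 h2 k hj)

lemma Ev.majFac {ζ q : ℂ} (h1 : ‖ζ‖ * ‖q‖ < 1) (h2 : ‖q‖ < ‖ζ‖) (k : ℕ) {j : ℕ} (hj : 1 ≤ j) :
    Ev ζ q (majFac k j) (ChiGenus.den (4 + k) ζ q j) := by
  have := Ev.den h1 h2 (4 + k) hj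
  rwa [pow_add, mul_assoc, mul_assoc, ← mul_assoc (ChiGenus.geo 0 j ^ k)] at this

/-! ### Convergence of the infinite products -/

/-- `∏_{j ≥ 1} (1 - c q^j)`. -/
def eul (c q : ℂ) : ℂ := ∏' n : ℕ, (1 - c * q ^ (n + 1))

lemma summable_mul_pow_succ (c : ℂ) {q : ℂ} (hq : ‖q‖ < 1) :
    Summable fun n : ℕ => ‖-(c * q ^ (n + 1))‖ := by
  have := ((summable_nat_add_iff 1).2 (summable_geometric_of_lt_one (norm_nonneg q) hq)).mul_left ‖c‖
  simpa using this

lemma multipliable_eul (c : ℂ) {q : ℂ} (hq : ‖q‖ < 1) :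
    Multipliable fun n : ℕ => (1 - c * q ^ (n + 1)) := by
  simpa [sub_eq_add_neg] using multipliable_one_add_of_summable (summable_mul_pow_succ c hq)

lemma eul_ne_zero {c q : ℂ} (hq : ‖q‖ < 1) (h : ‖c‖ * ‖q‖ < 1) : eul c q ≠ 0 := by
  have := tprod_one_add_ne_zero_of_summable (f := fun n : ℕ => -(c * q ^ (n + 1))) (fun n => ?_)
    (summable_mul_pow_succ c hq)
  · simpa [eul, sub_eq_add_neg] using this
  · rw [← sub_eq_add_neg, sub_ne_zero]
    intro h1
    have h2 : ‖c * q ^ (n + 1)‖ < 1 := by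
      rw [norm_mul, norm_pow, pow_succ']
      calc ‖c‖ * (‖q‖ * ‖q‖ ^ n) = ‖c‖ * ‖q‖ * ‖q‖ ^ n := by ring
        _ ≤ ‖c‖ * ‖q‖ * 1 := by
          gcongr
          exact pow_le_one₀ (norm_nonneg _) hq.le
        _ < 1 := by simpa using h
    rw [← h1] at h2
    simp at h2

lemma tendsto_prod_eul (c : ℂ) {q : ℂ} (hq : ‖q‖ < 1) :
    Tendsto (fun N => ∏ j ∈ Finset.Icc 1 N, (1 - c * q ^ j)) atTop (𝓝 (eul c q)) := by
  refine ((multipliable_eul c hq).hasProd.tendsto_prod_nat).congr fun N => ?_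
  induction N with
  | zero => simp
  | succ N ih => rw [Finset.prod_range_succ, ih, Finset.prod_Icc_succ_top (by omega)]

/-- The limit of the products of `den`. -/
def eulDen (l : ℕ) (ζ q : ℂ) : ℂ := (eul 1 q)⁻¹ ^ l * (eul ζ q)⁻¹ ^ 2 * (eul ζ⁻¹ q)⁻¹ ^ 2

lemma tendsto_prod_den {ζ q : ℂ} (h1 : ‖ζ‖ * ‖q‖ < 1) (h2 : ‖q‖ < ‖ζ‖) (l : ℕ) :
    Tendsto (fun N => ∏ j ∈ Finset.Icc 1 N, den l ζ q j) atTop (𝓝 (eulDen l ζ q)) := by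
  have hz : 0 < ‖ζ‖ := (norm_nonneg _).trans_lt h2
  have hq : ‖q‖ < 1 := by nlinarith [norm_nonneg q]
  have h3 : ‖ζ⁻¹‖ * ‖q‖ < 1 := by rwa [norm_inv, inv_mul_lt_iff₀ hz, mul_one]
  have t0 := (((tendsto_prod_eul 1 hq).inv₀ (eul_ne_zero hq (by simpa using hq))).pow l)
  have t1 := (((tendsto_prod_eul ζ hq).inv₀ (eul_ne_zero hq h1)).pow 2)
  have t2 := (((tendsto_prod_eul ζ⁻¹ hq).inv₀ (eul_ne_zero hq h3)).pow 2)
  refine ((t0.mul t1).mul t2).congr fun N => ?_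
  simp only [den, Finset.prod_mul_distrib, Finset.prod_pow, Finset.prod_inv_distrib, one_mul]

lemma cf_prod_nonneg {Φ M : ℕ → ℤ[T;T⁻¹]⟦X⟧} (hd : ∀ j, 1 ≤ j → Dom (Φ j) (M j)) (N : ℕ)
    (x : ℤ × ℕ) : 0 ≤ cf (∏ j ∈ Finset.Icc 1 N, M j) x :=
  (abs_nonneg _).trans
    (Dom.prod (fun j hj => hd j (Finset.mem_Icc.1 hj).1 : ∀ j ∈ Finset.Icc 1 N, _) x)

lemma cf_prod_mono {M : ℕ → ℤ[T;T⁻¹]⟦X⟧} (hd : ∀ j, 1 ≤ j → Dom 1 (M j)) (x : ℤ × ℕ) :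
    Monotone fun N => cf (∏ j ∈ Finset.Icc 1 N, M j) x := by
  refine monotone_nat_of_le_succ fun N => ?_
  have h1 : Dom (∏ j ∈ Finset.Icc 1 N, M j) (∏ j ∈ Finset.Icc 1 N, M j) := fun x => by
    rw [abs_of_nonneg (cf_prod_nonneg hd N x)]
  have h2 := h1.mul (hd (N + 1) (by omega)) x
  rw [mul_one] at h2
  rw [Finset.prod_Icc_succ_top (by omega)]
  exact (le_abs_self _).trans h2

lemma cf_prod_le {M : ℕ → ℤ[T;T⁻¹]⟦X⟧} (hd : ∀ j, 1 ≤ j → Dom 1 (M j))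
    (hs : ∀ j, 1 ≤ j → PowerSeries.X ^ j ∣ M j - 1) (N : ℕ) (x : ℤ × ℕ) :
    cf (∏ j ∈ Finset.Icc 1 N, M j) x ≤ cf (∏ j ∈ Finset.Icc 1 x.2, M j) x := by
  rcases le_total N x.2 with h | h
  · exact cf_prod_mono hd x h
  · exact (cf_prod_stable hs x h).le

/-- The majorant has nonnegative coefficients, so a finite partial sum at (|ζ|, |q|) is at most the
value of a long enough partial product; these values converge and are therefore bounded. -/
lemma summable_majorant {M : ℕ → ℤ[T;T⁻¹]⟦X⟧} (hd : ∀ j, 1 ≤ j → Dom 1 (M j))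
    (hs : ∀ j, 1 ≤ j → PowerSeries.X ^ j ∣ M j - 1) {ζ q : ℂ} (hz : ζ ≠ 0) {v : ℕ → ℂ} {V : ℂ}
    (hv : ∀ j, 1 ≤ j → Ev ‖ζ‖ ‖q‖ (M j) (v j))
    (hV : Tendsto (fun N => ∏ j ∈ Finset.Icc 1 N, v j) atTop (𝓝 V)) :
    Summable fun x : ℤ × ℕ =>
      (cf (∏ j ∈ Finset.Icc 1 x.2, M j) x : ℝ) * (‖ζ‖ ^ x.1 * ‖q‖ ^ x.2) := by
  obtain ⟨B, hB⟩ := hV.norm.bddAbove_range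
  refine summable_of_sum_le (c := B) (fun x => ?_) fun u => ?_
  · have := cf_prod_nonneg hd x.2 x
    positivity
  · obtain ⟨N, hN⟩ : ∃ N, ∀ x ∈ u, x.2 ≤ N := ⟨u.sup Prod.snd, fun x hx => Finset.le_sup hx⟩
    have hE : Ev ‖ζ‖ ‖q‖ (∏ j ∈ Finset.Icc 1 N, M j) (∏ j ∈ Finset.Icc 1 N, v j) :=
      Ev.prod (by simpa using hz) fun j hj => hv j (Finset.mem_Icc.1 hj).1
    have e : ∀ x : ℤ × ℕ, ((cf (∏ j ∈ Finset.Icc 1 N, M j) x : ℂ) *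
        ((‖ζ‖ : ℂ) ^ x.1 * (‖q‖ : ℂ) ^ x.2)) =
        (((cf (∏ j ∈ Finset.Icc 1 N, M j) x : ℝ) * (‖ζ‖ ^ x.1 * ‖q‖ ^ x.2) : ℝ) : ℂ) :=
      fun x => by push_cast; rfl
    unfold Ev at hE
    simp only [e] at hE
    have hR := Complex.hasSum_re hE
    simp only [Complex.ofReal_re] at hR
    calc ∑ x ∈ u, (cf (∏ j ∈ Finset.Icc 1 x.2, M j) x : ℝ) * (‖ζ‖ ^ x.1 * ‖q‖ ^ x.2)
        = ∑ x ∈ u, (cf (∏ j ∈ Finset.Icc 1 N, M j) x : ℝ) * (‖ζ‖ ^ x.1 * ‖q‖ ^ x.2) := by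
          refine Finset.sum_congr rfl fun x hx => ?_
          rw [cf_prod_stable hs x (hN x hx)]
      _ ≤ _ := sum_le_hasSum u (fun x _ => by
          have := cf_prod_nonneg hd N x
          positivity) hR
      _ ≤ _ := Complex.re_le_norm _
      _ ≤ B := hB ⟨N, rfl⟩

/-- Evaluation of a formal infinite product with a convergent majorant. -/
lemma hasSum_formal_prod {Φ M : ℕ → ℤ[T;T⁻¹]⟦X⟧} (hΦM : ∀ j, 1 ≤ j → Dom (Φ j) (M j))
    (hd : ∀ j, 1 ≤ j → Dom 1 (M j)) (hΦ : ∀ j, 1 ≤ j → PowerSeries.X ^ j ∣ Φ j - 1)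
    (hM : ∀ j, 1 ≤ j → PowerSeries.X ^ j ∣ M j - 1) {ζ q : ℂ} (hz : ζ ≠ 0) {u v : ℕ → ℂ} {U V : ℂ}
    (hu : ∀ j, 1 ≤ j → Ev ζ q (Φ j) (u j)) (hv : ∀ j, 1 ≤ j → Ev ‖ζ‖ ‖q‖ (M j) (v j))
    (hU : Tendsto (fun N => ∏ j ∈ Finset.Icc 1 N, u j) atTop (𝓝 U))
    (hV : Tendsto (fun N => ∏ j ∈ Finset.Icc 1 N, v j) atTop (𝓝 V)) :
    HasSum (fun x : ℤ × ℕ => (cf (∏ j ∈ Finset.Icc 1 x.2, Φ j) x : ℂ) * (ζ ^ x.1 * q ^ x.2)) U := by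
  have hB := summable_majorant hd hM hz hv hV
  have hle : ∀ (N : ℕ) (x : ℤ × ℕ),
      ‖(cf (∏ j ∈ Finset.Icc 1 N, Φ j) x : ℂ) * (ζ ^ x.1 * q ^ x.2)‖ ≤
      (cf (∏ j ∈ Finset.Icc 1 x.2, M j) x : ℝ) * (‖ζ‖ ^ x.1 * ‖q‖ ^ x.2) := fun N x => by
    rw [norm_mul, norm_mul, norm_zpow, norm_pow, Complex.norm_intCast]
    gcongr
    exact_mod_cast (Dom.prod (fun j hj => hΦM j (Finset.mem_Icc.1 hj).1) x).trans
      (cf_prod_le hd hM N x)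
  -- Tannery's theorem: each coefficient of the partial products is eventually constant in N, and
  -- all of them are dominated by the summable majorant.
  have hlim := tendsto_tsum_of_dominated_convergence (𝓕 := atTop) hB
    (f := fun (N : ℕ) (x : ℤ × ℕ) =>
      (cf (∏ j ∈ Finset.Icc 1 N, Φ j) x : ℂ) * (ζ ^ x.1 * q ^ x.2))
    (g := fun x : ℤ × ℕ => (cf (∏ j ∈ Finset.Icc 1 x.2, Φ j) x : ℂ) * (ζ ^ x.1 * q ^ x.2))
    (fun x => tendsto_const_nhds.congr' (by
      filter_upwards [eventually_ge_atTop x.2] with N hN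
      rw [cf_prod_stable hΦ x hN])) (Eventually.of_forall fun N x => hle N x)
  have hsum : Summable fun x : ℤ × ℕ =>
      (cf (∏ j ∈ Finset.Icc 1 x.2, Φ j) x : ℂ) * (ζ ^ x.1 * q ^ x.2) :=
    hB.of_norm_bounded fun x => hle x.2 x
  have hE : ∀ N, ∑' x : ℤ × ℕ, (cf (∏ j ∈ Finset.Icc 1 N, Φ j) x : ℂ) * (ζ ^ x.1 * q ^ x.2) =
      ∏ j ∈ Finset.Icc 1 N, u j := fun N =>
    (Ev.prod hz fun j hj => hu j (Finset.mem_Icc.1 hj).1).tsum_eq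
  rw [← tendsto_nhds_unique (hlim.congr hE) hU]
  exact hsum.hasSum

/-- The expansion of `∏ (1 - q^j)^{4-k} (1 - ζ q^j)^{-2} (1 - ζ⁻¹ q^j)^{-2}`. -/
theorem hasSum_a {ζ q : ℂ} (h1 : ‖ζ‖ * ‖q‖ < 1) (h2 : ‖q‖ < ‖ζ‖) (k : ℕ) :
    HasSum (fun x : ℤ × ℕ => (a x.1 k x.2 : ℂ) * (ζ ^ x.1 * q ^ x.2))
      (eul 1 q ^ 4 * eulDen k ζ q) := by
  have hz : 0 < ‖ζ‖ := (norm_nonneg _).trans_lt h2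
  have hq : ‖q‖ < 1 := by nlinarith [norm_nonneg q]
  have h1' : ‖(‖ζ‖ : ℂ)‖ * ‖(‖q‖ : ℂ)‖ < 1 := by simpa using h1
  have h2' : ‖(‖q‖ : ℂ)‖ < ‖(‖ζ‖ : ℂ)‖ := by simpa using h2
  have hU : Tendsto (fun N => ∏ j ∈ Finset.Icc 1 N, ((1 - q ^ j) ^ 4 * den k ζ q j)) atTop
      (𝓝 (eul 1 q ^ 4 * eulDen k ζ q)) := by
    refine (((tendsto_prod_eul 1 hq).pow 4).mul (tendsto_prod_den h1 h2 k)).congr fun N => ?_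
    simp only [Finset.prod_mul_distrib, Finset.prod_pow, one_mul]
  refine hasSum_of_eq (fun x => ?_) (hasSum_formal_prod (fun j hj => Dom.fac k hj)
    (fun j hj => Dom.one_majFac k hj) (fun j hj => X_pow_dvd_fac_sub_one k hj)
    (fun j hj => X_pow_dvd_majFac_sub_one k hj) (norm_pos_iff.1 hz)
    (fun j hj => Ev.fac h1 h2 k hj) (fun j hj => Ev.majFac h1' h2' k hj) hU
    (tendsto_prod_den h1' h2' (4 + k)))
  rw [← partialProd_eq]
  rfl

/-! ### Generating functions of partitions and coloured partitions -/

open scoped PowerSeries.WithPiTopology in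
lemma coeff_prod_geo (n : ℕ) : PowerSeries.coeff n (∏ j ∈ Finset.Icc 1 n, geo 0 j) =
    (Fintype.card (Nat.Partition n) : ℤ[T;T⁻¹]) := by
  -- With discrete coefficients, coefficientwise convergence of Euler's product means that each
  -- coefficient is eventually equal to its limit.
  let _ : TopologicalSpace ℤ[T;T⁻¹] := ⊥
  have _ : DiscreteTopology ℤ[T;T⁻¹] := ⟨rfl⟩
  have hgeo : ∀ j, 1 ≤ j → ∑' i : ℕ, (PowerSeries.X : ℤ[T;T⁻¹]⟦X⟧) ^ (j * i) = geo 0 j := by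
    intro j hj
    have h : (1 - PowerSeries.X ^ j : ℤ[T;T⁻¹]⟦X⟧) * geo 0 j = 1 := by
      have := one_sub_mul_geo 0 hj
      rwa [C_T_zero_mul] at this
    have h2 := PowerSeries.WithPiTopology.tsum_pow_mul_one_sub_of_constantCoeff_eq_zero
      (f := (PowerSeries.X ^ j : ℤ[T;T⁻¹]⟦X⟧)) (by
        have : j ≠ 0 := by omega
        simp [this])
    simp only [← pow_mul] at h2
    exact left_inv_eq_right_inv h2 h
  have hp := (Nat.Partition.hasProd_powerSeriesMk_card_restricted ℤ[T;T⁻¹]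
    (fun _ => True)).tendsto_prod_nat
  rw [PowerSeries.WithPiTopology.tendsto_iff_coeff_tendsto] at hp
  have hn := hp n
  rw [nhds_discrete, tendsto_pure] at hn
  obtain ⟨N, hN, hN'⟩ := (hn.and (eventually_ge_atTop n)).exists
  have e : ∏ i ∈ Finset.range N, (if True then ∑' j : ℕ,
      (PowerSeries.X : ℤ[T;T⁻¹]⟦X⟧) ^ ((i + 1) * j) else 1) = ∏ j ∈ Finset.Icc 1 N, geo 0 j := by
    clear hN hN'
    induction N with
    | zero => simp
    | succ N ih =>
      rw [Finset.prod_range_succ, ih, Finset.prod_Icc_succ_top (by omega), if_pos trivial,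
        hgeo _ (by omega)]
  rw [e, PowerSeries.coeff_mk] at hN
  have hc : (Nat.Partition.restricted n fun _ => True).card = Fintype.card (Nat.Partition n) := by
    simp [Nat.Partition.restricted, Finset.card_univ]
  rw [← hc, ← hN]
  ext m
  exact (cf_prod_stable (fun j hj => X_pow_dvd_geo_sub_one 0 hj) (m, n) hN').symm

/-- The two-variable evaluation is applied at ζ = 1 to a product not involving ζ; each factor is its
own majorant, and only the indices (0, n) contribute. -/
lemma hasSum_card_partition {q : ℂ} (hq : ‖q‖ < 1) :
    HasSum (fun n : ℕ => (Fintype.card (Nat.Partition n) : ℂ) * q ^ n) (eul 1 q)⁻¹ := by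
  have hz : (1 : ℂ) ≠ 0 := one_ne_zero
  have hev : ∀ {r : ℂ}, ‖r‖ < 1 → ∀ j, 1 ≤ j → Ev 1 r (geo 0 j) (1 - r ^ j)⁻¹ := by
    intro r hr j hj
    have := Ev.geo (ζ := 1) (q := r) 0 hj (by
      simpa using pow_lt_one₀ (norm_nonneg _) hr (by omega))
    simpa using this
  have hlim : ∀ {r : ℂ}, ‖r‖ < 1 → Tendsto (fun N => ∏ j ∈ Finset.Icc 1 N, (1 - r ^ j)⁻¹) atTop
      (𝓝 (eul 1 r)⁻¹) := by
    intro r hr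
    refine ((tendsto_prod_eul 1 hr).inv₀ (eul_ne_zero hr (by simpa using hr))).congr fun N => ?_
    simp [Finset.prod_inv_distrib]
  have hq' : ‖(‖q‖ : ℂ)‖ < 1 := by simpa using hq
  have h := hasSum_formal_prod (fun j hj => Dom.geo_self 0 hj) (fun j hj => Dom.one_geo 0 hj)
    (fun j hj => X_pow_dvd_geo_sub_one 0 hj) (fun j hj => X_pow_dvd_geo_sub_one 0 hj) hz
    (hev hq) (by simpa using hev hq') (hlim hq) (hlim hq')
  have hi : Function.Injective (fun n : ℕ => ((0, n) : ℤ × ℕ)) := fun a b hab => by simpa using hab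
  have hc : ∀ (m : ℤ) (n : ℕ), cf (∏ j ∈ Finset.Icc 1 n, geo 0 j) (m, n) =
      if m = 0 then (Fintype.card (Nat.Partition n) : ℤ) else 0 := fun m n => by
    rw [cf, coeff_prod_geo, ← map_natCast LaurentPolynomial.C, LaurentPolynomial.C_apply]
  rw [← hi.hasSum_iff] at h
  · refine hasSum_of_eq (fun n => ?_) h
    simp only [Function.comp, hc]
    simp
  · rintro ⟨m, n⟩ hx
    have hm : m ≠ 0 := by
      rintro rfl
      exact hx ⟨n, rfl⟩
    simp [hc, hm]

lemma p_zero (n : ℕ) : p 0 n = if n = 0 then 1 else 0 := by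
  cases n <;> simp [p]

/-- Splitting off the first colour turns p_{k+1} into a convolution, which is what multiplies the
generating functions. -/
lemma p_succ (k n : ℕ) : p (k + 1) n = ∑ x ∈ Finset.HasAntidiagonal.antidiagonal n,
    Fintype.card (Nat.Partition x.1) * p k x.2 := by
  simp only [p, Finset.mul_sum]
  rw [Finset.sum_sigma']
  refine Finset.sum_bij' (fun x _ => ⟨(x 0, ∑ i, Fin.tail x i), Fin.tail x⟩)
    (fun y _ => Fin.cons y.1.1 y.2) ?_ ?_ ?_ ?_ ?_
  · intro x hx
    rw [Finset.Nat.mem_antidiagonalTuple, Fin.sum_univ_succ] at hx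
    simp only [Finset.mem_sigma, Finset.HasAntidiagonal.mem_antidiagonal,
      Finset.Nat.mem_antidiagonalTuple, and_true]
    exact hx
  · rintro ⟨⟨i, j⟩, y⟩ hy
    simp only [Finset.mem_sigma, Finset.HasAntidiagonal.mem_antidiagonal,
      Finset.Nat.mem_antidiagonalTuple] at hy
    rw [Finset.Nat.mem_antidiagonalTuple, Fin.sum_univ_succ]
    simp [hy]
  · intro x _
    simp
  · rintro ⟨⟨i, j⟩, y⟩ hy
    simp only [Finset.mem_sigma, Finset.HasAntidiagonal.mem_antidiagonal,
      Finset.Nat.mem_antidiagonalTuple] at hy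
    simp [hy]
  · intro x _
    rw [Fin.prod_univ_succ]
    rfl

lemma hasSum_p (k : ℕ) {q : ℂ} (hq : ‖q‖ < 1) :
    HasSum (fun n : ℕ => (p k n : ℂ) * q ^ n) ((eul 1 q)⁻¹ ^ k) := by
  induction k with
  | zero =>
    convert hasSum_single 0 (f := fun n : ℕ => (p 0 n : ℂ) * q ^ n) ?_
    · simp [p_zero]
    · intro n hn
      simp [p_zero, hn]
  | succ k ih =>
    have h1 := hasSum_card_partition hq
    have hs := summable_norm_sum_mul_antidiagonal_of_summable_norm h1.summable.norm ih.summable.norm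
    have ht := tsum_mul_tsum_eq_tsum_sum_antidiagonal_of_summable_norm h1.summable.norm
      ih.summable.norm
    rw [h1.tsum_eq, ih.tsum_eq] at ht
    rw [pow_succ', ht]
    refine hasSum_of_eq (fun n => ?_) hs.of_norm.hasSum
    rw [p_succ]
    push_cast
    rw [Finset.sum_mul]
    refine Finset.sum_congr rfl fun x hx => ?_
    rw [← Finset.HasAntidiagonal.mem_antidiagonal.1 hx, pow_add]
    ring

end
end ChiGenus

namespace ChiGenus
noncomputable section
open Filter Topology

/-! ### The product form of f_k -/

lemma eta_eq (τ : ℂ) : ModularForm.eta τ =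
    Function.Periodic.qParam 24 τ * eul 1 (nome τ) := by
  rw [ModularForm.eta, eul]
  congr 2
  funext n
  rw [ModularForm.eta_q_eq_pow, nome, one_mul]

lemma norm_nome (τ : ℂ) : ‖nome τ‖ = Real.exp (-(2 * Real.pi * τ.im)) := by
  rw [nome, Complex.norm_exp]
  simp

lemma norm_zeta (w : ℂ) : ‖zeta w‖ = Real.exp (-(2 * Real.pi * w.im)) := norm_nome w

lemma theta_eq {w τ : ℂ} (hτ : 0 < τ.im) : theta w τ =
    Complex.I * Complex.exp (Real.pi * Complex.I * w) * Function.Periodic.qParam 24 τ ^ 3 *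
      (eul 1 (nome τ) * eul (zeta w) (nome τ) * ((1 - (zeta w)⁻¹) * eul (zeta w)⁻¹ (nome τ))) := by
  have hq : ‖nome τ‖ < 1 := by
    rw [norm_nome, Real.exp_lt_one_iff]
    have := Real.pi_pos
    nlinarith [mul_pos this hτ]
  have e1 : Complex.exp (2 * Real.pi * Complex.I * τ / 8) =
      Function.Periodic.qParam 24 τ ^ 3 := by
    rw [Function.Periodic.qParam, ← Complex.exp_nat_mul]
    congr 1
    push_cast
    ring
  have m1 := multipliable_eul 1 hq
  have m2 := multipliable_eul (zeta w) hq
  have m3 := multipliable_eul (zeta w)⁻¹ hq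
  have m3' : Multipliable fun n : ℕ => (1 - (zeta w)⁻¹ * nome τ ^ n) := by
    have : Summable fun n : ℕ => ‖-((zeta w)⁻¹ * nome τ ^ n)‖ := by
      simpa using (summable_geometric_of_lt_one (norm_nonneg _) hq).mul_left ‖zeta w‖⁻¹
    simpa [sub_eq_add_neg] using multipliable_one_add_of_summable this
  have e2 : ∏' n : ℕ, (1 - (zeta w)⁻¹ * nome τ ^ n) =
      (1 - (zeta w)⁻¹) * eul (zeta w)⁻¹ (nome τ) := by
    rw [tprod_eq_zero_mul' (f := fun n : ℕ => 1 - (zeta w)⁻¹ * nome τ ^ n) m3, pow_zero, mul_one]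
    rfl
  simp only [one_mul] at m1
  rw [theta, e1, (m1.mul m2).tprod_mul m3', m1.tprod_mul m2, e2]
  simp only [eul, one_mul]

/-- The factor 1 - ζ⁻¹ of ϑ cancels against ζ^{1/2} - ζ^{-1/2}, and the three factors q^{1/24} of η³
against q^{1/8}. The case ζ = 1 is excluded because the quotient defining g is then 0/0, while the
product is regular there. -/
lemma f_eq (k : ℕ) {w τ : ℂ} (hτ : 0 < τ.im) (hw : |w.im| < τ.im) (hz : zeta w ≠ 1) :
    f k w τ = eul 1 (nome τ) ^ 4 * eulDen k (zeta w) (nome τ) *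
      (Function.Periodic.qParam 24 τ ^ k)⁻¹ := by
  have hpi := Real.pi_pos
  have hq : ‖nome τ‖ < 1 := by
    rw [norm_nome, Real.exp_lt_one_iff]
    nlinarith [mul_pos hpi hτ]
  have hw' := abs_lt.1 hw
  have h1 : ‖zeta w‖ * ‖nome τ‖ < 1 := by
    rw [norm_nome, norm_zeta, ← Real.exp_add, Real.exp_lt_one_iff]
    nlinarith
  have h2 : ‖(zeta w)⁻¹‖ * ‖nome τ‖ < 1 := by
    rw [norm_inv, norm_nome, norm_zeta, ← Real.exp_neg, ← Real.exp_add, Real.exp_lt_one_iff]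
    nlinarith
  have hE := eul_ne_zero hq (c := 1) (by simpa using hq)
  have hE1 := eul_ne_zero hq h1
  have hE2 := eul_ne_zero hq h2
  have h24 : Function.Periodic.qParam 24 τ ≠ 0 := Complex.exp_ne_zero _
  have hu : zeta w = Complex.exp (Real.pi * Complex.I * w) ^ 2 := by
    rw [zeta, ← Complex.exp_nat_mul]
    congr 1
    push_cast
    ring
  have hg : g w τ = eul 1 (nome τ) ^ 2 / (eul (zeta w) (nome τ) * eul (zeta w)⁻¹ (nome τ)) := by
    rw [g, theta_eq hτ, eta_eq, Complex.exp_neg]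
    generalize eul (zeta w) (nome τ) = A at *
    generalize eul (zeta w)⁻¹ (nome τ) = B at *
    have hu0 := Complex.exp_ne_zero (Real.pi * Complex.I * w)
    generalize Complex.exp (Real.pi * Complex.I * w) = u at *
    rw [hu] at hz ⊢
    have h3 : u ^ 2 - 1 ≠ 0 := sub_ne_zero.2 hz
    have h4 : 1 - (u ^ 2)⁻¹ = (u ^ 2 - 1) / u ^ 2 := by field_simp
    have h5 : u - u⁻¹ = (u ^ 2 - 1) / u := by field_simp
    rw [h4, h5]
    have hI := Complex.I_ne_zero
    field_simp
  rw [f, hg, eta_eq, eulDen]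
  generalize eul (zeta w) (nome τ) = A at *
  generalize eul (zeta w)⁻¹ (nome τ) = B at *
  generalize eul 1 (nome τ) = E at *
  generalize Function.Periodic.qParam 24 τ = e at *
  rw [mul_pow, inv_pow E]
  field_simp

theorem hasSum_f (k : ℕ) {w τ : ℂ} (hτ : 0 < τ.im) (hw : |w.im| < τ.im) (hz : zeta w ≠ 1) :
    HasSum (fun x : ℤ × ℕ => (a x.1 k x.2 : ℂ) * zeta w ^ x.1 *
      Complex.exp (2 * Real.pi * Complex.I * τ * ((x.2 : ℂ) - (k : ℂ) / 24))) (f k w τ) := by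
  have hpi := Real.pi_pos
  have hw' := abs_lt.1 hw
  have h1 : ‖zeta w‖ * ‖nome τ‖ < 1 := by
    rw [norm_nome, norm_zeta, ← Real.exp_add, Real.exp_lt_one_iff]
    nlinarith
  have h2 : ‖nome τ‖ < ‖zeta w‖ := by
    rw [norm_nome, norm_zeta, Real.exp_lt_exp]
    nlinarith
  rw [f_eq k hτ hw hz]
  refine hasSum_of_eq (fun x => ?_) ((hasSum_a h1 h2 k).mul_right _)
  rw [mul_assoc, mul_assoc, mul_assoc]
  congr 2
  rw [nome, Function.Periodic.qParam, ← Complex.exp_nat_mul, ← Complex.exp_nat_mul,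
    ← Complex.exp_neg, ← Complex.exp_add]
  congr 1
  push_cast
  ring

/-! ### Extraction of Fourier and Laurent coefficients -/

lemma integral_exp_int_mul (j : ℤ) : ∫ y in (-Real.pi)..Real.pi,
    Complex.exp (j * Complex.I * (y : ℂ)) = if j = 0 then (2 * Real.pi : ℂ) else 0 := by
  split_ifs with h
  · subst h
    simp
    ring
  · have hc : (j : ℂ) * Complex.I ≠ 0 := mul_ne_zero (by exact_mod_cast h) Complex.I_ne_zero
    rw [integral_exp_mul_complex hc, div_eq_zero_iff]
    left
    rw [sub_eq_zero, Complex.exp_eq_exp_iff_exists_int]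
    exact ⟨j, by push_cast; ring⟩

/-- Fourier coefficients of an absolutely convergent trigonometric series. -/
lemma integral_fourier_series {ι : Type*} [Countable ι] {κ : ι → ℤ} (hκ : Function.Injective κ)
    {c : ι → ℂ} (hc : Summable fun i => ‖c i‖) (i₀ : ι) :
    ∫ y in (-Real.pi)..Real.pi, (∑' i, c i * Complex.exp (κ i * Complex.I * (y : ℂ))) *
      Complex.exp (-(κ i₀ * Complex.I * (y : ℂ))) = 2 * Real.pi * c i₀ := by
  have hn : ∀ (j : ℤ) (y : ℝ), ‖Complex.exp (j * Complex.I * (y : ℂ))‖ = 1 := fun j y => by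
    rw [Complex.norm_exp]
    simp
  have hn' : ∀ (j : ℤ) (y : ℝ), ‖Complex.exp (-(j * Complex.I * (y : ℂ)))‖ = 1 := fun j y => by
    rw [Complex.norm_exp]
    simp
  have h := intervalIntegral.hasSum_integral_of_dominated_convergence (μ := MeasureTheory.volume)
    (a := -Real.pi) (b := Real.pi)
    (F := fun i y => c i * Complex.exp (κ i * Complex.I * (y : ℂ)) *
      Complex.exp (-(κ i₀ * Complex.I * (y : ℂ))))
    (f := fun y => (∑' i, c i * Complex.exp (κ i * Complex.I * (y : ℂ))) *
      Complex.exp (-(κ i₀ * Complex.I * (y : ℂ))))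
    (fun i _ => ‖c i‖) (fun i => by
      apply Continuous.aestronglyMeasurable
      fun_prop)
    (fun i => Eventually.of_forall fun y _ => by
      rw [norm_mul, norm_mul, hn, hn', mul_one, mul_one])
    (Eventually.of_forall fun y _ => hc)
    (by simp)
    (Eventually.of_forall fun y _ => by
      refine HasSum.mul_right _ (Summable.hasSum ?_)
      refine Summable.of_norm ?_
      simpa only [norm_mul, hn, mul_one] using hc)
  rw [← h.tsum_eq, tsum_eq_single i₀]
  · have : ∀ y : ℝ, c i₀ * Complex.exp (κ i₀ * Complex.I * (y : ℂ)) *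
      Complex.exp (-(κ i₀ * Complex.I * (y : ℂ))) = c i₀ := fun y => by
      rw [mul_assoc, ← Complex.exp_add, add_neg_cancel, Complex.exp_zero, mul_one]
    simp only [this, intervalIntegral.integral_const]
    rw [Complex.real_smul]
    push_cast
    ring
  · intro i hi
    have : ∀ y : ℝ, c i * Complex.exp (κ i * Complex.I * (y : ℂ)) *
      Complex.exp (-(κ i₀ * Complex.I * (y : ℂ))) =
        c i * Complex.exp ((κ i - κ i₀ : ℤ) * Complex.I * (y : ℂ)) := fun y => by
      rw [mul_assoc, ← Complex.exp_add]
      congr 2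
      push_cast
      ring
    simp only [this]
    rw [intervalIntegral.integral_const_mul, integral_exp_int_mul, if_neg, mul_zero]
    exact fun h => hi (hκ (sub_eq_zero.1 h))

lemma laurent_eq_zero {c : ℤ → ℂ} {r : ℝ} (hr : 0 < r)
    (h : ∀ ζ : ℂ, ‖ζ‖ = r → HasSum (fun m => c m * ζ ^ m) 0) (m : ℤ) : c m = 0 := by
  have hr' : (r : ℂ) ≠ 0 := by exact_mod_cast hr.ne'
  have hs : Summable fun m => ‖c m * (r : ℂ) ^ m‖ :=
    (h r (by simp [abs_of_pos hr])).summable.norm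
  have hi := integral_fourier_series (κ := id) Function.injective_id hs m
  have e : ∀ y : ℝ, ∑' i : ℤ, c i * (r : ℂ) ^ i * Complex.exp ((id i : ℤ) * Complex.I * (y : ℂ))
      = 0 := fun y => by
    rw [← (h (r * Complex.exp (Complex.I * y)) (by
      rw [norm_mul, mul_comm Complex.I, Complex.norm_exp_ofReal_mul_I]
      simp [abs_of_pos hr])).tsum_eq]
    refine tsum_congr fun i => ?_
    rw [mul_zpow, ← Complex.exp_int_mul, mul_assoc, id]
    congr 3
    ring
  simp only [e, zero_mul, intervalIntegral.integral_zero] at hi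
  have hpi : (2 * Real.pi : ℂ) ≠ 0 := by
    exact_mod_cast (mul_pos two_pos Real.pi_pos).ne'
  have := (mul_eq_zero.1 hi.symm).resolve_left hpi
  exact (mul_eq_zero.1 this).resolve_right (zpow_ne_zero _ hr')

/-- Uniqueness of Laurent coefficients on a circle. -/
lemma laurent_unique {c d : ℤ → ℂ} {r : ℝ} (hr : 0 < r) {v : ℂ → ℂ}
    (hc : ∀ ζ : ℂ, ‖ζ‖ = r → HasSum (fun m => c m * ζ ^ m) (v ζ))
    (hd : ∀ ζ : ℂ, ‖ζ‖ = r → HasSum (fun m => d m * ζ ^ m) (v ζ)) (m : ℤ) : c m = d m := by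
  refine sub_eq_zero.1 (laurent_eq_zero (c := fun m => c m - d m) hr (fun ζ hζ => ?_) m)
  have := (hc ζ hζ).sub (hd ζ hζ)
  rw [sub_self] at this
  exact hasSum_of_eq (fun m => by ring) this

/-! ### The coefficient functions of g² and their partial theta series -/

/-- The coefficient of `ζ^m` in the expansion of `q^{k/24} f_k`. -/
def A (k : ℕ) (m : ℤ) (q : ℂ) : ℂ := ∑' n : ℕ, (a m k n : ℂ) * q ^ n

/-- `q^{k/24} f_k` away from its removable singularities. -/
def gf (k : ℕ) (ζ q : ℂ) : ℂ := eul 1 q ^ 4 * eulDen k ζ q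

lemma hasSum_A (k : ℕ) (m : ℤ) {q : ℂ} (hq : ‖q‖ < 1) :
    HasSum (fun n : ℕ => (a m k n : ℂ) * q ^ n) (A k m q) := by
  have h := (hasSum_a (ζ := 1) (q := q) (by simpa using hq) (by simpa using hq) k).summable
  have h' := h.prod_factor m
  simp only [one_zpow, one_mul] at h'
  exact h'.hasSum

lemma hasSum_A_zpow (k : ℕ) {ζ q : ℂ} (h1 : ‖ζ‖ * ‖q‖ < 1) (h2 : ‖q‖ < ‖ζ‖) :
    HasSum (fun m : ℤ => A k m q * ζ ^ m) (gf k ζ q) := by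
  have hz : 0 < ‖ζ‖ := (norm_nonneg _).trans_lt h2
  have hq : ‖q‖ < 1 := by nlinarith [norm_nonneg q]
  refine (hasSum_a h1 h2 k).prod_fiberwise fun m => ?_
  exact hasSum_of_eq (fun n => by ring) ((hasSum_A k m hq).mul_right (ζ ^ m))

/-- η^{-k} is free of ζ, so it factors out of every Laurent coefficient; everything about k is
thereby separated from everything about m. -/
lemma A_eq (k : ℕ) (m : ℤ) {q : ℂ} (hq : ‖q‖ < 1) : A k m q = (eul 1 q)⁻¹ ^ k * A 0 m q := by
  refine laurent_unique (c := fun m => A k m q) (d := fun m => (eul 1 q)⁻¹ ^ k * A 0 m q)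
    (r := 1) one_pos (v := fun ζ => gf k ζ q) (fun ζ hζ => ?_) (fun ζ hζ => ?_) m
  · exact hasSum_A_zpow k (by simpa [hζ] using hq) (by simpa [hζ] using hq)
  · have := (hasSum_A_zpow 0 (ζ := ζ) (q := q) (by simpa [hζ] using hq)
      (by simpa [hζ] using hq)).mul_left ((eul 1 q)⁻¹ ^ k)
    have e : gf k ζ q = (eul 1 q)⁻¹ ^ k * gf 0 ζ q := by
      rw [gf, gf, eulDen, eulDen]
      ring
    rw [e]
    exact hasSum_of_eq (fun m => by ring) this

lemma gf_inv (k : ℕ) (ζ q : ℂ) : gf k ζ⁻¹ q = gf k ζ q := by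
  rw [gf, gf, eulDen, eulDen, inv_inv]
  ring

lemma A_neg (k : ℕ) (m : ℤ) {q : ℂ} (hq : ‖q‖ < 1) : A k (-m) q = A k m q := by
  refine laurent_unique (c := fun m => A k (-m) q) (d := fun m => A k m q)
    (r := 1) one_pos (v := fun ζ => gf k ζ q) (fun ζ hζ => ?_) (fun ζ hζ => ?_) m
  · have := hasSum_A_zpow k (ζ := ζ⁻¹) (q := q) (by simpa [hζ] using hq) (by simpa [hζ] using hq)
    rw [gf_inv, ← (Equiv.neg ℤ).hasSum_iff] at this
    exact hasSum_of_eq (fun m => by simp) this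
  · exact hasSum_A_zpow k (by simpa [hζ] using hq) (by simpa [hζ] using hq)

/-- At ζ = 1 the product for g² collapses to 1. -/
lemma hasSum_A_zero {q : ℂ} (hq : ‖q‖ < 1) : HasSum (fun m : ℤ => A 0 m q) 1 := by
  have := hasSum_A_zpow 0 (ζ := 1) (q := q) (by simpa using hq) (by simpa using hq)
  simp only [one_zpow, mul_one] at this
  convert this
  have hE := eul_ne_zero hq (c := 1) (by simpa using hq)
  rw [gf, eulDen, inv_one]
  field_simp

/-- The `r`-th Laurent coefficient of `ζ (1 - ζ)⁻² g²` in the annulus `|q| < |ζ| < 1`. -/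
def H (q : ℂ) (r : ℤ) : ℂ := ∑' s : ℕ, (s : ℂ) * A 0 (r - s) q

lemma exists_real_between_norm {q : ℂ} (hq : ‖q‖ < 1) : ∃ ρ : ℝ, ‖q‖ < ρ ∧ ρ < 1 ∧ 0 < ρ := by
  obtain ⟨ρ, h1, h2⟩ := exists_between hq
  exact ⟨ρ, h1, h2, (norm_nonneg _).trans_lt h1⟩

lemma exists_shear_equiv : ∃ e : ℤ × ℕ ≃ ℤ × ℕ, ∀ x, e x = (x.1 - x.2, x.2) :=
  ⟨⟨fun x => (x.1 - x.2, x.2), fun x => (x.1 + x.2, x.2),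
    fun _ => Prod.ext (sub_add_cancel _ _) rfl, fun _ => Prod.ext (add_sub_cancel_right _ _) rfl⟩,
    fun _ => rfl⟩

lemma hasSum_mul_hasSum {ι κ : Type*} {f : ι → ℂ} {g : κ → ℂ} {u v : ℂ} (hf : HasSum f u)
    (hg : HasSum g v) : HasSum (fun x : ι × κ => f x.1 * g x.2) (u * v) :=
  hf.mul hg (summable_mul_of_summable_norm hf.summable.norm hg.summable.norm)

/-- For |ζ| < 1 one has ζ/(1-ζ)² = Σ s ζ^s, and g² is expanded in |q| < |ζ| < 1/|q|; a shear of the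
index set collects equal powers of ζ in the product. -/
lemma hasSum_H_zpow_aux {ζ q : ℂ} (h2 : ‖q‖ < ‖ζ‖) (h3 : ‖ζ‖ < 1) :
    (∀ r : ℤ, Summable fun s : ℕ => (s : ℂ) * A 0 (r - s) q) ∧
    HasSum (fun r : ℤ => H q r * ζ ^ r) (ζ / (1 - ζ) ^ 2 * gf 0 ζ q) := by
  have hz : 0 < ‖ζ‖ := (norm_nonneg _).trans_lt h2
  have hz' : ζ ≠ 0 := norm_pos_iff.1 hz
  have h1 : ‖ζ‖ * ‖q‖ < 1 := mul_lt_one_of_nonneg_of_lt_one_left (norm_nonneg _) h3 (h2.trans h3).le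
  have hA := hasSum_A_zpow 0 h1 h2
  have hg : HasSum (fun n : ℕ => (n : ℂ) * ζ ^ n) (ζ / (1 - ζ) ^ 2) :=
    hasSum_coe_mul_geometric_of_norm_lt_one h3
  have hp := hasSum_mul_hasSum hA hg
  obtain ⟨e, he⟩ : ∃ e : ℤ × ℕ ≃ ℤ × ℕ, ∀ x, e x = (x.1 - x.2, x.2) :=
    exists_shear_equiv
  rw [← e.hasSum_iff] at hp
  have hterm : ∀ x : ℤ × ℕ, ((fun x : ℤ × ℕ => A 0 x.1 q * ζ ^ x.1 * (x.2 * ζ ^ x.2)) ∘ e) x =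
      (x.2 : ℂ) * A 0 (x.1 - x.2) q * ζ ^ x.1 := fun x => by
    rw [Function.comp, he]
    dsimp only
    rw [zpow_sub₀ hz', zpow_natCast]
    generalize A 0 (x.1 - x.2) q = B
    have := pow_ne_zero x.2 hz'
    field_simp
  have hp' := hasSum_of_eq hterm hp
  have hsm : ∀ r : ℤ, Summable fun s : ℕ => (s : ℂ) * A 0 (r - s) q := fun r => by
    have := (hp'.summable.prod_factor r).mul_right (ζ ^ r)⁻¹
    refine this.congr fun s => ?_
    rw [mul_assoc _ (ζ ^ r), mul_inv_cancel₀ (zpow_ne_zero r hz'), mul_one]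
  refine ⟨hsm, ?_⟩
  have h4 : ∀ r : ℤ, HasSum (fun s : ℕ => (s : ℂ) * A 0 (r - s) q * ζ ^ r) (H q r * ζ ^ r) :=
    fun r => (hsm r).hasSum.mul_right (ζ ^ r)
  have h5 := HasSum.prod_fiberwise hp' h4
  rwa [mul_comm (gf 0 ζ q)] at h5

lemma summable_H {q : ℂ} (hq : ‖q‖ < 1) (r : ℤ) :
    Summable fun s : ℕ => (s : ℂ) * A 0 (r - s) q := by
  obtain ⟨ρ, h1, h2, h3⟩ := exists_real_between_norm hq
  have e : ‖(ρ : ℂ)‖ = ρ := by simp [abs_of_pos h3]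
  exact (hasSum_H_zpow_aux (ζ := ρ) (by rwa [e]) (by rwa [e])).1 r

lemma eul_mul_self {c q : ℂ} (hq : ‖q‖ < 1) : eul c q = (1 - c * q) * eul (c * q) q := by
  rw [eul, tprod_eq_zero_mul' (f := fun n : ℕ => 1 - c * q ^ (n + 1))]
  · simp only [eul, zero_add, pow_one]
    congr 2
    funext n
    ring
  · refine (multipliable_eul (c * q) hq).congr fun n => ?_
    ring

/-- Quasi-periodicity of the theta function. For 1 < |ζ| < 1/|q| both ζq and ζ⁻¹ lie in |q| < |·| <
1, where the same expansion holds, and the two values differ by the factor qζ². Comparing Laurent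
coefficients gives the relation. -/
lemma H_neg {q : ℂ} (hq0 : q ≠ 0) (hq : ‖q‖ < 1) (r : ℤ) :
    H q (-r) = q ^ (r + 1) * H q (r + 2) := by
  have hqn : 0 < ‖q‖ := norm_pos_iff.2 hq0
  obtain ⟨ρ, h1, h2⟩ := exists_between (one_lt_inv₀ hqn |>.2 hq)
  have hρ : 0 < ρ := one_pos.trans h1
  have h2' : ρ * ‖q‖ < 1 := by
    have := mul_lt_mul_of_pos_right h2 hqn
    rwa [inv_mul_cancel₀ hqn.ne'] at this
  have key : ∀ m : ℤ, H q m * q ^ m = q * H q (2 - m) := by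
    refine laurent_unique (c := fun m => H q m * q ^ m) (d := fun m => q * H q (2 - m)) hρ
      (v := fun ζ => ζ * q / (1 - ζ * q) ^ 2 * gf 0 (ζ * q) q) (fun ζ hζ => ?_) (fun ζ hζ => ?_)
    · have := (hasSum_H_zpow_aux (ζ := ζ * q) (q := q) (by
        rw [norm_mul, hζ]; nlinarith) (by rwa [norm_mul, hζ])).2
      exact hasSum_of_eq (fun m => by rw [mul_zpow]; ring) this
    · have hz : ζ ≠ 0 := norm_pos_iff.1 (by rw [hζ]; exact hρ)
      have h3 : ‖ζ⁻¹‖ < 1 := by rw [norm_inv, hζ]; exact inv_lt_one_of_one_lt₀ h1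
      have h4 : ‖q‖ < ‖ζ⁻¹‖ := by
        rw [norm_inv, hζ, lt_inv_comm₀ hqn hρ]
        exact h2
      have h5 := ((hasSum_H_zpow_aux h4 h3).2).mul_left (q * ζ ^ 2)
      let e : ℤ ≃ ℤ := Equiv.subLeft 2
      rw [← e.hasSum_iff] at h5
      have hζ1 : ζ - 1 ≠ 0 := sub_ne_zero.2 fun h => by
        rw [h] at hζ
        simp at hζ
        linarith
      have hζq : 1 - ζ * q ≠ 0 := sub_ne_zero.2 fun h => by
        have := congrArg norm h
        rw [norm_mul, hζ] at this
        simp at this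
        linarith
      -- Under ζ → ζq the product (ζq; q)_∞ loses its first factor and (ζ⁻¹q; q)_∞ gains the factor
      -- 1 - ζ⁻¹.
      have e1 : gf 0 (ζ * q) q = (1 - ζ * q) ^ 2 / (1 - ζ⁻¹) ^ 2 * gf 0 ζ q := by
        have hA := eul_mul_self (c := ζ) hq
        have hB := eul_mul_self (c := (ζ * q)⁻¹) hq
        have hBc : (ζ * q)⁻¹ * q = ζ⁻¹ := by field_simp
        rw [hBc] at hB
        rw [gf, gf, eulDen, eulDen, hA, hB]
        have hζ2 : 1 - ζ⁻¹ ≠ 0 := by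
          have : 1 - ζ⁻¹ = (ζ - 1) / ζ := by field_simp
          rw [this]
          exact div_ne_zero hζ1 hz
        simp only [mul_inv, mul_pow, pow_zero]
        generalize eul (ζ * q) q = A
        generalize eul ζ⁻¹ q = B
        generalize eul 1 q = C
        simp only [inv_pow]
        rw [div_eq_mul_inv]
        have h6 : (1 - ζ * q) ^ 2 * ((1 - ζ * q) ^ 2)⁻¹ = 1 := mul_inv_cancel₀ (pow_ne_zero _ hζq)
        linear_combination (-(C ^ 4 * (A ^ 2)⁻¹ * ((1 - ζ⁻¹) ^ 2)⁻¹ * (B ^ 2)⁻¹)) * h6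
      have e2 : ζ * q / (1 - ζ * q) ^ 2 * gf 0 (ζ * q) q =
          q * ζ ^ 2 * (ζ⁻¹ / (1 - ζ⁻¹) ^ 2 * gf 0 ζ⁻¹ q) := by
        rw [e1, gf_inv]
        have : 1 - ζ⁻¹ = (ζ - 1) / ζ := by field_simp
        rw [this]
        field_simp
      simp only [e2]
      refine hasSum_of_eq (fun m => ?_) h5
      simp only [Function.comp, e, Equiv.subLeft_apply]
      rw [inv_zpow, zpow_sub₀ hz, inv_div]
      have := zpow_ne_zero m hz
      have h7 : ζ ^ (2 : ℤ) = ζ ^ 2 := by norm_cast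
      rw [h7]
      field_simp
  have h := key (r + 2)
  have e : (2 - (r + 2) : ℤ) = -r := by ring
  have e' : q ^ (r + 2) = q * q ^ (r + 1) := by
    rw [← zpow_one_add₀ hq0]
    congr 1
    ring
  rw [e, e'] at h
  exact mul_left_cancel₀ hq0 (by linear_combination -h)

lemma hasSum_mul_A {q : ℂ} (hq : ‖q‖ < 1) (r : ℤ) :
    HasSum (fun s : ℤ => (s : ℂ) * A 0 (r - s) q) (H q r - H q (-r)) := by
  have h1 := (summable_H hq r).hasSum
  have h2 := (summable_H hq (-r)).hasSum.neg
  have := HasSum.of_nat_of_neg (f := fun s : ℤ => (s : ℂ) * A 0 (r - s) q)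
    (g := H q r) (g' := -H q (-r)) (hasSum_of_eq (fun s => by simp) h1)
    (hasSum_of_eq (fun s => by
      rw [← A_neg 0 (-r - s) hq]
      have : -(-r - (s : ℤ)) = r - -(s : ℤ) := by ring
      rw [this]
      push_cast
      ring) h2)
  simpa [sub_eq_add_neg] using this

/-- The difference is the two-sided sum Σ_s s A(r-s) = Σ_l (r-l) A(l). Here Σ A(l) = 1, and Σ l A(l)
= 0 because A is even. Analytically it is the contribution of the double pole at ζ = 1. -/
lemma H_sub_H_neg {q : ℂ} (hq : ‖q‖ < 1) (r : ℤ) : H q r - H q (-r) = r := by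
  have h0 := hasSum_mul_A hq 0
  simp only [neg_zero, sub_self, zero_sub] at h0
  have h1 := hasSum_mul_A hq r
  have h2 := (hasSum_A_zero hq).mul_left (r : ℂ)
  rw [← (Equiv.neg ℤ).hasSum_iff] at h0
  have h3 := h2.add h0
  rw [← (Equiv.subLeft r).hasSum_iff] at h3
  have h4 := hasSum_of_eq (g := fun s : ℤ => (s : ℂ) * A 0 (r - s) q) (fun s => by
    simp
    ring) h3
  have := h1.unique h4
  simpa using this

lemma H_recursion {q : ℂ} (hq0 : q ≠ 0) (hq : ‖q‖ < 1) (r : ℤ) :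
    H q r = r + q ^ (r + 1) * H q (r + 2) := by
  rw [← H_neg hq0 hq, ← H_sub_H_neg hq r]
  ring

/-- H(-r) is dominated by a tail of the absolutely convergent series for H(0), so the growth comes
only from the summand r. This controls the remainder when the recursion is iterated. -/
lemma exists_norm_H_le {q : ℂ} (hq : ‖q‖ < 1) : ∃ M : ℝ, ∀ r : ℕ, ‖H q r‖ ≤ r + M := by
  have h0 := (summable_H hq 0).norm
  refine ⟨∑' s : ℕ, ‖(s : ℂ) * A 0 (0 - s) q‖, fun r => ?_⟩
  have h1 : H q r = r + H q (-r) := by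
    have := H_sub_H_neg hq r
    push_cast at this
    linear_combination this
  rw [h1]
  refine (norm_add_le _ _).trans ?_
  have h2 := (summable_nat_add_iff r).2 h0
  have hle : ∀ s : ℕ, ‖(s : ℂ) * A 0 (-r - s) q‖ ≤
      ‖((s + r : ℕ) : ℂ) * A 0 (0 - (s + r : ℕ)) q‖ := fun s => by
    have : (0 - (s + r : ℕ) : ℤ) = -r - s := by push_cast; ring
    rw [this, norm_mul, norm_mul]
    gcongr
    rw [Complex.norm_natCast, Complex.norm_natCast]
    push_cast
    linarith [Nat.cast_nonneg (α := ℝ) r]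
  have h3 : ‖H q (-r)‖ ≤ ∑' s : ℕ, ‖((s + r : ℕ) : ℂ) * A 0 (0 - (s + r : ℕ)) q‖ :=
    tsum_of_norm_bounded h2.hasSum hle
  have h4 := h0.sum_add_tsum_nat_add r
  have h5 : 0 ≤ ∑ i ∈ Finset.range r, ‖(i : ℂ) * A 0 (0 - i) q‖ :=
    Finset.sum_nonneg fun i _ => norm_nonneg _
  rw [Complex.norm_natCast]
  linarith

lemma summable_partialTheta {q : ℂ} (hq : ‖q‖ < 1) (r : ℕ) :
    Summable fun j : ℕ => ((r : ℂ) + 2 * j) * q ^ (j * j + j * r) := by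
  have hg := (hasSum_coe_mul_geometric_of_norm_lt_one (r := ‖q‖) (by simpa using hq)).summable
  have hg' := summable_geometric_of_lt_one (norm_nonneg q) hq
  refine Summable.of_norm_bounded (g := fun j : ℕ => r * ‖q‖ ^ j + 2 * (j * ‖q‖ ^ j))
    ((hg'.mul_left _).add (hg.mul_left _)) fun j => ?_
  rw [norm_mul, norm_pow]
  have h1 : ‖(r : ℂ) + 2 * j‖ = r + 2 * j := by
    have : ((r : ℂ) + 2 * j) = ((r + 2 * j : ℕ) : ℂ) := by push_cast; ring
    rw [this, Complex.norm_natCast]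
    push_cast
    ring
  have h2 : ‖q‖ ^ (j * j + j * r) ≤ ‖q‖ ^ j :=
    pow_le_pow_of_le_one (norm_nonneg _) hq.le (by nlinarith [Nat.le_mul_self j])
  rw [h1]
  calc ((r : ℝ) + 2 * j) * ‖q‖ ^ (j * j + j * r) ≤ (r + 2 * j) * ‖q‖ ^ j := by gcongr
    _ = _ := by ring

lemma H_eq_sum_add {q : ℂ} (hq0 : q ≠ 0) (hq : ‖q‖ < 1) (r J : ℕ) :
    H q r = ∑ j ∈ Finset.range J, ((r : ℂ) + 2 * j) * q ^ (j * j + j * r) +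
      q ^ (J * J + J * r) * H q (r + 2 * J : ℕ) := by
  induction J with
  | zero => simp
  | succ J ih =>
    rw [ih, Finset.sum_range_succ, H_recursion hq0 hq]
    have e1 : q ^ (((r + 2 * J : ℕ) : ℤ) + 1) = q ^ (r + 2 * J + 1) := by
      rw [← zpow_natCast]
      congr 1
    have e2 : ((r + 2 * J : ℕ) : ℤ) + 2 = ((r + 2 * (J + 1) : ℕ) : ℤ) := by push_cast; ring
    have e3 : (J + 1) * (J + 1) + (J + 1) * r = (J * J + J * r) + (r + 2 * J + 1) := by ring
    rw [e1, e2, e3, pow_add]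
    push_cast
    ring

/-- The recursion is iterated J times; the remainder q^{J²+Jr}H(r+2J) tends to 0, since H grows at
most linearly. -/
lemma hasSum_H {q : ℂ} (hq0 : q ≠ 0) (hq : ‖q‖ < 1) (r : ℕ) :
    HasSum (fun j : ℕ => ((r : ℂ) + 2 * j) * q ^ (j * j + j * r)) (H q r) := by
  have hs := (summable_partialTheta hq r).hasSum
  obtain ⟨M, hM⟩ := exists_norm_H_le hq
  have hrem : Tendsto (fun J : ℕ => q ^ (J * J + J * r) * H q (r + 2 * J : ℕ)) atTop (𝓝 0) := by
    have hg := (hasSum_coe_mul_geometric_of_norm_lt_one (r := ‖q‖)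
      (by simpa using hq)).summable.tendsto_atTop_zero
    have hg' := (summable_geometric_of_lt_one (norm_nonneg q) hq).tendsto_atTop_zero
    have hb : Tendsto (fun J : ℕ => (r + M) * ‖q‖ ^ J + 2 * (J * ‖q‖ ^ J)) atTop (𝓝 0) := by
      simpa using (hg'.const_mul (r + M)).add (hg.const_mul 2)
    refine squeeze_zero_norm (fun J => ?_) hb
    rw [norm_mul, norm_pow]
    have h2 : ‖q‖ ^ (J * J + J * r) ≤ ‖q‖ ^ J :=
      pow_le_pow_of_le_one (norm_nonneg _) hq.le (by nlinarith [Nat.le_mul_self J])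
    calc ‖q‖ ^ (J * J + J * r) * ‖H q (r + 2 * J : ℕ)‖
        ≤ ‖q‖ ^ J * ((r + 2 * J : ℕ) + M) := by
          gcongr
          exact hM _
      _ = _ := by push_cast; ring
  have h1 := hs.tendsto_sum_nat.add hrem
  rw [add_zero] at h1
  rw [show H q r = _ from
    tendsto_nhds_unique (tendsto_const_nhds.congr fun J => H_eq_sum_add hq0 hq r J) h1]
  exact hs

/-- Convolution with s is a double summation, so one difference of H leaves the plain sum of the
A(r-s), and a second one isolates a single A. -/
lemma H_succ {q : ℂ} (hq : ‖q‖ < 1) (r : ℤ) :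
    HasSum (fun s : ℕ => A 0 (r - s) q) (H q (r + 1) - H q r) := by
  have h1 := (summable_H hq (r + 1)).hasSum
  rw [← hasSum_nat_add_iff' 1] at h1
  have h2 := h1.sub (summable_H hq r).hasSum
  simp only [Finset.sum_range_one, Nat.cast_zero, zero_mul, sub_zero] at h2
  refine hasSum_of_eq (fun s => ?_) h2
  have : r + 1 - ((s + 1 : ℕ) : ℤ) = r - s := by push_cast; ring
  rw [this]
  push_cast
  ring

/-- The `ζ^m` coefficient of `g²` is a second difference. -/
lemma A_eq_second_diff {q : ℂ} (hq : ‖q‖ < 1) (r : ℤ) :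
    A 0 (r + 1) q = H q (r + 2) - 2 * H q (r + 1) + H q r := by
  have h1 := H_succ hq (r + 1)
  have h2 := H_succ hq r
  rw [← hasSum_nat_add_iff' 1] at h1
  simp only [Finset.sum_range_one, Nat.cast_zero, sub_zero] at h1
  have h3 := h1.unique (hasSum_of_eq (fun s => by
    congr 1
    push_cast
    ring) h2)
  rw [show r + 1 + 1 = r + 2 by ring] at h3
  linear_combination -h3

end
end ChiGenus

namespace ChiGenus
noncomputable section
open Filter Topology MeasureTheory Set

/-! ### Euler–Maclaurin summation over the natural numbers -/

/-- `f 0, …, f 4` are successive derivatives. -/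
def IsChain (f : ℕ → ℝ → ℂ) : Prop := ∀ i < 4, ∀ x, HasDerivAt (f i) (f (i + 1) x) x

/-- The successive derivatives of a product. -/
def mulC (f g : ℕ → ℝ → ℂ) : ℕ → ℝ → ℂ
  | 0 => fun x => f 0 x * g 0 x
  | 1 => fun x => f 1 x * g 0 x + f 0 x * g 1 x
  | 2 => fun x => f 2 x * g 0 x + 2 * (f 1 x * g 1 x) + f 0 x * g 2 x
  | 3 => fun x => f 3 x * g 0 x + 3 * (f 2 x * g 1 x) + 3 * (f 1 x * g 2 x) + f 0 x * g 3 x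
  | _ => fun x => f 4 x * g 0 x + 4 * (f 3 x * g 1 x) + 6 * (f 2 x * g 2 x) +
      4 * (f 1 x * g 3 x) + f 0 x * g 4 x

lemma IsChain.mul {f g : ℕ → ℝ → ℂ} (hf : IsChain f) (hg : IsChain g) : IsChain (mulC f g) := by
  intro i hi x
  have f0 := hf 0 (by norm_num) x
  have f1 := hf 1 (by norm_num) x
  have f2 := hf 2 (by norm_num) x
  have f3 := hf 3 (by norm_num) x
  have g0 := hg 0 (by norm_num) x
  have g1 := hg 1 (by norm_num) x
  have g2 := hg 2 (by norm_num) x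
  have g3 := hg 3 (by norm_num) x
  interval_cases i
  · exact f0.mul g0
  · refine ((f1.mul g0).add (f0.mul g1)).congr_deriv ?_
    simp only [mulC]
    ring
  · refine (((f2.mul g0).add ((f1.mul g1).const_mul 2)).add (f0.mul g2)).congr_deriv ?_
    simp only [mulC]
    ring
  · refine ((((f3.mul g0).add ((f2.mul g1).const_mul 3)).add ((f1.mul g2).const_mul 3)).add
      (f0.mul g3)).congr_deriv ?_
    simp only [mulC]
    ring

lemma IsChain.sub {f g : ℕ → ℝ → ℂ} (hf : IsChain f) (hg : IsChain g) :
    IsChain (fun i x => f i x - g i x) := fun i hi x => (hf i hi x).sub (hg i hi x)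

lemma IsChain.const_mul {f : ℕ → ℝ → ℂ} (c : ℂ) (hf : IsChain f) :
    IsChain (fun i x => c * f i x) := fun i hi x => (hf i hi x).const_mul c

lemma IsChain.continuous {f : ℕ → ℝ → ℂ} (hf : IsChain f) {i : ℕ} (hi : i < 4) :
    Continuous (f i) :=
  continuous_iff_continuousAt.2 fun x => (hf i hi x).continuousAt

/-- Abstract form of Euler–Maclaurin: U collects the boundary terms at the integers. They telescope
and vanish at both ends, leaving only the integrated remainders. -/
lemma norm_le_integral_of_telescoping {w U : ℕ → ℂ} {G : ℝ → ℝ} (hG : IntegrableOn G (Ioi 0))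
    (hG0 : ∀ x, 0 ≤ x → 0 ≤ G x)
    (h : ∀ j : ℕ, ‖w j + (U (j + 1) - U j)‖ ≤ ∫ x in (j : ℝ)..(j + 1 : ℕ), G x)
    (hU0 : U 0 = 0) (hU : Tendsto U atTop (𝓝 0)) {S : ℂ} (hS : HasSum w S) :
    ‖S‖ ≤ ∫ x in Ioi (0 : ℝ), G x := by
  have hlim := (hS.tendsto_sum_nat.add hU).norm
  rw [add_zero] at hlim
  have hint : ∀ a b : ℝ, 0 ≤ a → a ≤ b → IntervalIntegrable G volume a b := fun a b ha hab =>
    (intervalIntegrable_iff_integrableOn_Ioc_of_le hab).2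
      (hG.mono_set fun x hx => lt_of_le_of_lt ha hx.1)
  refine le_of_tendsto hlim (Eventually.of_forall fun N => ?_)
  have e : ∑ j ∈ Finset.range N, w j + U N =
      ∑ j ∈ Finset.range N, (w j + (U (j + 1) - U j)) := by
    rw [Finset.sum_add_distrib, Finset.sum_range_sub, hU0, sub_zero]
  rw [e]
  refine (norm_sum_le _ _).trans ((Finset.sum_le_sum fun j _ => h j).trans ?_)
  rw [intervalIntegral.sum_integral_adjacent_intervals (a := fun j : ℕ => (j : ℝ))
    fun j _ => hint _ _ (by positivity) (by push_cast; linarith)]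
  rw [intervalIntegral.integral_of_le (by simp)]
  refine setIntegral_mono_set hG ?_ (Eventually.of_forall fun x hx => ?_)
  · exact (ae_restrict_iff' measurableSet_Ioi).2 (Eventually.of_forall fun x hx => hG0 x (le_of_lt hx))
  · have : ((0 : ℕ) : ℝ) < x := hx.1
    rw [Nat.cast_zero] at this
    exact this

lemma norm_integral_kernel_le {κ : ℝ → ℝ} {f : ℝ → ℂ} {G : ℝ → ℝ} (hG : IntegrableOn G (Ioi 0))
    (hf : ∀ x, 0 ≤ x → ‖f x‖ ≤ G x) (j : ℕ)
    (hκ : ∀ x : ℝ, (j : ℝ) ≤ x → x ≤ (j + 1 : ℕ) → |κ x| ≤ 1) :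
    ‖∫ x in (j : ℝ)..(j + 1 : ℕ), (κ x : ℂ) * f x‖ ≤ ∫ x in (j : ℝ)..(j + 1 : ℕ), G x := by
  have hj : (0 : ℝ) ≤ j := by positivity
  have hj1 : (j : ℝ) ≤ (j + 1 : ℕ) := by push_cast; linarith
  refine intervalIntegral.norm_integral_le_of_norm_le hj1 (Eventually.of_forall fun x hx => ?_)
    ((intervalIntegrable_iff_integrableOn_Ioc_of_le hj1).2
      (hG.mono_set fun x hx => lt_of_le_of_lt hj hx.1))
  rw [norm_mul, Complex.norm_real, Real.norm_eq_abs]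
  calc |κ x| * ‖f x‖ ≤ 1 * ‖f x‖ := by
        gcongr
        exact hκ x hx.1.le hx.2
    _ ≤ G x := by rw [one_mul]; exact hf x (hj.trans hx.1.le)

/-- Euler–Maclaurin bound through the third derivative. -/
lemma norm_sum_deriv_le_third {w : ℕ → ℝ → ℂ} (hw : IsChain w) (h0 : w 0 0 = 0) (h1 : w 1 0 = 0)
    (t0 : Tendsto (fun n : ℕ => w 0 n) atTop (𝓝 0)) (t1 : Tendsto (fun n : ℕ => w 1 n) atTop (𝓝 0))
    {G : ℝ → ℝ} (hG : IntegrableOn G (Ioi 0)) (hle : ∀ x, 0 ≤ x → ‖w 3 x‖ ≤ G x) {S : ℂ}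
    (hS : HasSum (fun j : ℕ => w 1 j) S) : ‖S‖ ≤ ∫ x in Ioi (0 : ℝ), G x := by
  -- With this U the corrected summand is the trapezoidal error (w 1 j + w 1 (j+1))/2 - ∫ w 1 on [j,
  -- j+1]; the integral of w 1 is the increment of w 0.
  refine norm_le_integral_of_telescoping (U := fun n : ℕ => w 1 n / 2 - w 0 n) hG
    (fun x hx => (norm_nonneg _).trans (hle x hx)) (fun j => ?_) (by simp [h0, h1])
    (by simpa using (t1.div_const 2).sub t0) hS
  have key : ∀ x : ℝ, HasDerivAt (fun x : ℝ => ((x : ℂ) - j - 1 / 2) * w 1 x -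
      (((x : ℂ) - j) ^ 2 - ((x : ℂ) - j)) / 2 * w 2 x - w 0 x)
      ((((-(((x - j) ^ 2 - (x - j)) / 2) : ℝ)) : ℂ) * w 3 x) x := fun x => by
    have hx : HasDerivAt (fun x : ℝ => (x : ℂ)) 1 x := Complex.ofRealCLM.hasDerivAt
    have hx' := hx.sub_const (j : ℂ)
    refine ((((hx'.sub_const (1 / 2)).mul (hw 1 (by norm_num) x)).sub
      ((((hx'.pow 2).sub hx').div_const 2).mul (hw 2 (by norm_num) x))).sub
        (hw 0 (by norm_num) x)).congr_deriv ?_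
    simp only [Pi.sub_apply, Pi.pow_apply]
    push_cast
    ring
  have hI := intervalIntegral.integral_eq_sub_of_hasDerivAt (a := (j : ℝ)) (b := (j + 1 : ℕ))
    (fun x _ => key x) (by
      have := hw.continuous (show 3 < 4 by norm_num)
      apply Continuous.intervalIntegrable
      fun_prop)
  have e : w 1 j + ((w 1 (j + 1 : ℕ) / 2 - w 0 (j + 1 : ℕ)) - (w 1 j / 2 - w 0 j)) =
      ∫ x in (j : ℝ)..(j + 1 : ℕ), (((-(((x - j) ^ 2 - (x - j)) / 2) : ℝ)) : ℂ) * w 3 x := by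
    rw [hI]
    push_cast
    ring
  rw [e]
  refine norm_integral_kernel_le hG hle j fun x hx hx' => ?_
  push_cast at hx'
  rw [abs_le]
  constructor <;> nlinarith

/-- Euler–Maclaurin bound through the fourth derivative. -/
lemma norm_sum_deriv_le_fourth {w : ℕ → ℝ → ℂ} (hw : IsChain w) (hc : Continuous (w 4))
    (h0 : w 0 0 = 0) (h1 : w 1 0 = 0) (h2 : w 2 0 = 0)
    (t0 : Tendsto (fun n : ℕ => w 0 n) atTop (𝓝 0)) (t1 : Tendsto (fun n : ℕ => w 1 n) atTop (𝓝 0))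
    (t2 : Tendsto (fun n : ℕ => w 2 n) atTop (𝓝 0))
    {G : ℝ → ℝ} (hG : IntegrableOn G (Ioi 0)) (hle : ∀ x, 0 ≤ x → ‖w 4 x‖ ≤ G x) {S : ℂ}
    (hS : HasSum (fun j : ℕ => w 1 j) S) : ‖S‖ ≤ ∫ x in Ioi (0 : ℝ), G x := by
  -- The coefficient 1/12 is the next Bernoulli correction, B₂/2; the remaining kernel is B₃(x -
  -- j)/6.
  refine norm_le_integral_of_telescoping (U := fun n : ℕ => w 1 n / 2 - w 2 n / 12 - w 0 n) hG
    (fun x hx => (norm_nonneg _).trans (hle x hx)) (fun j => ?_) (by simp [h0, h1, h2])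
    (by simpa using ((t1.div_const 2).sub (t2.div_const 12)).sub t0) hS
  have key : ∀ x : ℝ, HasDerivAt (fun x : ℝ => ((x : ℂ) - j - 1 / 2) * w 1 x -
      (((x : ℂ) - j) ^ 2 - ((x : ℂ) - j) + 1 / 6) / 2 * w 2 x +
      (((x : ℂ) - j) ^ 3 / 6 - ((x : ℂ) - j) ^ 2 / 4 + ((x : ℂ) - j) / 12) * w 3 x - w 0 x)
      (((((x - j) ^ 3 / 6 - (x - j) ^ 2 / 4 + (x - j) / 12 : ℝ)) : ℂ) * w 4 x) x := fun x => by
    have hx : HasDerivAt (fun x : ℝ => (x : ℂ)) 1 x := Complex.ofRealCLM.hasDerivAt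
    have hx' := hx.sub_const (j : ℂ)
    refine (((((hx'.sub_const (1 / 2)).mul (hw 1 (by norm_num) x)).sub
      (((((hx'.pow 2).sub hx').add_const (1 / 6)).div_const 2).mul (hw 2 (by norm_num) x))).add
      (((((hx'.pow 3).div_const 6).sub ((hx'.pow 2).div_const 4)).add (hx'.div_const 12)).mul
        (hw 3 (by norm_num) x))).sub (hw 0 (by norm_num) x)).congr_deriv ?_
    simp only [Pi.sub_apply, Pi.pow_apply, Pi.add_apply]
    push_cast
    ring
  have hI := intervalIntegral.integral_eq_sub_of_hasDerivAt (a := (j : ℝ)) (b := (j + 1 : ℕ))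
    (fun x _ => key x) (by
      apply Continuous.intervalIntegrable
      fun_prop)
  have e : w 1 j + ((w 1 (j + 1 : ℕ) / 2 - w 2 (j + 1 : ℕ) / 12 - w 0 (j + 1 : ℕ)) -
      (w 1 j / 2 - w 2 j / 12 - w 0 j)) = ∫ x in (j : ℝ)..(j + 1 : ℕ),
        ((((x - j) ^ 3 / 6 - (x - j) ^ 2 / 4 + (x - j) / 12 : ℝ)) : ℂ) * w 4 x := by
    rw [hI]
    push_cast
    ring
  rw [e]
  refine norm_integral_kernel_le hG hle j fun x hx hx' => ?_
  push_cast at hx'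
  have hu0 : 0 ≤ x - j := by linarith
  have hu1 : x - j ≤ 1 := by linarith
  generalize x - (j : ℝ) = u at *
  have h2 : u ^ 2 ≤ 1 := by nlinarith
  have h3 : u ^ 3 ≤ 1 := pow_le_one₀ hu0 hu1
  have h3' : 0 ≤ u ^ 3 := by positivity
  rw [abs_le]
  constructor <;> nlinarith [sq_nonneg u]

/-! ### The profile P -/

/-- Closed form of the profile. -/
lemma P_eq {m β : ℝ} (hm : 0 < m) (hβ : 0 < β) : P m β =
    β ^ 2 * m * (Real.exp (-(β * m)) * (1 + Real.exp (-(β * m))) / (1 - Real.exp (-(β * m))) ^ 3) -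
      2 * β * (Real.exp (-(β * m)) / (1 - Real.exp (-(β * m))) ^ 2) := by
  have hs : ∀ x : ℝ, 0 < x → Real.sinh (β * x / 2) ≠ 0 := fun x hx =>
    (Real.sinh_pos_iff.2 (by positivity)).ne'
  have hlin : ∀ x : ℝ, HasDerivAt (fun x : ℝ => β * x / 2) (β / 2) x := fun x => by
    simpa using ((hasDerivAt_id x).const_mul β).div_const 2
  have hch : ∀ x : ℝ, HasDerivAt (fun x => Real.cosh (β * x / 2)) (Real.sinh (β * x / 2) * (β / 2)) x :=
    fun x => (hlin x).cosh
  have hsh : ∀ x : ℝ, HasDerivAt (fun x => Real.sinh (β * x / 2)) (Real.cosh (β * x / 2) * (β / 2)) x :=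
    fun x => (hlin x).sinh
  have hsq : ∀ x : ℝ, Real.cosh (β * x / 2) ^ 2 = Real.sinh (β * x / 2) ^ 2 + 1 := fun x => by
    rw [Real.cosh_sq]
  have hid : ∀ x : ℝ, HasDerivAt (fun x : ℝ => x / 2) (1 / 2) x := fun x =>
    (hasDerivAt_id x).div_const 2
  have d1 : ∀ x : ℝ, 0 < x → HasDerivAt (halfCoth β)
      (1 / 2 * (Real.cosh (β * x / 2) / Real.sinh (β * x / 2)) -
        β * x / 4 / Real.sinh (β * x / 2) ^ 2) x := fun x hx => by
    have h := (hid x).mul ((hch x).div (hsh x) (hs x hx))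
    have he : halfCoth β =ᶠ[𝓝 x] ((fun x : ℝ => x / 2) * fun x =>
        Real.cosh (β * x / 2) / Real.sinh (β * x / 2)) := by
      filter_upwards [lt_mem_nhds hx] with y hy
      simp [halfCoth, hy.ne']
    refine (h.congr_of_eventuallyEq he).congr_deriv ?_
    have := hs x hx
    have := hsq x
    simp only [Pi.div_apply]
    field_simp
    rw [this]
    ring
  have e1 : deriv (halfCoth β) =ᶠ[𝓝 m] fun x =>
      1 / 2 * (Real.cosh (β * x / 2) / Real.sinh (β * x / 2)) -
        β * x / 4 / Real.sinh (β * x / 2) ^ 2 := by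
    filter_upwards [lt_mem_nhds hm] with y hy
    exact (d1 y hy).deriv
  have d2 : HasDerivAt (fun x => 1 / 2 * (Real.cosh (β * x / 2) / Real.sinh (β * x / 2)) -
        β * x / 4 / Real.sinh (β * x / 2) ^ 2)
      (-(β / 2) / Real.sinh (β * m / 2) ^ 2 +
        β ^ 2 * m / 4 * Real.cosh (β * m / 2) / Real.sinh (β * m / 2) ^ 3) m := by
    have h4 : HasDerivAt (fun x : ℝ => β * x / 4) (β / 4) m := by
      simpa using ((hasDerivAt_id m).const_mul β).div_const 4
    refine ((((hch m).div (hsh m) (hs m hm)).const_mul (1 / 2)).sub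
      (h4.div ((hsh m).pow 2) (pow_ne_zero 2 (hs m hm)))).congr_deriv ?_
    have := hs m hm
    have := hsq m
    simp only [Pi.pow_apply]
    field_simp
    rw [this]
    push_cast
    ring
  rw [P, iteratedDeriv_succ, iteratedDeriv_one, e1.deriv_eq, d2.deriv]
  have hr : Real.exp (-(β * m)) < 1 := Real.exp_lt_one_iff.2 (by nlinarith [mul_pos hβ hm])
  have hx0 := Real.exp_ne_zero (β * m / 2)
  have e2 : Real.exp (-(β * m)) = (Real.exp (β * m / 2))⁻¹ ^ 2 := by
    rw [← Real.exp_neg, ← Real.exp_nat_mul]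
    congr 1
    push_cast
    ring
  have hne : 1 - Real.exp (-(β * m)) ≠ 0 := by linarith
  rw [Real.cosh_eq, Real.sinh_eq, Real.exp_neg, e2]
  rw [e2] at hne
  generalize Real.exp (β * m / 2) = u at *
  have h5 : u ^ 2 - 1 ≠ 0 := fun h => hne (by
    have : u ^ 2 = 1 := by linarith
    rw [inv_pow, this]
    simp)
  have h6 : u - u⁻¹ = (u ^ 2 - 1) / u := by field_simp
  have h7 : 1 - u⁻¹ ^ 2 = (u ^ 2 - 1) / u ^ 2 := by field_simp
  rw [h6, h7]
  field_simp
  ring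

lemma P_neg (m β : ℝ) : P (-m) β = P m β := by
  have he : (fun x => halfCoth β (-x)) = halfCoth β := by
    funext x
    simp only [halfCoth, neg_eq_zero, mul_neg, neg_div, Real.cosh_neg, Real.sinh_neg]
    split_ifs
    · rfl
    · rw [div_neg, neg_mul_neg]
  have := iteratedDeriv_comp_neg 2 (halfCoth β) m
  rw [he] at this
  rw [P, P, this]
  simp

lemma P_abs (m β : ℝ) : P |m| β = P m β := by
  rcases abs_cases m with ⟨h, -⟩ | ⟨h, -⟩
  · rw [h]
  · rw [h, P_neg]

/-- `P(m, β) ≥ (β / 6) e^{-β m}`. -/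
lemma P_lower {m β : ℝ} (hm : 0 < m) (hβ : 0 < β) : β / 6 * Real.exp (-(β * m)) ≤ P m β := by
  have ht : 0 < β * m := mul_pos hβ hm
  rw [P_eq hm hβ]
  have hd : ∀ t : ℝ, HasDerivAt (fun t : ℝ => Real.exp (-t)) (-Real.exp (-t)) t := fun t => by
    simpa using ((hasDerivAt_id t).neg).exp
  -- Both sides agree at 0, and the derivative of the difference is e^{-t}(t - 1 + e^{-t}) ≥ 0.
  have a1 : ∀ t : ℝ, 0 ≤ t → (1 - Real.exp (-t)) ^ 2 / 2 ≤ 1 - Real.exp (-t) - t * Real.exp (-t) := by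
    have hmono : MonotoneOn (fun t : ℝ => 1 - Real.exp (-t) - t * Real.exp (-t) -
        (1 - Real.exp (-t)) ^ 2 / 2) (Ici 0) := by
      have hder : ∀ t : ℝ, HasDerivAt (fun t : ℝ => 1 - Real.exp (-t) - t * Real.exp (-t) -
        (1 - Real.exp (-t)) ^ 2 / 2) (Real.exp (-t) * (t - (1 - Real.exp (-t)))) t := fun t => by
        refine ((((hd t).const_sub 1).sub ((hasDerivAt_id t).mul (hd t))).sub
          ((((hd t).const_sub 1).pow 2).div_const 2)).congr_deriv ?_
        simp
        ring
      refine monotoneOn_of_deriv_nonneg (convex_Ici 0)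
        (fun t _ => (hder t).continuousAt.continuousWithinAt)
        (fun t _ => (hder t).differentiableAt.differentiableWithinAt) fun t _ => ?_
      rw [(hder t).deriv]
      have := Real.add_one_le_exp (-t)
      exact mul_nonneg (Real.exp_pos _).le (by linarith)
    intro t ht
    have := hmono (mem_Ici.2 le_rfl) (mem_Ici.2 ht) ht
    simp at this
    linarith
  -- Same argument one order higher: `a1` supplies the sign of the derivative. With r = e^{-t} and t
  -- = βm, this is a lower bound for the numerator of P over the common denominator (1-r)³.
  have a2 : ∀ t : ℝ, 0 ≤ t → (1 - Real.exp (-t)) ^ 3 / 6 ≤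
      t * (1 + Real.exp (-t)) - 2 * (1 - Real.exp (-t)) := by
    have hmono : MonotoneOn (fun t : ℝ => t * (1 + Real.exp (-t)) - 2 * (1 - Real.exp (-t)) -
        (1 - Real.exp (-t)) ^ 3 / 6) (Ici 0) := by
      have hder : ∀ t : ℝ, HasDerivAt (fun t : ℝ => t * (1 + Real.exp (-t)) -
          2 * (1 - Real.exp (-t)) - (1 - Real.exp (-t)) ^ 3 / 6)
          (1 - Real.exp (-t) - t * Real.exp (-t) - (1 - Real.exp (-t)) ^ 2 / 2 * Real.exp (-t)) t :=
        fun t => by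
        refine ((((hasDerivAt_id t).mul ((hd t).const_add 1)).sub
          (((hd t).const_sub 1).const_mul 2)).sub
          ((((hd t).const_sub 1).pow 3).div_const 6)).congr_deriv ?_
        simp
        ring
      refine monotoneOn_of_deriv_nonneg (convex_Ici 0)
        (fun t _ => (hder t).continuousAt.continuousWithinAt)
        (fun t _ => (hder t).differentiableAt.differentiableWithinAt) fun t ht => ?_
      rw [interior_Ici, mem_Ioi] at ht
      rw [(hder t).deriv]
      have h1 := a1 t ht.le
      have h2 : Real.exp (-t) ≤ 1 := Real.exp_le_one_iff.2 (by linarith)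
      nlinarith [sq_nonneg (1 - Real.exp (-t))]
    intro t ht
    have := hmono (mem_Ici.2 le_rfl) (mem_Ici.2 ht) ht
    simp at this
    linarith
  have h := a2 (β * m) ht.le
  have hr : 0 < 1 - Real.exp (-(β * m)) := by
    have := Real.exp_lt_one_iff.2 (show -(β * m) < 0 by linarith)
    linarith
  have hr0 := Real.exp_pos (-(β * m))
  generalize Real.exp (-(β * m)) = r at *
  have e : β ^ 2 * m * (r * (1 + r) / (1 - r) ^ 3) - 2 * β * (r / (1 - r) ^ 2) =
      β * r * (β * m * (1 + r) - 2 * (1 - r)) / (1 - r) ^ 3 := by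
    field_simp
  rw [e, le_div_iff₀ (by positivity)]
  have := mul_le_mul_of_nonneg_left h (mul_pos hβ hr0).le
  nlinarith

/-! ### Derivative bounds for the summand and its quadratic approximation -/

lemma norm_exp_sub_exp_neg_le (u : ℂ) :
    ‖Complex.exp u - Complex.exp (-u)‖ ≤ 2 * ‖u‖ * Real.exp ‖u‖ := by
  have h : ∀ v : ℂ, ‖Complex.exp v - 1‖ ≤ ‖v‖ * Real.exp ‖v‖ := fun v => by
    simpa using Complex.norm_exp_sub_sum_le_norm_mul_exp v 1
  calc ‖Complex.exp u - Complex.exp (-u)‖ = ‖(Complex.exp u - 1) - (Complex.exp (-u) - 1)‖ := by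
        congr 1; ring
    _ ≤ ‖u‖ * Real.exp ‖u‖ + ‖-u‖ * Real.exp ‖-u‖ := (norm_sub_le _ _).trans (add_le_add (h _) (h _))
    _ = _ := by rw [norm_neg]; ring

lemma norm_exp_add_exp_neg_le (u : ℂ) :
    ‖Complex.exp u + Complex.exp (-u)‖ ≤ 2 * Real.exp ‖u‖ := by
  have h1 := Complex.norm_exp_le_exp_norm u
  have h2 := Complex.norm_exp_le_exp_norm (-u)
  rw [norm_neg] at h2
  linarith [norm_add_le (Complex.exp u) (Complex.exp (-u))]

lemma norm_exp_add_exp_neg_sub_two_le (u : ℂ) :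
    ‖Complex.exp u + Complex.exp (-u) - 2‖ ≤ ‖u‖ ^ 2 * Real.exp ‖u‖ := by
  have e : Complex.exp u + Complex.exp (-u) - 2 =
      (Complex.exp (u / 2) - Complex.exp (-(u / 2))) ^ 2 := by
    have h1 : Complex.exp u = Complex.exp (u / 2) ^ 2 := by
      rw [← Complex.exp_nat_mul]; congr 1; push_cast; ring
    have h2 : Complex.exp (-u) = Complex.exp (-(u / 2)) ^ 2 := by
      rw [← Complex.exp_nat_mul]; congr 1; push_cast; ring
    have h3 : Complex.exp (u / 2) * Complex.exp (-(u / 2)) = 1 := by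
      rw [← Complex.exp_add, add_neg_cancel, Complex.exp_zero]
    rw [h1, h2]
    linear_combination 2 * h3
  rw [e, norm_pow]
  have h := norm_exp_sub_exp_neg_le (u / 2)
  have hn : ‖u / 2‖ = ‖u‖ / 2 := by simp
  rw [hn] at h
  calc _ ≤ (2 * (‖u‖ / 2) * Real.exp (‖u‖ / 2)) ^ 2 := by gcongr
    _ = ‖u‖ ^ 2 * Real.exp (‖u‖ / 2) ^ 2 := by ring
    _ = _ := by
      rw [← Real.exp_nat_mul]
      congr 2
      push_cast
      ring

/-- The derivatives of `e^{cx}`. -/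
def expC (c : ℂ) : ℕ → ℝ → ℂ := fun i x => c ^ i * Complex.exp (c * x)

lemma hasDerivAt_exp_mul (c : ℂ) (x : ℝ) :
    HasDerivAt (fun x : ℝ => Complex.exp (c * x)) (c * Complex.exp (c * x)) x := by
  have hx : HasDerivAt (fun x : ℝ => (x : ℂ)) 1 x := Complex.ofRealCLM.hasDerivAt
  have := (hx.const_mul c).cexp
  rw [mul_one, mul_comm] at this
  exact this

lemma isChain_expC (c : ℂ) : IsChain (expC c) := fun i _ x =>
  ((hasDerivAt_exp_mul c x).const_mul (c ^ i)).congr_deriv (by simp only [expC]; ring)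

/-- The derivatives of `e^{zx} + e^{-zx} - 2`. -/
def coshC (z : ℂ) : ℕ → ℝ → ℂ
  | 0 => fun x => Complex.exp (z * x) + Complex.exp (-(z * x)) - 2
  | 1 => fun x => z * (Complex.exp (z * x) - Complex.exp (-(z * x)))
  | 2 => fun x => z ^ 2 * (Complex.exp (z * x) + Complex.exp (-(z * x)))
  | 3 => fun x => z ^ 3 * (Complex.exp (z * x) - Complex.exp (-(z * x)))
  | _ => fun x => z ^ 4 * (Complex.exp (z * x) + Complex.exp (-(z * x)))

lemma isChain_coshC (z : ℂ) : IsChain (coshC z) := by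
  intro i hi x
  have h1 := hasDerivAt_exp_mul z x
  have h2 : HasDerivAt (fun x : ℝ => Complex.exp (-(z * x))) (-(z * Complex.exp (-(z * x)))) x := by
    simpa using hasDerivAt_exp_mul (-z) x
  interval_cases i
  · exact ((h1.add h2).sub_const 2).congr_deriv (by simp only [coshC]; ring)
  · exact ((h1.sub h2).const_mul z).congr_deriv (by simp only [coshC]; ring)
  · exact ((h1.add h2).const_mul (z ^ 2)).congr_deriv (by simp only [coshC]; ring)
  · exact ((h1.sub h2).const_mul (z ^ 3)).congr_deriv (by simp only [coshC]; ring)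

/-- The derivatives of `e^{-zx²}`. -/
def gaussC (z : ℂ) : ℕ → ℝ → ℂ
  | 0 => fun x => Complex.exp (-(z * x ^ 2))
  | 1 => fun x => -(2 * z * x) * Complex.exp (-(z * x ^ 2))
  | 2 => fun x => (4 * z ^ 2 * x ^ 2 - 2 * z) * Complex.exp (-(z * x ^ 2))
  | 3 => fun x => (-(8 * z ^ 3 * x ^ 3) + 12 * z ^ 2 * x) * Complex.exp (-(z * x ^ 2))
  | _ => fun x => (16 * z ^ 4 * x ^ 4 - 48 * z ^ 3 * x ^ 2 + 12 * z ^ 2) *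
      Complex.exp (-(z * x ^ 2))

lemma isChain_gaussC (z : ℂ) : IsChain (gaussC z) := by
  intro i hi x
  have hx : HasDerivAt (fun x : ℝ => (x : ℂ)) 1 x := Complex.ofRealCLM.hasDerivAt
  have hx2 : HasDerivAt (fun x : ℝ => (x : ℂ) ^ 2) (2 * x) x :=
    (hx.pow 2).congr_deriv (by push_cast; ring)
  have hx3 : HasDerivAt (fun x : ℝ => (x : ℂ) ^ 3) (3 * x ^ 2) x :=
    (hx.pow 3).congr_deriv (by push_cast; ring)
  have he : HasDerivAt (fun x : ℝ => Complex.exp (-(z * x ^ 2)))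
      (-(2 * z * x) * Complex.exp (-(z * x ^ 2))) x :=
    ((hx2.const_mul z).neg.cexp).congr_deriv (by simp only [Pi.neg_apply]; ring)
  interval_cases i
  · exact he
  · exact (((hx.const_mul (2 * z)).neg).mul he).congr_deriv
      (by simp only [gaussC, Pi.neg_apply]; ring)
  · exact (((hx2.const_mul (4 * z ^ 2)).sub_const (2 * z)).mul he).congr_deriv
      (by simp only [gaussC]; ring)
  · exact ((((hx3.const_mul (8 * z ^ 3)).neg).add (hx.const_mul (12 * z ^ 2))).mul he).congr_deriv
      (by simp only [gaussC, Pi.add_apply, Pi.neg_apply]; ring)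

/-- The derivatives of `z x²`. -/
def quadC (z : ℂ) : ℕ → ℝ → ℂ
  | 0 => fun x => z * x ^ 2
  | 1 => fun x => 2 * z * x
  | 2 => fun _ => 2 * z
  | _ => fun _ => 0

lemma isChain_quadC (z : ℂ) : IsChain (quadC z) := by
  intro i hi x
  have hx : HasDerivAt (fun x : ℝ => (x : ℂ)) 1 x := Complex.ofRealCLM.hasDerivAt
  have hx2 : HasDerivAt (fun x : ℝ => (x : ℂ) ^ 2) (2 * x) x :=
    (hx.pow 2).congr_deriv (by push_cast; ring)
  interval_cases i
  · exact (hx2.const_mul z).congr_deriv (by simp only [quadC]; ring)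
  · exact (hx.const_mul (2 * z)).congr_deriv (by simp only [quadC]; ring)
  · exact hasDerivAt_const x (2 * z)
  · exact hasDerivAt_const x 0

/-- The derivatives of `z⁻¹ (e^{zx} + e^{-zx} - 2) e^{-zx²} - z x²`. -/
def errC (z : ℂ) : ℕ → ℝ → ℂ := fun i x => z⁻¹ * mulC (coshC z) (gaussC z) i x - quadC z i x

lemma isChain_errC (z : ℂ) : IsChain (errC z) :=
  (((isChain_coshC z).mul (isChain_gaussC z)).const_mul z⁻¹).sub (isChain_quadC z)

lemma norm_coshC_le (z : ℂ) {x : ℝ} (hx : 0 ≤ x) :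
    ‖coshC z 0 x‖ ≤ ‖z‖ ^ 2 * x ^ 2 * Real.exp (‖z‖ * x) ∧
    ‖coshC z 1 x‖ ≤ 2 * ‖z‖ ^ 2 * x * Real.exp (‖z‖ * x) ∧
    ‖coshC z 2 x‖ ≤ 2 * ‖z‖ ^ 2 * Real.exp (‖z‖ * x) ∧
    ‖coshC z 3 x‖ ≤ 2 * ‖z‖ ^ 4 * x * Real.exp (‖z‖ * x) ∧
    ‖coshC z 4 x‖ ≤ 2 * ‖z‖ ^ 4 * Real.exp (‖z‖ * x) := by
  have hn : ‖z * (x : ℂ)‖ = ‖z‖ * x := by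
    rw [norm_mul, Complex.norm_real, Real.norm_eq_abs, abs_of_nonneg hx]
  have h1 := norm_exp_sub_exp_neg_le (z * x)
  have h2 := norm_exp_add_exp_neg_le (z * x)
  have h3 := norm_exp_add_exp_neg_sub_two_le (z * x)
  rw [hn] at h1 h2 h3
  refine ⟨?_, ?_, ?_, ?_, ?_⟩
  · simpa only [coshC, mul_pow] using h3
  · simp only [coshC, norm_mul]
    calc _ ≤ ‖z‖ * (2 * (‖z‖ * x) * Real.exp (‖z‖ * x)) := by gcongr
      _ = _ := by ring
  · simp only [coshC, norm_mul, norm_pow]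
    calc _ ≤ ‖z‖ ^ 2 * (2 * Real.exp (‖z‖ * x)) := by gcongr
      _ = _ := by ring
  · simp only [coshC, norm_mul, norm_pow]
    calc _ ≤ ‖z‖ ^ 3 * (2 * (‖z‖ * x) * Real.exp (‖z‖ * x)) := by gcongr
      _ = _ := by ring
  · simp only [coshC, norm_mul, norm_pow]
    calc _ ≤ ‖z‖ ^ 4 * (2 * Real.exp (‖z‖ * x)) := by gcongr
      _ = _ := by ring

lemma norm_gaussC_le (z : ℂ) {x : ℝ} (hx : 0 ≤ x) :
    ‖gaussC z 0 x‖ ≤ Real.exp (-(z.re * x ^ 2)) ∧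
    ‖gaussC z 1 x‖ ≤ 2 * ‖z‖ * x * Real.exp (-(z.re * x ^ 2)) ∧
    ‖gaussC z 2 x‖ ≤ (4 * ‖z‖ ^ 2 * x ^ 2 + 2 * ‖z‖) * Real.exp (-(z.re * x ^ 2)) ∧
    ‖gaussC z 3 x‖ ≤ (8 * ‖z‖ ^ 3 * x ^ 3 + 12 * ‖z‖ ^ 2 * x) * Real.exp (-(z.re * x ^ 2)) ∧
    ‖gaussC z 4 x‖ ≤ (16 * ‖z‖ ^ 4 * x ^ 4 + 48 * ‖z‖ ^ 3 * x ^ 2 + 12 * ‖z‖ ^ 2) *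
      Real.exp (-(z.re * x ^ 2)) := by
  have hn : ‖Complex.exp (-(z * x ^ 2))‖ = Real.exp (-(z.re * x ^ 2)) := by
    rw [Complex.norm_exp, ← Complex.ofReal_pow, Complex.neg_re, Complex.re_mul_ofReal]
  have hxn : ‖(x : ℂ)‖ = x := by rw [Complex.norm_real, Real.norm_eq_abs, abs_of_nonneg hx]
  refine ⟨?_, ?_, ?_, ?_, ?_⟩
  · simp only [gaussC, hn, le_refl]
  · simp only [gaussC, norm_mul, norm_neg, hn, hxn, Complex.norm_ofNat, le_refl]
  · simp only [gaussC, norm_mul, hn]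
    gcongr
    refine (norm_sub_le _ _).trans ?_
    simp only [norm_mul, norm_pow, hxn, Complex.norm_ofNat, le_refl]
  · simp only [gaussC, norm_mul, hn]
    gcongr
    refine (norm_add_le _ _).trans ?_
    simp only [norm_neg, norm_mul, norm_pow, hxn, Complex.norm_ofNat, le_refl]
  · simp only [gaussC, norm_mul, hn]
    gcongr
    refine (norm_add_le _ _).trans (add_le_add ((norm_sub_le _ _).trans ?_) ?_) <;>
    simp only [norm_mul, norm_pow, hxn, Complex.norm_ofNat, le_refl]

/-- The constant in the bound for the fourth derivative of `errC`. -/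
def errConst : ℝ := 64 * 4 * 24 ^ 3 * Real.exp 2

lemma errConst_pos : 0 < errConst := by
  unfold errConst
  positivity

/-- Leibniz' rule for the fourth derivative: each of the five terms is at most |z|³ times a
polynomial in |z|x². One factor |z| is set apart to cancel the z⁻¹ in `errC`. -/
lemma mulC_coshC_gaussC_le {z : ℂ} (hz1 : ‖z‖ ≤ 1) {x : ℝ} (hx : 0 ≤ x) :
    ‖mulC (coshC z) (gaussC z) 4 x‖ ≤ ‖z‖ * (64 * ‖z‖ ^ 2 * (1 + ‖z‖ * x ^ 2) ^ 3 *
      (Real.exp (‖z‖ * x) * Real.exp (-(z.re * x ^ 2)))) := by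
  obtain ⟨s0, s1, s2, s3, s4⟩ := norm_coshC_le z hx
  obtain ⟨g0, g1, g2, g3, g4⟩ := norm_gaussC_le z hx
  simp only [mulC]
  have hb0 : 0 ≤ ‖z‖ := norm_nonneg z
  have he0 : 0 < Real.exp (‖z‖ * x) := Real.exp_pos _
  have hn0 : 0 < Real.exp (-(z.re * x ^ 2)) := Real.exp_pos _
  generalize Real.exp (‖z‖ * x) = e at *
  generalize Real.exp (-(z.re * x ^ 2)) = n at *
  generalize ‖z‖ = b at *
  have h4 : ‖coshC z 4 x * gaussC z 0 x‖ ≤ 2 * b ^ 4 * e * n := by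
    rw [norm_mul]; gcongr
  have h3 : ‖4 * (coshC z 3 x * gaussC z 1 x)‖ ≤
      4 * ((2 * b ^ 4 * x * e) * (2 * b * x * n)) := by
    rw [norm_mul, norm_mul, Complex.norm_ofNat]; gcongr
  have h2 : ‖6 * (coshC z 2 x * gaussC z 2 x)‖ ≤
      6 * ((2 * b ^ 2 * e) * ((4 * b ^ 2 * x ^ 2 + 2 * b) * n)) := by
    rw [norm_mul, norm_mul, Complex.norm_ofNat]; gcongr
  have h1 : ‖4 * (coshC z 1 x * gaussC z 3 x)‖ ≤
      4 * ((2 * b ^ 2 * x * e) * ((8 * b ^ 3 * x ^ 3 + 12 * b ^ 2 * x) * n)) := by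
    rw [norm_mul, norm_mul, Complex.norm_ofNat]; gcongr
  have h0 : ‖coshC z 0 x * gaussC z 4 x‖ ≤
      (b ^ 2 * x ^ 2 * e) * ((16 * b ^ 4 * x ^ 4 + 48 * b ^ 3 * x ^ 2 + 12 * b ^ 2) * n) := by
    rw [norm_mul]; gcongr
  refine (norm_add_le _ _).trans ((add_le_add_left ((norm_add_le _ _).trans
    (add_le_add_left ((norm_add_le _ _).trans (add_le_add_left (norm_add_le _ _) _)) _)) _).trans ?_)
  refine (add_le_add (add_le_add (add_le_add (add_le_add h4 h3) h2) h1) h0).trans ?_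
  have key : 2 * b + 16 * b * (b * x ^ 2) + 12 * (4 * (b * x ^ 2) + 2) +
      8 * (b * x ^ 2) * (8 * (b * x ^ 2) + 12) +
      (b * x ^ 2) * (16 * (b * x ^ 2) ^ 2 + 48 * (b * x ^ 2) + 12) ≤
      64 * (1 + b * x ^ 2) ^ 3 := by
    have hs : 0 ≤ b * x ^ 2 := by positivity
    generalize b * x ^ 2 = s at *
    have h5 : b * s ≤ 1 * s := by gcongr
    have h6 : 0 ≤ s ^ 2 := by positivity
    have h7 : 0 ≤ s ^ 3 := by positivity
    have h8 : 64 * (1 + s) ^ 3 = 64 + 192 * s + 192 * s ^ 2 + 64 * s ^ 3 := by ring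
    rw [h8]
    nlinarith
  have h9 := mul_le_mul_of_nonneg_left key (show 0 ≤ b ^ 3 * (e * n) by positivity)
  calc _ = b ^ 3 * (e * n) * (2 * b + 16 * b * (b * x ^ 2) + 12 * (4 * (b * x ^ 2) + 2) +
      8 * (b * x ^ 2) * (8 * (b * x ^ 2) + 12) +
      (b * x ^ 2) * (16 * (b * x ^ 2) ^ 2 + 48 * (b * x ^ 2) + 12)) := by ring
    _ ≤ _ := h9
    _ = _ := by ring

lemma errConst_bound {b β x : ℝ} (hβ : 0 < β) (hβb : β ≤ b) (hb2 : b ≤ 2 * β) (hb1 : b ≤ 1)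
    (hx : 0 ≤ x) : 64 * b ^ 2 * (1 + b * x ^ 2) ^ 3 * (Real.exp (b * x) * Real.exp (-(β * x ^ 2))) ≤
      errConst * β ^ 2 * Real.exp (-(β / 4) * x ^ 2) := by
  have hb : 0 < b := hβ.trans_le hβb
  -- Completing the square, 2βx - βx²/2 = 2β - β(x-2)²/2 ≤ 2.
  have hexp : Real.exp (b * x) * Real.exp (-(β * x ^ 2)) ≤
      Real.exp 2 * Real.exp (-(β * x ^ 2 / 2)) := by
    rw [← Real.exp_add, ← Real.exp_add, Real.exp_le_exp]
    have h1 : b * x ≤ 2 * β * x := by gcongr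
    nlinarith [mul_nonneg hβ.le (sq_nonneg (x - 2))]
  -- Another quarter of the Gaussian exponent absorbs the polynomial, leaving e^{-βx²/4}; 24 = 2·12
  -- makes 1 + 2s ≤ 24(1 + s/12) with s = βx².
  have hpoly : (1 + b * x ^ 2) ^ 3 ≤ 24 ^ 3 * Real.exp (β * x ^ 2 / 4) := by
    have hbx : b * x ^ 2 ≤ 2 * β * x ^ 2 := by gcongr
    have hβx : 0 ≤ β * x ^ 2 := by positivity
    have h2 : 1 + b * x ^ 2 ≤ 24 * Real.exp (β * x ^ 2 / 12) := by
      have := Real.add_one_le_exp (β * x ^ 2 / 12)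
      linarith
    calc (1 + b * x ^ 2) ^ 3 ≤ (24 * Real.exp (β * x ^ 2 / 12)) ^ 3 := by gcongr
      _ = 24 ^ 3 * Real.exp (β * x ^ 2 / 12) ^ 3 := by ring
      _ = _ := by
        rw [← Real.exp_nat_mul]
        congr 2
        push_cast
        ring
  have hbb : b ^ 2 ≤ (2 * β) ^ 2 := by gcongr
  calc _ ≤ 64 * (2 * β) ^ 2 * (24 ^ 3 * Real.exp (β * x ^ 2 / 4)) *
        (Real.exp 2 * Real.exp (-(β * x ^ 2 / 2))) := by gcongr
    _ = errConst * β ^ 2 * (Real.exp (β * x ^ 2 / 4) * Real.exp (-(β * x ^ 2 / 2))) := by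
        rw [errConst]; ring
    _ = _ := by
        rw [← Real.exp_add]
        congr 2
        ring

lemma norm_errC_four_le {z : ℂ} (hz : 0 < z.re) (hz2 : ‖z‖ ≤ 2 * z.re) (hz1 : ‖z‖ ≤ 1) {x : ℝ}
    (hx : 0 ≤ x) : ‖errC z 4 x‖ ≤ errConst * z.re ^ 2 * Real.exp (-(z.re / 4) * x ^ 2) := by
  have hb : 0 < ‖z‖ := hz.trans_le (Complex.re_le_norm z)
  refine le_trans ?_ (errConst_bound hz (Complex.re_le_norm z) hz2 hz1 hx)
  have e : errC z 4 x = z⁻¹ * mulC (coshC z) (gaussC z) 4 x := by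
    simp only [errC, quadC, sub_zero]
  rw [e, norm_mul, norm_inv, inv_mul_le_iff₀ hb]
  exact mulC_coshC_gaussC_le hz1 hx

/-- `∫₀^∞` of the bound for the fourth derivative of `errC`. -/
def errInt (β : ℝ) : ℝ := ∫ x in Ioi (0 : ℝ), errConst * β ^ 2 * Real.exp (-(β / 4) * x ^ 2)

lemma errInt_eq {β : ℝ} (hβ : 0 < β) : errInt β = errConst * √Real.pi * (β * √β) := by
  rw [errInt, integral_const_mul, integral_gaussian_Ioi]
  have h1 : Real.pi / (β / 4) = 4 * Real.pi / β := by field_simp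
  have h2 : √(4 * Real.pi / β) = 2 * √Real.pi / √β := by
    rw [Real.sqrt_div' _ hβ.le, Real.sqrt_mul (by norm_num)]
    congr 2
    rw [show (4 : ℝ) = 2 ^ 2 by norm_num, Real.sqrt_sq (by norm_num)]
  have h3 : √β ≠ 0 := (Real.sqrt_pos.2 hβ).ne'
  rw [h1, h2]
  field_simp
  rw [Real.sq_sqrt hβ.le]

/-- The quadratic z x² removes the leading Taylor term, so the derivatives of orders 0 to 3 all
vanish at 0. Integrating the Gaussian bound for the fourth derivative downwards costs one power of x
per step, always with the constant `errInt`, which is O(β^{3/2}). -/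
lemma norm_errC_le {z : ℂ} (hz : 0 < z.re) (hz2 : ‖z‖ ≤ 2 * z.re) (hz1 : ‖z‖ ≤ 1) {x : ℝ}
    (hx : 0 ≤ x) : ‖errC z 3 x‖ ≤ errInt z.re ∧ ‖errC z 2 x‖ ≤ errInt z.re * x ∧
      ‖errC z 1 x‖ ≤ errInt z.re * x ^ 2 ∧ ‖errC z 0 x‖ ≤ errInt z.re * x ^ 3 := by
  have hz0 : z ≠ 0 := fun h => by simp [h] at hz
  have hch := isChain_errC z
  have i0 : errC z 0 0 = 0 := by simp [errC, mulC, coshC, gaussC, quadC, one_add_one_eq_two]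
  have i1 : errC z 1 0 = 0 := by simp [errC, mulC, coshC, gaussC, quadC]
  have i2 : errC z 2 0 = 0 := by
    simp [errC, mulC, coshC, gaussC, quadC]
    field_simp
    ring
  have i3 : errC z 3 0 = 0 := by simp [errC, mulC, coshC, gaussC, quadC]
  have hGi : IntegrableOn (fun x : ℝ => errConst * z.re ^ 2 * Real.exp (-(z.re / 4) * x ^ 2))
      (Ioi 0) :=
    ((integrable_exp_neg_mul_sq (by positivity)).const_mul _).integrableOn
  have hL0 : 0 ≤ errInt z.re := by
    rw [errInt_eq hz]
    have := errConst_pos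
    positivity
  have b3 : ∀ x : ℝ, 0 ≤ x → ‖errC z 3 x‖ ≤ errInt z.re := fun x hx => by
    have hc : Continuous (errC z 4) := by
      unfold errC
      simp only [mulC, coshC, gaussC, quadC]
      fun_prop
    have hI := intervalIntegral.integral_eq_sub_of_hasDerivAt (a := 0) (b := x)
      (fun y _ => hch 3 (by norm_num) y) (hc.intervalIntegrable _ _)
    rw [i3, sub_zero] at hI
    rw [← hI]
    refine (intervalIntegral.norm_integral_le_of_norm_le hx (Eventually.of_forall fun y hy =>
      norm_errC_four_le hz hz2 hz1 hy.1.le) ?_).trans ?_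
    · exact (intervalIntegrable_iff_integrableOn_Ioc_of_le hx).2
        (hGi.mono_set fun y hy => hy.1)
    · rw [intervalIntegral.integral_of_le hx, errInt]
      refine setIntegral_mono_set hGi (Eventually.of_forall fun y => ?_)
        (Eventually.of_forall fun y hy => hy.1)
      have := errConst_pos
      simp only [Pi.zero_apply]
      positivity
  have step : ∀ i < 4, errC z i 0 = 0 → ∀ B : ℝ → ℝ, (∀ x y, 0 ≤ x → x ≤ y → B x ≤ B y) →
      (∀ x, 0 ≤ x → ‖errC z (i + 1) x‖ ≤ B x) → ∀ x, 0 ≤ x → ‖errC z i x‖ ≤ B x * x := by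
    intro i hi h0 B hB hle x hx
    have := (convex_Icc (0 : ℝ) x).norm_image_sub_le_of_norm_hasDerivWithin_le
      (f := errC z i) (f' := errC z (i + 1)) (C := B x) (x := 0) (y := x)
      (fun y _ => (hch i hi y).hasDerivWithinAt)
      (fun y hy => (hle y hy.1).trans (hB y x hy.1 hy.2)) ⟨le_rfl, hx⟩ ⟨hx, le_rfl⟩
    rwa [h0, sub_zero, sub_zero, Real.norm_eq_abs, abs_of_nonneg hx] at this
  have b2 := step 2 (by norm_num) i2 (fun _ => errInt z.re) (fun _ _ _ _ => le_rfl) b3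
  have b1 := step 1 (by norm_num) i1 (fun x => errInt z.re * x) (fun x y _ hxy => by gcongr) b2
  have b0 := step 0 (by norm_num) i0 (fun x => errInt z.re * x * x)
    (fun x y hx hxy => by
      have := hx.trans hxy
      gcongr) b1
  refine ⟨b3 x hx, b2 x hx, (b1 x hx).trans_eq (by ring), (b0 x hx).trans_eq (by ring)⟩

lemma pow_le_exp_half {v : ℝ} (hv : 0 ≤ v) : 1 ≤ Real.exp (v / 2) ∧ v ≤ 2 * Real.exp (v / 2) ∧
    v ^ 2 ≤ 8 * Real.exp (v / 2) ∧ v ^ 3 ≤ 48 * Real.exp (v / 2) := by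
  have h := fun n : ℕ => Real.pow_div_factorial_le_exp (v / 2) (by positivity) n
  have h1 := h 1
  have h2 := h 2
  have h3 := h 3
  norm_num [Nat.factorial] at h1 h2 h3
  refine ⟨Real.one_le_exp (by positivity), by linarith, by nlinarith, by nlinarith⟩

lemma exp_neg_eq_half_mul (v : ℝ) : Real.exp (v / 2) * Real.exp (-v) = Real.exp (-(v / 2)) := by
  rw [← Real.exp_add]
  congr 1
  ring

lemma integral_mul_exp_half {t : ℝ} (ht : 0 < t) (c : ℝ) :
    IntegrableOn (fun x : ℝ => c * t * Real.exp (-(t * x / 2))) (Ioi 0) ∧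
    ∫ x in Ioi (0 : ℝ), c * t * Real.exp (-(t * x / 2)) = 2 * c := by
  have e : ∀ x : ℝ, -(t * x / 2) = -(t / 2) * x := fun x => by ring
  simp only [e]
  constructor
  · exact (exp_neg_integrableOn_Ioi 0 (by positivity)).const_mul _
  · rw [integral_const_mul, integral_exp_mul_Ioi (by linarith)]
    simp
    field_simp

/-! ### The main term and the estimate of A near the real axis -/

lemma hasSum_sq_mul_geometric {r : ℂ} (hr : ‖r‖ < 1) :
    HasSum (fun j : ℕ => (j : ℂ) ^ 2 * r ^ j) (r * (1 + r) / (1 - r) ^ 3) := by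
  have h0 : 1 - r ≠ 0 := fun h => by
    rw [← sub_eq_zero.1 h] at hr
    simp at hr
  have h2 := (hasSum_choose_mul_geometric_of_norm_lt_one 2 hr).mul_left 2
  have h1 := (hasSum_coe_mul_geometric_of_norm_lt_one hr).mul_left 3
  have h := (h2.sub h1).sub ((hasSum_geometric_of_norm_lt_one hr).mul_left 2)
  have e : 2 * (1 / (1 - r) ^ (2 + 1)) - 3 * (r / (1 - r) ^ 2) - 2 * (1 - r)⁻¹ =
      r * (1 + r) / (1 - r) ^ 3 := by
    field_simp
    ring
  rw [e] at h
  refine hasSum_of_eq (fun j => ?_) h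
  have hc : (((j + 2).choose 2 : ℕ) : ℂ) = ((j : ℂ) + 2) * (j + 1) / 2 := by
    rw [Nat.cast_choose_two]
    push_cast
    ring
  rw [hc]
  ring

/-- The product of `z x²` and `e^{-zmx}`, with its derivatives. -/
def mainC (z : ℂ) (m : ℝ) : ℕ → ℝ → ℂ := mulC (quadC z) (expC (-(z * m)))

/-- `∑_j ∂ₓ (z x² e^{-zmx})` at `x = j`. -/
def mainSum (z : ℂ) (m : ℝ) : ℂ :=
  2 * z * (Complex.exp (-(z * m)) / (1 - Complex.exp (-(z * m))) ^ 2) -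
    z ^ 2 * m * (Complex.exp (-(z * m)) * (1 + Complex.exp (-(z * m))) /
      (1 - Complex.exp (-(z * m))) ^ 3)

lemma norm_exp_neg_mul_ofReal (z : ℂ) (m : ℝ) :
    ‖Complex.exp (-(z * m))‖ = Real.exp (-(z.re * m)) := by
  rw [Complex.norm_exp, Complex.neg_re, Complex.re_mul_ofReal]

lemma hasSum_mainC {z : ℂ} {m : ℝ} (hz : 0 < z.re) (hm : 0 < m) :
    HasSum (fun j : ℕ => mainC z m 1 j) (mainSum z m) := by
  have hr : ‖Complex.exp (-(z * m))‖ < 1 := by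
    rw [norm_exp_neg_mul_ofReal, Real.exp_lt_one_iff]
    nlinarith
  have h := ((hasSum_coe_mul_geometric_of_norm_lt_one hr).mul_left (2 * z)).sub
    ((hasSum_sq_mul_geometric hr).mul_left (z ^ 2 * m))
  refine hasSum_of_eq (fun j => ?_) h
  have e : Complex.exp (-(z * m)) ^ j = Complex.exp (-(z * m) * j) := by
    rw [← Complex.exp_nat_mul, mul_comm]
  rw [e]
  simp only [mainC, mulC, quadC, expC, Complex.ofReal_natCast]
  ring

lemma mainSum_ofReal {β m : ℝ} (hβ : 0 < β) (hm : 0 < m) :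
    mainSum β m = -((P m β : ℝ) : ℂ) := by
  rw [P_eq hm hβ, mainSum]
  push_cast
  ring

lemma tendsto_of_norm_le_exp {w : ℕ → ℂ} {t : ℝ} (ht : 0 < t) (C : ℝ)
    (h : ∀ n : ℕ, ‖w n‖ ≤ C * Real.exp (-(t * n / 2))) : Tendsto w atTop (𝓝 0) := by
  refine squeeze_zero_norm h ?_
  have h1 : Tendsto (fun n : ℕ => t * (n : ℝ) / 2) atTop atTop :=
    (tendsto_natCast_atTop_atTop.const_mul_atTop ht).atTop_div_const (by norm_num)
  simpa using (Real.tendsto_exp_neg_atTop_nhds_zero.comp h1).const_mul C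

lemma pow_mul_exp_neg_le {t x : ℝ} (ht : 0 < t) (hx : 0 ≤ x) :
    Real.exp (-(t * x)) ≤ Real.exp (-(t * x / 2)) ∧
    x * Real.exp (-(t * x)) ≤ 2 / t * Real.exp (-(t * x / 2)) ∧
    x ^ 2 * Real.exp (-(t * x)) ≤ 8 / t ^ 2 * Real.exp (-(t * x / 2)) ∧
    x ^ 3 * Real.exp (-(t * x)) ≤ 48 / t ^ 3 * Real.exp (-(t * x / 2)) := by
  have hv : 0 ≤ t * x := by positivity
  obtain ⟨h0, h1, h2, h3⟩ := pow_le_exp_half hv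
  have key : ∀ (i : ℕ) (c : ℝ), (t * x) ^ i ≤ c * Real.exp (t * x / 2) →
      x ^ i * Real.exp (-(t * x)) ≤ c / t ^ i * Real.exp (-(t * x / 2)) := fun i c hc => by
    rw [← exp_neg_eq_half_mul (t * x)]
    have : x ^ i ≤ c / t ^ i * Real.exp (t * x / 2) := by
      rw [div_mul_eq_mul_div, le_div_iff₀ (by positivity), ← mul_pow, mul_comm x]
      exact hc
    calc x ^ i * Real.exp (-(t * x)) ≤ c / t ^ i * Real.exp (t * x / 2) * Real.exp (-(t * x)) := by
          gcongr
      _ = _ := by ring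
  have k1 := key 1 2 (by simpa using h1)
  simp only [pow_one] at k1
  exact ⟨by simpa using key 0 1 (by simpa using h0), k1, key 2 8 h2, key 3 48 h3⟩

lemma norm_expC_le {z : ℂ} {m : ℝ} (hz2 : ‖z‖ ≤ 2 * z.re) (hm : 0 ≤ m) (i : ℕ) (x : ℝ) :
    ‖expC (-(z * m)) i x‖ ≤ (2 * (z.re * m)) ^ i * Real.exp (-(z.re * m * x)) := by
  have h : ‖Complex.exp (-(z * m) * x)‖ = Real.exp (-(z.re * m * x)) := by
    rw [neg_mul, mul_assoc, ← Complex.ofReal_mul, norm_exp_neg_mul_ofReal, mul_assoc]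
  rw [expC, norm_mul, norm_pow, norm_neg, norm_mul, h, Complex.norm_real, Real.norm_eq_abs,
    abs_of_nonneg hm]
  have h2 : ‖z‖ * m ≤ 2 * (z.re * m) := by
    rw [← mul_assoc]
    gcongr
  gcongr

lemma tendsto_mainC {z : ℂ} {m : ℝ} (hz : 0 < z.re) (hz2 : ‖z‖ ≤ 2 * z.re) (hm : 0 < m) :
    Tendsto (fun n : ℕ => mainC z m 0 n) atTop (𝓝 0) ∧
    Tendsto (fun n : ℕ => mainC z m 1 n) atTop (𝓝 0) := by
  have ht : 0 < z.re * m := by positivity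
  have he := fun i (n : ℕ) => norm_expC_le hz2 hm.le i (n : ℝ)
  constructor
  · refine tendsto_of_norm_le_exp ht (‖z‖ * (8 / (z.re * m) ^ 2)) fun n => ?_
    obtain ⟨-, -, b2, -⟩ := pow_mul_exp_neg_le ht (Nat.cast_nonneg n)
    have h0 := he 0 n
    simp only [mainC, mulC, quadC, norm_mul, norm_pow, Complex.norm_real, Real.norm_natCast] at h0 ⊢
    calc _ ≤ ‖z‖ * (n : ℝ) ^ 2 * ((2 * (z.re * m)) ^ 0 * Real.exp (-(z.re * m * n))) := by gcongr
      _ = ‖z‖ * ((n : ℝ) ^ 2 * Real.exp (-(z.re * m * n))) := by ring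
      _ ≤ ‖z‖ * (8 / (z.re * m) ^ 2 * Real.exp (-(z.re * m * n / 2))) := by gcongr
      _ = _ := by ring
  · refine tendsto_of_norm_le_exp ht (2 * ‖z‖ * (2 / (z.re * m)) +
      2 * (z.re * m) * ‖z‖ * (8 / (z.re * m) ^ 2)) fun n => ?_
    obtain ⟨-, b1, b2, -⟩ := pow_mul_exp_neg_le ht (Nat.cast_nonneg n)
    have h0 := he 0 n
    have h1 := he 1 n
    simp only [mainC, mulC, quadC]
    refine (norm_add_le _ _).trans ?_
    simp only [norm_mul, norm_pow, Complex.norm_real, Real.norm_natCast, Complex.norm_ofNat]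
    calc _ ≤ 2 * ‖z‖ * n * ((2 * (z.re * m)) ^ 0 * Real.exp (-(z.re * m * n))) +
          ‖z‖ * (n : ℝ) ^ 2 * ((2 * (z.re * m)) ^ 1 * Real.exp (-(z.re * m * n))) := by gcongr
      _ = 2 * ‖z‖ * (n * Real.exp (-(z.re * m * n))) +
          2 * (z.re * m) * ‖z‖ * ((n : ℝ) ^ 2 * Real.exp (-(z.re * m * n))) := by ring
      _ ≤ 2 * ‖z‖ * (2 / (z.re * m) * Real.exp (-(z.re * m * n / 2))) +
          2 * (z.re * m) * ‖z‖ * (8 / (z.re * m) ^ 2 * Real.exp (-(z.re * m * n / 2))) := by gcongr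
      _ = _ := by ring

/-- The third derivative of `z x² e^{-zmx}` as a function of `z`, with its derivative. -/
lemma hasDerivAt_mainC_three (m x : ℝ) (z : ℂ) :
    HasDerivAt (fun z => mainC z m 3 x) ((-12 * z * m + 24 * z ^ 2 * m ^ 2 * x -
      10 * z ^ 3 * m ^ 3 * x ^ 2 + z ^ 4 * m ^ 4 * x ^ 3) * Complex.exp (-(z * m) * x)) z := by
  have e : (fun z => mainC z m 3 x) = fun z : ℂ => (-6 * m * z ^ 2 + 6 * m ^ 2 * x * z ^ 3 -
      m ^ 3 * x ^ 2 * z ^ 4) * Complex.exp (-(z * m) * x) := by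
    funext z
    simp only [mainC, mulC, quadC, expC]
    ring
  rw [e]
  have hz := hasDerivAt_id z
  have h1 : HasDerivAt (fun z : ℂ => Complex.exp (-(z * m) * x))
      (Complex.exp (-(z * m) * x) * (-m * x)) z :=
    ((((hz.mul_const (m : ℂ)).neg).mul_const (x : ℂ)).cexp).congr_deriv (by
      simp only [id, Pi.neg_apply]; ring)
  have hp : ∀ (c : ℂ) (i : ℕ), HasDerivAt (fun z : ℂ => c * z ^ i) (c * (i * z ^ (i - 1))) z :=
    fun c i => (hasDerivAt_pow i z).const_mul c
  refine ((((hp (-6 * m) 2).add (hp (6 * m ^ 2 * x) 3)).sub (hp (m ^ 3 * x ^ 2) 4)).mul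
    h1).congr_deriv ?_
  simp only [Pi.sub_apply, Pi.add_apply]
  push_cast
  ring

/-- Mean value inequality in z along the vertical segment from β to β + iy. Every term of the
z-derivative is βm times a power of βmx, which half of the exponential absorbs. -/
lemma norm_mainC_three_sub_le {β y m x : ℝ} (hβ : 0 < β) (hy : |y| ≤ β) (hm : 0 < m)
    (hx : 0 ≤ x) :
    ‖mainC (β + y * Complex.I) m 3 x - mainC β m 3 x‖ ≤
      1624 * |y| * (β * m) * Real.exp (-(β * m * x / 2)) := by
  have hd : ∀ s : ℝ, HasDerivAt (fun s : ℝ => mainC (β + s * Complex.I) m 3 x) _ s := fun s => by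
    have hl : HasDerivAt (fun s : ℂ => (β : ℂ) + s * Complex.I) Complex.I s := by
      simpa using ((hasDerivAt_id (s : ℂ)).mul_const Complex.I).const_add (β : ℂ)
    exact (HasDerivAt.comp (h₂ := fun z => mainC z m 3 x) (s : ℂ)
      (hasDerivAt_mainC_three m x _) hl).comp_ofReal
  have h := (convex_Icc (-|y|) |y|).norm_image_sub_le_of_norm_hasDerivWithin_le
    (f := fun s : ℝ => mainC (β + s * Complex.I) m 3 x) (x := 0) (y := y)
    (C := 1624 * (β * m) * Real.exp (-(β * m * x / 2)))
    (fun s _ => (hd s).hasDerivWithinAt) (fun s hs => ?_) (by simp) (abs_le.1 le_rfl)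
  · simp only [Complex.ofReal_zero, zero_mul, add_zero, sub_zero, Real.norm_eq_abs] at h
    exact h.trans_eq (by ring)
  · have hn : ‖(β : ℂ) + s * Complex.I‖ ≤ 2 * β := by
      refine (norm_add_le _ _).trans ?_
      rw [norm_mul, Complex.norm_I, Complex.norm_real, Complex.norm_real, Real.norm_eq_abs,
        Real.norm_eq_abs, abs_of_pos hβ]
      have := abs_le.2 hs
      linarith
    have hre : ((β : ℂ) + s * Complex.I).re = β := by simp
    have hE : ‖Complex.exp (-(((β : ℂ) + s * Complex.I) * m) * x)‖ = Real.exp (-(β * m * x)) := by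
      rw [neg_mul, mul_assoc, ← Complex.ofReal_mul, norm_exp_neg_mul_ofReal, hre, mul_assoc]
    rw [norm_mul, Complex.norm_I, mul_one, norm_mul, hE]
    generalize (β : ℂ) + s * Complex.I = z at *
    have hv : 0 ≤ β * m * x := by positivity
    obtain ⟨b0, b1, b2, b3⟩ := pow_le_exp_half hv
    have hpoly : ‖-12 * z * m + 24 * z ^ 2 * m ^ 2 * x - 10 * z ^ 3 * m ^ 3 * x ^ 2 +
        z ^ 4 * m ^ 4 * x ^ 3‖ ≤ 12 * (2 * β) * m + 24 * (2 * β) ^ 2 * m ^ 2 * x +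
        10 * (2 * β) ^ 3 * m ^ 3 * x ^ 2 + (2 * β) ^ 4 * m ^ 4 * x ^ 3 := by
      refine (norm_add_le _ _).trans (add_le_add ((norm_sub_le _ _).trans (add_le_add
        ((norm_add_le _ _).trans (add_le_add ?_ ?_)) ?_)) ?_) <;>
      · simp only [norm_mul, norm_pow, norm_neg, Complex.norm_ofNat, Complex.norm_real,
          Real.norm_eq_abs, abs_of_pos hm, abs_of_nonneg hx]
        gcongr
    calc _ ≤ (12 * (2 * β) * m + 24 * (2 * β) ^ 2 * m ^ 2 * x +
          10 * (2 * β) ^ 3 * m ^ 3 * x ^ 2 + (2 * β) ^ 4 * m ^ 4 * x ^ 3) *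
            Real.exp (-(β * m * x)) := by gcongr
      _ = β * m * (24 * 1 + 96 * (β * m * x) + 80 * (β * m * x) ^ 2 + 16 * (β * m * x) ^ 3) *
            Real.exp (-(β * m * x)) := by ring
      -- The constant is 24 + 96·2 + 80·8 + 16·48 = 1624.
      _ ≤ β * m * (24 * Real.exp (β * m * x / 2) + 96 * (2 * Real.exp (β * m * x / 2)) +
            80 * (8 * Real.exp (β * m * x / 2)) + 16 * (48 * Real.exp (β * m * x / 2))) *
            Real.exp (-(β * m * x)) := by gcongr
      _ = 1624 * (β * m) * (Real.exp (β * m * x / 2) * Real.exp (-(β * m * x))) := by ring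
      _ = _ := by rw [exp_neg_eq_half_mul]

lemma isChain_mainC (z : ℂ) (m : ℝ) : IsChain (mainC z m) :=
  (isChain_quadC z).mul (isChain_expC _)

/-- The factor |y| is already present, so Euler–Maclaurin through the third derivative suffices; the
fourth-order form is not applicable, because the second derivative of the difference at 0 is 2iy.
The bound is uniform in m, since ∫ t e^{-tx/2} dx = 2 for t = βm. -/
lemma norm_mainSum_sub_le {β y m : ℝ} (hβ : 0 < β) (hy : |y| ≤ β) (hm : 0 < m) :
    ‖mainSum (β + y * Complex.I) m - mainSum β m‖ ≤ 3248 * |y| := by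
  have ht : 0 < β * m := by positivity
  have hre : ((β : ℂ) + y * Complex.I).re = β := by simp
  have hn : ‖(β : ℂ) + y * Complex.I‖ ≤ 2 * ((β : ℂ) + y * Complex.I).re := by
    rw [hre]
    refine (norm_add_le _ _).trans ?_
    rw [norm_mul, Complex.norm_I, Complex.norm_real, Complex.norm_real, Real.norm_eq_abs,
      Real.norm_eq_abs, abs_of_pos hβ]
    linarith
  have hn' : ‖(β : ℂ)‖ ≤ 2 * (β : ℂ).re := by
    rw [Complex.norm_real, Real.norm_eq_abs, abs_of_pos hβ, Complex.ofReal_re]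
    linarith
  have t1 := tendsto_mainC (by rwa [hre]) hn hm
  have t2 := tendsto_mainC (z := β) (by simpa using hβ) hn' hm
  obtain ⟨hI, hV⟩ := integral_mul_exp_half ht (1624 * |y|)
  refine (norm_sum_deriv_le_third ((isChain_mainC _ m).sub (isChain_mainC _ m)) ?_ ?_ ?_ ?_ hI
    (fun x hx => norm_mainC_three_sub_le hβ hy hm hx)
    ((hasSum_mainC (by rwa [hre]) hm).sub (hasSum_mainC (by simpa using hβ) hm))).trans_eq ?_
  · simp [mainC, mulC, quadC]
  · simp [mainC, mulC, quadC]
  · simpa using t1.1.sub t2.1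
  · simpa using t1.2.sub t2.2
  · rw [hV]; ring

/-- The derivatives of `z⁻¹ (e^{zx} + e^{-zx} - 2) e^{-zx²-zmx} - z x² e^{-zmx}`. -/
def diffC (z : ℂ) (m : ℝ) : ℕ → ℝ → ℂ := mulC (errC z) (expC (-(z * m)))

/-- With m = r+1 and q = e^{-z}, the summand (m±1+2j)q^{j²+j(m±1)} is -z⁻¹ times the x-derivative of
e^{-zx²-z(m±1)x} at x = j. The second difference in m therefore creates the factor e^{zx} + e^{-zx}
- 2, and A becomes minus a sum of derivatives. -/
lemma hasSum_diffC {z : ℂ} (hz : 0 < z.re) (r : ℕ) :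
    HasSum (fun j : ℕ => diffC z ((r + 1 : ℕ) : ℝ) 1 j)
      (-A 0 ((r + 1 : ℕ) : ℤ) (Complex.exp (-z)) - mainSum z ((r + 1 : ℕ) : ℝ)) := by
  have hz0 : z ≠ 0 := fun h => by simp [h] at hz
  have hq : ‖Complex.exp (-z)‖ < 1 := by
    rw [Complex.norm_exp, Complex.neg_re, Real.exp_lt_one_iff]
    linarith
  have hA := A_eq_second_diff hq (r : ℤ)
  have h0 := hasSum_H (Complex.exp_ne_zero _) hq r
  have h1 := hasSum_H (Complex.exp_ne_zero _) hq (r + 1)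
  have h2 := hasSum_H (Complex.exp_ne_zero _) hq (r + 2)
  have hM := hasSum_mainC (m := ((r + 1 : ℕ) : ℝ)) hz (by positivity)
  have h := ((h2.sub (h1.mul_left 2)).add h0).neg.sub hM
  have e : -(H (Complex.exp (-z)) (r + 2 : ℕ) - 2 * H (Complex.exp (-z)) (r + 1 : ℕ) +
      H (Complex.exp (-z)) r) - mainSum z ((r + 1 : ℕ) : ℝ) =
      -A 0 ((r + 1 : ℕ) : ℤ) (Complex.exp (-z)) - mainSum z ((r + 1 : ℕ) : ℝ) := by
    push_cast
    rw [hA]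
  rw [e] at h
  refine hasSum_of_eq (fun j => ?_) h
  have hp : ∀ s : ℕ, Complex.exp (-z) ^ (j * j + j * s) =
      Complex.exp (-(z * (j : ℂ) ^ 2)) * Complex.exp (-(z * s) * j) := fun s => by
    rw [← Complex.exp_nat_mul, ← Complex.exp_add]
    congr 1
    push_cast
    ring
  have e2 : Complex.exp (-(z * ((r + 2 : ℕ) : ℂ)) * j) =
      Complex.exp (-(z * ((r + 1 : ℕ) : ℂ)) * j) * Complex.exp (-(z * j)) := by
    rw [← Complex.exp_add]
    congr 1
    push_cast
    ring
  have e0 : Complex.exp (-(z * (r : ℂ)) * j) =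
      Complex.exp (-(z * ((r + 1 : ℕ) : ℂ)) * j) * Complex.exp (z * j) := by
    rw [← Complex.exp_add]
    congr 1
    push_cast
    ring
  rw [hp, hp, hp, e2, e0]
  simp only [diffC, mainC, mulC, quadC, expC, errC, coshC, gaussC, Complex.ofReal_natCast]
  generalize Complex.exp (-(z * ((r + 1 : ℕ) : ℂ)) * j) = E
  generalize Complex.exp (-(z * (j : ℂ) ^ 2)) = G
  generalize Complex.exp (z * j) = u
  generalize Complex.exp (-(z * j)) = v
  push_cast
  field_simp
  ring

/-- In Leibniz' rule the i-th derivative of `errC` with i ≤ 3 contributes x^{3-i}(βm)^{4-i}e^{-βmx},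
that is βm times a function of βmx. Its integral does not depend on m. The constant is 8 + 24·2 +
32·8 + 16·48 = 1080. -/
lemma norm_diffC_four_le {z : ℂ} {m x : ℝ} (hz : 0 < z.re) (hz2 : ‖z‖ ≤ 2 * z.re) (hz1 : ‖z‖ ≤ 1)
    (hm : 0 < m) (hx : 0 ≤ x) :
    ‖diffC z m 4 x‖ ≤ errConst * z.re ^ 2 * Real.exp (-(z.re / 4) * x ^ 2) +
      1080 * errInt z.re * (z.re * m) * Real.exp (-(z.re * m * x / 2)) := by
  have ht : 0 < z.re * m := by positivity
  have he := fun i => norm_expC_le hz2 hm.le i x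
  have h4 := norm_errC_four_le hz hz2 hz1 hx
  obtain ⟨h3, h2, h1, h0⟩ := norm_errC_le hz hz2 hz1 hx
  have hL : 0 ≤ errInt z.re := (norm_nonneg _).trans h3
  have hv : 0 ≤ z.re * m * x := by positivity
  obtain ⟨b0, b1, b2, b3⟩ := pow_le_exp_half hv
  have hE1 : Real.exp (-(z.re * m * x)) ≤ 1 := Real.exp_le_one_iff.2 (by linarith)
  have hEE := exp_neg_eq_half_mul (z.re * m * x)
  have hc : 0 ≤ errConst := errConst_pos.le
  simp only [diffC, mulC]
  generalize hQ : errConst * z.re ^ 2 * Real.exp (-(z.re / 4) * x ^ 2) = Q at *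
  have hQ0 : 0 ≤ Q := (norm_nonneg _).trans h4
  generalize errInt z.re = L at *
  generalize z.re * m = t at *
  have e0 := he 0
  have e1 := he 1
  have e2 := he 2
  have e3 := he 3
  have e4 := he 4
  have hEp : 0 < Real.exp (-(t * x)) := Real.exp_pos _
  calc _ ≤ ‖errC z 4 x * expC (-(z * m)) 0 x‖ + ‖4 * (errC z 3 x * expC (-(z * m)) 1 x)‖ +
        ‖6 * (errC z 2 x * expC (-(z * m)) 2 x)‖ + ‖4 * (errC z 1 x * expC (-(z * m)) 3 x)‖ +
        ‖errC z 0 x * expC (-(z * m)) 4 x‖ :=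
        (norm_add_le _ _).trans (add_le_add ((norm_add_le _ _).trans (add_le_add
          ((norm_add_le _ _).trans (add_le_add (norm_add_le _ _) le_rfl)) le_rfl)) le_rfl)
    _ ≤ Q * ((2 * t) ^ 0 * 1) + 4 * (L * ((2 * t) ^ 1 * Real.exp (-(t * x)))) +
        6 * (L * x * ((2 * t) ^ 2 * Real.exp (-(t * x)))) +
        4 * (L * x ^ 2 * ((2 * t) ^ 3 * Real.exp (-(t * x)))) +
        L * x ^ 3 * ((2 * t) ^ 4 * Real.exp (-(t * x))) := by
        simp only [norm_mul, Complex.norm_ofNat]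
        have e0' := e0.trans (mul_le_mul_of_nonneg_left hE1 (by positivity))
        gcongr
    _ = Q + L * t * (8 * 1 + 24 * (t * x) + 32 * (t * x) ^ 2 + 16 * (t * x) ^ 3) *
        Real.exp (-(t * x)) := by ring
    _ ≤ Q + L * t * (8 * Real.exp (t * x / 2) + 24 * (2 * Real.exp (t * x / 2)) +
        32 * (8 * Real.exp (t * x / 2)) + 16 * (48 * Real.exp (t * x / 2))) *
        Real.exp (-(t * x)) := by gcongr
    _ = Q + 1080 * L * t * (Real.exp (t * x / 2) * Real.exp (-(t * x))) := by ring
    _ = _ := by rw [hEE]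

lemma tendsto_diffC {z : ℂ} {m : ℝ} (hz : 0 < z.re) (hz2 : ‖z‖ ≤ 2 * z.re) (hz1 : ‖z‖ ≤ 1)
    (hm : 0 < m) : Tendsto (fun n : ℕ => diffC z m 0 n) atTop (𝓝 0) ∧
    Tendsto (fun n : ℕ => diffC z m 1 n) atTop (𝓝 0) ∧
    Tendsto (fun n : ℕ => diffC z m 2 n) atTop (𝓝 0) := by
  have ht : 0 < z.re * m := by positivity
  have he := fun i (n : ℕ) => norm_expC_le hz2 hm.le i (n : ℝ)
  have hb := fun n : ℕ => norm_errC_le hz hz2 hz1 (Nat.cast_nonneg n)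
  have hL : 0 ≤ errInt z.re := (norm_nonneg _).trans (hb 0).1
  generalize errInt z.re = L at *
  generalize z.re * m = t at *
  refine ⟨tendsto_of_norm_le_exp ht (L * (48 / t ^ 3)) fun n => ?_,
    tendsto_of_norm_le_exp ht (L * (8 / t ^ 2) + L * (2 * t) * (48 / t ^ 3)) fun n => ?_,
    tendsto_of_norm_le_exp ht (L * (2 / t) + 2 * (L * (2 * t)) * (8 / t ^ 2) +
      L * (2 * t) ^ 2 * (48 / t ^ 3)) fun n => ?_⟩
  all_goals
    obtain ⟨h3, h2, h1, h0⟩ := hb n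
    obtain ⟨-, b1, b2, b3⟩ := pow_mul_exp_neg_le ht (Nat.cast_nonneg n)
    have e0 := he 0 n
    have e1 := he 1 n
    have e2 := he 2 n
    simp only [diffC, mulC]
  · rw [norm_mul]
    calc _ ≤ L * (n : ℝ) ^ 3 * ((2 * t) ^ 0 * Real.exp (-(t * n))) := by gcongr
      _ = L * ((n : ℝ) ^ 3 * Real.exp (-(t * n))) := by ring
      _ ≤ L * (48 / t ^ 3 * Real.exp (-(t * n / 2))) := by gcongr
      _ = _ := by ring
  · refine (norm_add_le _ _).trans ?_
    rw [norm_mul, norm_mul]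
    calc _ ≤ L * (n : ℝ) ^ 2 * ((2 * t) ^ 0 * Real.exp (-(t * n))) +
          L * (n : ℝ) ^ 3 * ((2 * t) ^ 1 * Real.exp (-(t * n))) := by gcongr
      _ = L * ((n : ℝ) ^ 2 * Real.exp (-(t * n))) +
          L * (2 * t) * ((n : ℝ) ^ 3 * Real.exp (-(t * n))) := by ring
      _ ≤ L * (8 / t ^ 2 * Real.exp (-(t * n / 2))) +
          L * (2 * t) * (48 / t ^ 3 * Real.exp (-(t * n / 2))) := by gcongr
      _ = _ := by ring
  · refine (norm_add_le _ _).trans ((add_le_add_left (norm_add_le _ _) _).trans ?_)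
    rw [norm_mul, norm_mul, norm_mul, norm_mul, Complex.norm_ofNat]
    calc _ ≤ L * n * ((2 * t) ^ 0 * Real.exp (-(t * n))) +
          2 * (L * (n : ℝ) ^ 2 * ((2 * t) ^ 1 * Real.exp (-(t * n)))) +
          L * (n : ℝ) ^ 3 * ((2 * t) ^ 2 * Real.exp (-(t * n))) := by gcongr
      _ = L * (n * Real.exp (-(t * n))) +
          2 * (L * (2 * t)) * ((n : ℝ) ^ 2 * Real.exp (-(t * n))) +
          L * (2 * t) ^ 2 * ((n : ℝ) ^ 3 * Real.exp (-(t * n))) := by ring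
      _ ≤ L * (2 / t * Real.exp (-(t * n / 2))) +
          2 * (L * (2 * t)) * (8 / t ^ 2 * Real.exp (-(t * n / 2))) +
          L * (2 * t) ^ 2 * (48 / t ^ 3 * Real.exp (-(t * n / 2))) := by gcongr
      _ = _ := by ring

lemma norm_A_add_mainSum_le {z : ℂ} (hz : 0 < z.re) (hz2 : ‖z‖ ≤ 2 * z.re) (hz1 : ‖z‖ ≤ 1)
    (r : ℕ) : ‖A 0 ((r + 1 : ℕ) : ℤ) (Complex.exp (-z)) + mainSum z ((r + 1 : ℕ) : ℝ)‖ ≤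
      2161 * errInt z.re := by
  have hm : (0 : ℝ) < ((r + 1 : ℕ) : ℝ) := by positivity
  have ht : 0 < z.re * ((r + 1 : ℕ) : ℝ) := by positivity
  have hz0 : z ≠ 0 := fun h => by simp [h] at hz
  obtain ⟨t0, t1, t2⟩ := tendsto_diffC hz hz2 hz1 hm
  obtain ⟨hI, hV⟩ := integral_mul_exp_half ht (1080 * errInt z.re)
  have hGi : IntegrableOn (fun x : ℝ => errConst * z.re ^ 2 * Real.exp (-(z.re / 4) * x ^ 2))
      (Ioi 0) :=
    ((integrable_exp_neg_mul_sq (by positivity)).const_mul _).integrableOn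
  have hc : Continuous (diffC z ((r + 1 : ℕ) : ℝ) 4) := by
    unfold diffC errC
    simp only [mulC, coshC, gaussC, quadC, expC]
    fun_prop
  have h := norm_sum_deriv_le_fourth (w := diffC z ((r + 1 : ℕ) : ℝ))
    ((isChain_errC z).mul (isChain_expC _)) hc
    (by simp [diffC, errC, mulC, coshC, gaussC, quadC, one_add_one_eq_two])
    (by simp [diffC, errC, mulC, coshC, gaussC, quadC, one_add_one_eq_two])
    (by
      simp [diffC, errC, mulC, coshC, gaussC, quadC, one_add_one_eq_two]
      field_simp
      ring_nf
      simp)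
    t0 t1 t2 (hGi.add hI) (fun x hx => norm_diffC_four_le hz hz2 hz1 hm hx) (hasSum_diffC hz r)
  rw [← neg_add', norm_neg] at h
  refine h.trans_eq ?_
  simp only [Pi.add_apply]
  rw [integral_add hGi hI, hV]
  rw [show ∫ x in Ioi (0 : ℝ), errConst * z.re ^ 2 * Real.exp (-(z.re / 4) * x ^ 2) =
    errInt z.re from rfl]
  ring

/-- On `|y| ≤ β` the generating function of `a_{m,0}` at `e^{-(β+iy)}` is close to `P(m, β)`. -/
lemma kernel_estimate : ∃ C : ℝ, 0 < C ∧ ∀ (β y : ℝ) (m : ℕ), 0 < β → β ≤ 1 / 2 → |y| ≤ β →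
    1 ≤ m → ‖A 0 m (Complex.exp (-(β + y * Complex.I))) - P m β‖ ≤ C * (β * √β + |y|) := by
  refine ⟨2161 * (errConst * √Real.pi) + 3248, ?_, fun β y m hβ hβ1 hy hm => ?_⟩
  · have := errConst_pos
    positivity
  obtain ⟨r, rfl⟩ := Nat.exists_eq_add_of_le' hm
  have hre : ((β : ℂ) + y * Complex.I).re = β := by simp
  have hn : ‖(β : ℂ) + y * Complex.I‖ ≤ 2 * β := by
    refine (norm_add_le _ _).trans ?_
    rw [norm_mul, Complex.norm_I, Complex.norm_real, Complex.norm_real, Real.norm_eq_abs,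
      Real.norm_eq_abs, abs_of_pos hβ]
    linarith
  have h1 := norm_A_add_mainSum_le (z := β + y * Complex.I) (by rwa [hre]) (by rwa [hre])
    (by linarith) r
  have h2 := norm_mainSum_sub_le (m := ((r + 1 : ℕ) : ℝ)) hβ hy (by positivity)
  rw [mainSum_ofReal hβ (by positivity)] at h2
  rw [hre, errInt_eq hβ] at h1
  have e : A 0 ((r + 1 : ℕ) : ℤ) (Complex.exp (-(β + y * Complex.I))) - P ((r + 1 : ℕ) : ℝ) β =
      (A 0 ((r + 1 : ℕ) : ℤ) (Complex.exp (-(β + y * Complex.I))) +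
        mainSum (β + y * Complex.I) ((r + 1 : ℕ) : ℝ)) -
      (mainSum (β + y * Complex.I) ((r + 1 : ℕ) : ℝ) - -((P ((r + 1 : ℕ) : ℝ) β : ℝ) : ℂ)) := by
    ring
  rw [e]
  have hs : 0 ≤ β * √β := by positivity
  have hp : 0 ≤ errConst * √Real.pi := by
    have := errConst_pos
    positivity
  calc _ ≤ 2161 * (errConst * √Real.pi * (β * √β)) + 3248 * |y| :=
        (norm_sub_le _ _).trans (add_le_add h1 h2)
    _ ≤ _ := by nlinarith [mul_nonneg hp (abs_nonneg y), mul_nonneg hp hs]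

/-! ### A crude bound for A on the whole circle -/

lemma half_le_one_sub_exp_neg {β : ℝ} (hβ : 0 ≤ β) (hβ1 : β ≤ 1) : β / 2 ≤ 1 - Real.exp (-β) := by
  have h1 := Real.add_one_le_exp β
  have h2 : Real.exp (-β) * Real.exp β = 1 := by rw [← Real.exp_add, neg_add_cancel, Real.exp_zero]
  have h3 := Real.exp_pos (-β)
  nlinarith

lemma norm_H_le {q : ℂ} (hq0 : q ≠ 0) (hq : ‖q‖ < 1) (r : ℕ) :
    ‖H q r‖ ≤ r * (1 - ‖q‖)⁻¹ + 2 * (‖q‖ / (1 - ‖q‖) ^ 2) := by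
  have h := hasSum_H hq0 hq r
  have hn : ‖‖q‖‖ < 1 := by simpa using hq
  have hs := ((hasSum_geometric_of_norm_lt_one hn).mul_left (r : ℝ)).add
    ((hasSum_coe_mul_geometric_of_norm_lt_one hn).mul_left 2)
  rw [← h.tsum_eq]
  refine tsum_of_norm_bounded hs fun j => ?_
  have e : ‖(r : ℂ) + 2 * j‖ = (r : ℝ) + 2 * j := by
    rw [← Nat.cast_ofNat, ← Nat.cast_mul, ← Nat.cast_add, Complex.norm_natCast]
    push_cast
    ring
  rw [norm_mul, norm_pow, e]
  have : ‖q‖ ^ (j * j + j * r) ≤ ‖q‖ ^ j :=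
    pow_le_pow_of_le_one (norm_nonneg _) hq.le ((Nat.le_mul_self j).trans (Nat.le_add_right _ _))
  calc _ ≤ ((r : ℝ) + 2 * j) * ‖q‖ ^ j := by gcongr
    _ = _ := by ring

/-- Used only for |y| ≥ β, where the Euler product is exponentially small and any polynomial bound
is enough. It follows from the partial theta series after q^{j²+jr} is replaced by q^j in absolute
value. -/
lemma norm_A_le {β y : ℝ} {m : ℕ} (hβ : 0 < β) (hβ1 : β ≤ 1) (hm : 1 ≤ m) :
    ‖A 0 m (Complex.exp (-(β + y * Complex.I)))‖ ≤ 48 * m / β ^ 2 := by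
  obtain ⟨r, rfl⟩ := Nat.exists_eq_add_of_le' hm
  have hn : ‖Complex.exp (-((β : ℂ) + y * Complex.I))‖ = Real.exp (-β) := by
    rw [Complex.norm_exp]
    simp
  have hd := half_le_one_sub_exp_neg hβ.le hβ1
  have hρ0 := Real.exp_pos (-β)
  have hq : ‖Complex.exp (-((β : ℂ) + y * Complex.I))‖ < 1 := by
    rw [hn]
    linarith
  have hA := A_eq_second_diff hq (r : ℤ)
  have h0 := norm_H_le (Complex.exp_ne_zero _) hq r
  have h1 := norm_H_le (Complex.exp_ne_zero _) hq (r + 1)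
  have h2 := norm_H_le (Complex.exp_ne_zero _) hq (r + 2)
  generalize Complex.exp (-((β : ℂ) + y * Complex.I)) = q at *
  rw [hn] at h0 h1 h2
  push_cast at h0 h1 h2 ⊢
  rw [hA]
  generalize Real.exp (-β) = ρ at *
  have hd0 : 0 < 1 - ρ := by linarith
  have h3 : ‖H q (r + 2) - 2 * H q (r + 1) + H q r‖ ≤ ‖H q (r + 2)‖ + 2 * ‖H q (r + 1)‖ + ‖H q r‖ := by
    refine (norm_add_le _ _).trans (add_le_add_left ((norm_sub_le _ _).trans ?_) _)
    rw [norm_mul, Complex.norm_ofNat]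
  have i1 : (1 - ρ)⁻¹ ≤ 1 / (1 - ρ) ^ 2 := by
    rw [← one_div]
    exact one_div_le_one_div_of_le (by positivity) (by nlinarith)
  have i2 : ρ / (1 - ρ) ^ 2 ≤ 1 / (1 - ρ) ^ 2 := by
    gcongr
    linarith
  have i3 : 1 / (1 - ρ) ^ 2 ≤ 1 / (β / 2) ^ 2 := by gcongr
  have i4 : 1 / (β / 2) ^ 2 = 4 / β ^ 2 := by field_simp; norm_num
  rw [i4] at i3
  have i5 : 0 ≤ (1 - ρ)⁻¹ := by positivity
  have hr : (0 : ℝ) ≤ r := by positivity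
  have j1 : (1 - ρ)⁻¹ ≤ 4 / β ^ 2 := i1.trans i3
  have j2 : ρ / (1 - ρ) ^ 2 ≤ 4 / β ^ 2 := i2.trans i3
  have e : 48 * ((r : ℝ) + 1) / β ^ 2 = 12 * (r + 1) * (4 / β ^ 2) := by ring
  rw [e]
  calc _ ≤ _ := h3
    _ ≤ ((r + 2) * (1 - ρ)⁻¹ + 2 * (ρ / (1 - ρ) ^ 2)) + 2 * ((r + 1) * (1 - ρ)⁻¹ +
        2 * (ρ / (1 - ρ) ^ 2)) + (r * (1 - ρ)⁻¹ + 2 * (ρ / (1 - ρ) ^ 2)) := by gcongr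
    _ = (4 * r + 4) * (1 - ρ)⁻¹ + 8 * (ρ / (1 - ρ) ^ 2) := by ring
    _ ≤ (4 * r + 4) * (4 / β ^ 2) + 8 * (4 / β ^ 2) := by gcongr
    _ ≤ _ := by
      have : 0 ≤ 4 / β ^ 2 := by positivity
      nlinarith

/-! ### Decay of the Euler product ratio away from the real axis -/

/-- It follows from |1-w|² = (1-|w|)² + 2(|w| - Re w). The gain is exponential in |w| - Re w, so
that over w = q^j it adds up to a geometric sum. -/
lemma norm_one_sub_ge {w : ℂ} (hw : ‖w‖ ≤ 1) :
    (1 - ‖w‖) * Real.exp ((‖w‖ - w.re) / 4) ≤ ‖1 - w‖ := by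
  have hx := Complex.abs_re_le_norm w
  have hx' := abs_le.1 hx
  have e : ‖1 - w‖ ^ 2 = (1 - ‖w‖) ^ 2 + 2 * (‖w‖ - w.re) := by
    have h1 := Complex.sq_norm (1 - w)
    have h2 := Complex.sq_norm w
    rw [Complex.normSq_apply] at h1 h2
    simp only [Complex.sub_re, Complex.one_re, Complex.sub_im, Complex.one_im] at h1
    nlinarith
  refine le_of_sq_le_sq ?_ (norm_nonneg _)
  rw [e, mul_pow, ← Real.exp_nat_mul]
  have hs := norm_nonneg w
  generalize ‖w‖ = s at *
  have hd0 : 0 ≤ (s - w.re) / 2 := by linarith [hx'.2]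
  have hd1 : (s - w.re) / 2 ≤ 1 := by linarith [hx'.1]
  have h := (abs_le.1 (Real.abs_exp_sub_one_sub_id_le (x := (s - w.re) / 2)
    (by rwa [abs_of_nonneg hd0]))).2
  have e2 : ((2 : ℕ) : ℝ) * ((s - w.re) / 4) = (s - w.re) / 2 := by push_cast; ring
  rw [e2]
  -- From |e^d - 1 - d| ≤ d² with d = (|w| - Re w)/2; the 1/4 in the exponent keeps d in [0, 1]
  -- after squaring.
  have h3 : Real.exp ((s - w.re) / 2) ≤ 1 + (s - w.re) := by nlinarith
  have h4 : (1 - s) ^ 2 ≤ 1 := by nlinarith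
  have h5 : 0 ≤ (1 - s) ^ 2 := sq_nonneg _
  nlinarith

lemma hasSum_pow_succ {q : ℂ} (hq : ‖q‖ < 1) :
    HasSum (fun n : ℕ => q ^ (n + 1)) ((1 - q)⁻¹ - 1) := by
  have h0 : 1 - q ≠ 0 := fun h => by
    rw [← sub_eq_zero.1 h] at hq
    simp at hq
  have h := (hasSum_geometric_of_norm_lt_one hq).mul_left q
  have e : q * (1 - q)⁻¹ = (1 - q)⁻¹ - 1 := by
    field_simp
    ring
  rw [e] at h
  exact hasSum_of_eq (fun n => by ring) h

lemma tendsto_sum_Icc {q : ℂ} (hq : ‖q‖ < 1) :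
    Tendsto (fun N => ∑ j ∈ Finset.Icc 1 N, q ^ j) atTop (𝓝 ((1 - q)⁻¹ - 1)) := by
  refine (hasSum_pow_succ hq).tendsto_sum_nat.congr fun N => ?_
  induction N with
  | zero => simp
  | succ N ih => rw [Finset.sum_range_succ, ih, Finset.sum_Icc_succ_top (by omega)]

lemma norm_eul_ge {q : ℂ} (hq : ‖q‖ < 1) :
    ‖eul 1 (‖q‖ : ℂ)‖ * Real.exp (((1 - ‖q‖)⁻¹ - ((1 - q)⁻¹).re) / 4) ≤ ‖eul 1 q‖ := by
  have hn : ‖(‖q‖ : ℂ)‖ < 1 := by simpa using hq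
  have t1 := (tendsto_prod_eul 1 hq).norm
  have t2 := (tendsto_prod_eul 1 hn).norm
  have s1 := (Complex.continuous_re.tendsto _).comp (tendsto_sum_Icc hq)
  have s2 := (Complex.continuous_re.tendsto _).comp (tendsto_sum_Icc hn)
  have s3 := (Real.continuous_exp.tendsto _).comp ((s2.sub s1).div_const 4)
  have e : (((1 - (‖q‖ : ℂ))⁻¹ - 1).re - ((1 - q)⁻¹ - 1).re) / 4 =
      ((1 - ‖q‖)⁻¹ - ((1 - q)⁻¹).re) / 4 := by
    rw [Complex.sub_re, Complex.sub_re, ← Complex.ofReal_one, ← Complex.ofReal_sub,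
      ← Complex.ofReal_inv, Complex.ofReal_re]
    ring
  rw [e] at s3
  refine le_of_tendsto_of_tendsto' (t2.mul s3) t1 fun N => ?_
  simp only [Function.comp_apply, one_mul, norm_prod, Complex.re_sum, ← Finset.sum_sub_distrib,
    Finset.sum_div, Real.exp_sum, ← Finset.prod_mul_distrib]
  refine Finset.prod_le_prod (fun j _ => by positivity) fun j _ => ?_
  have h := norm_one_sub_ge (w := q ^ j) (by
    rw [norm_pow]
    exact pow_le_one₀ (norm_nonneg _) hq.le)
  have h1 : ‖1 - (‖q‖ : ℂ) ^ j‖ = 1 - ‖q‖ ^ j := by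
    rw [← Complex.ofReal_pow, ← Complex.ofReal_one, ← Complex.ofReal_sub, Complex.norm_real,
      Real.norm_eq_abs, abs_of_nonneg]
    linarith [pow_le_one₀ (n := j) (norm_nonneg q) hq.le]
  rw [h1, ← Complex.ofReal_pow, Complex.ofReal_re]
  rwa [norm_pow] at h

/-- The ratio `∏ (1 - e^{-βn}) / ∏ (1 - e^{-(β+iy)n})`. -/
def eulRatio (β y : ℝ) : ℂ :=
  eul 1 (Complex.exp (-(β : ℂ))) / eul 1 (Complex.exp (-(β + y * Complex.I)))

lemma norm_exp_neg_add (β y : ℝ) :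
    ‖Complex.exp (-((β : ℂ) + y * Complex.I))‖ = Real.exp (-β) := by
  rw [Complex.norm_exp]
  simp

lemma norm_exp_neg_add_lt_one {β : ℝ} (hβ : 0 < β) (y : ℝ) :
    ‖Complex.exp (-((β : ℂ) + y * Complex.I))‖ < 1 := by
  rw [norm_exp_neg_add, Real.exp_lt_one_iff]
  linarith

lemma re_inv_one_sub_exp {β : ℝ} (hβ : 0 < β) (y : ℝ) :
    (1 - Real.exp (-β))⁻¹ - ((1 - Complex.exp (-((β : ℂ) + y * Complex.I)))⁻¹).re =
      Real.exp (-β) * (1 + Real.exp (-β)) * (1 - Real.cos y) /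
        ((1 - Real.exp (-β)) * ((1 - Real.exp (-β)) ^ 2 +
          2 * Real.exp (-β) * (1 - Real.cos y))) := by
  have hre : (Complex.exp (-((β : ℂ) + y * Complex.I))).re = Real.exp (-β) * Real.cos y := by
    rw [Complex.exp_re]
    simp
  have him : (Complex.exp (-((β : ℂ) + y * Complex.I))).im = -(Real.exp (-β) * Real.sin y) := by
    rw [Complex.exp_im]
    simp
  have hN : Complex.normSq (1 - Complex.exp (-((β : ℂ) + y * Complex.I))) =
      (1 - Real.exp (-β)) ^ 2 + 2 * Real.exp (-β) * (1 - Real.cos y) := by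
    rw [Complex.normSq_apply]
    simp only [Complex.sub_re, Complex.sub_im, hre, him, Complex.one_re, Complex.one_im]
    linear_combination Real.exp (-β) ^ 2 * Real.sin_sq_add_cos_sq y
  rw [Complex.inv_re, hN, Complex.sub_re, Complex.one_re, hre]
  have h1 : Real.exp (-β) < 1 := Real.exp_lt_one_iff.2 (by linarith)
  have h0 := Real.exp_pos (-β)
  have hc := Real.cos_le_one y
  generalize Real.exp (-β) = ρ at *
  generalize Real.cos y = c at *
  have hd : 1 - ρ ≠ 0 := by linarith
  have hN0 : (1 - ρ) ^ 2 + 2 * ρ * (1 - c) ≠ 0 := by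
    have : 0 < (1 - ρ) ^ 2 := by
      have : 0 < 1 - ρ := by linarith
      positivity
    have : 0 ≤ 2 * ρ * (1 - c) := mul_nonneg (by linarith) (by linarith)
    linarith
  rw [inv_eq_one_div, div_sub_div _ _ hd hN0, div_eq_div_iff (mul_ne_zero hd hN0)
    (mul_ne_zero hd hN0)]
  ring

/-- Put X = 1 - cos y, so y²/5 ≤ X ≤ y²/2 by Jordan's inequality. For |y| ≤ β the second denominator
factor is at most 2β², beyond β it is at most 7X, and e^{-β} ≥ 1/2 keeps the numerator above 3X/4.
-/
lemma re_inv_one_sub_exp_ge {β y : ℝ} (hβ : 0 < β) (hβ1 : β ≤ 1 / 2) (hy : |y| ≤ Real.pi) :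
    (|y| ≤ β → y ^ 2 / (14 * β ^ 3) ≤
      (1 - Real.exp (-β))⁻¹ - ((1 - Complex.exp (-((β : ℂ) + y * Complex.I)))⁻¹).re) ∧
    (β ≤ |y| → 1 / (14 * β) ≤
      (1 - Real.exp (-β))⁻¹ - ((1 - Complex.exp (-((β : ℂ) + y * Complex.I)))⁻¹).re) := by
  rw [re_inv_one_sub_exp hβ]
  have h1 : Real.exp (-β) < 1 := Real.exp_lt_one_iff.2 (by linarith)
  have h2 := Real.add_one_le_exp (-β)
  have hX1 := Real.cos_le_one_sub_mul_cos_sq hy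
  have hX2 := Real.one_sub_sq_div_two_le_cos (x := y)
  have hX0 := Real.cos_le_one y
  have hpi : 1 / 5 ≤ 2 / Real.pi ^ 2 := by
    rw [div_le_div_iff₀ (by norm_num) (by positivity)]
    nlinarith [Real.pi_lt_d2, Real.pi_pos]
  have hX : y ^ 2 / 5 ≤ 1 - Real.cos y := by
    have := mul_le_mul_of_nonneg_right hpi (sq_nonneg y)
    linarith
  have hX3 : 1 - Real.cos y ≤ y ^ 2 / 2 := by linarith
  generalize Real.exp (-β) = ρ at *
  generalize 1 - Real.cos y = X at *
  have hd0 : 0 < 1 - ρ := by linarith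
  have hd : 1 - ρ ≤ β := by linarith
  have hρ : 1 / 2 ≤ ρ := by linarith
  have hXn : 0 ≤ X := le_trans (by positivity) hX
  have hd2 : (1 - ρ) ^ 2 ≤ β ^ 2 := by gcongr
  have hρX : 2 * ρ * X ≤ 2 * X := by nlinarith
  have hN : 0 < (1 - ρ) ^ 2 + 2 * ρ * X := by positivity
  have hnum : 3 / 4 * X ≤ ρ * (1 + ρ) * X := by
    gcongr
    nlinarith
  constructor
  · intro hyβ
    have hyb : y ^ 2 ≤ β ^ 2 := by rw [← sq_abs y]; gcongr
    have hNb : (1 - ρ) ^ 2 + 2 * ρ * X ≤ 2 * β ^ 2 := by linarith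
    calc y ^ 2 / (14 * β ^ 3) ≤ 3 / 4 * (y ^ 2 / 5) / (β * (2 * β ^ 2)) := by
          rw [div_le_div_iff₀ (by positivity) (by positivity)]
          have : 0 ≤ y ^ 2 * β ^ 3 := by positivity
          nlinarith
      _ ≤ ρ * (1 + ρ) * X / ((1 - ρ) * ((1 - ρ) ^ 2 + 2 * ρ * X)) := by
          exact div_le_div₀ (by positivity) (by linarith) (mul_pos hd0 hN)
            (mul_le_mul hd hNb hN.le hβ.le)
  · intro hyβ
    have hyb : β ^ 2 ≤ y ^ 2 := by rw [← sq_abs y]; gcongr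
    have hXp : 0 < X := lt_of_lt_of_le (div_pos ((pow_pos hβ 2).trans_le hyb) (by norm_num)) hX
    have hNb : (1 - ρ) ^ 2 + 2 * ρ * X ≤ 7 * X := by linarith
    calc 1 / (14 * β) ≤ 3 / 4 * X / (β * (7 * X)) := by
          rw [div_le_div_iff₀ (by positivity) (by positivity)]
          have : 0 ≤ X * β := by positivity
          nlinarith
      _ ≤ ρ * (1 + ρ) * X / ((1 - ρ) * ((1 - ρ) ^ 2 + 2 * ρ * X)) :=
          div_le_div₀ (by positivity) hnum (mul_pos hd0 hN) (mul_le_mul hd hNb hN.le hβ.le)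

lemma norm_eulRatio_le_exp {β y : ℝ} (hβ : 0 < β) :
    ‖eulRatio β y‖ ≤ Real.exp (-(((1 - Real.exp (-β))⁻¹ -
      ((1 - Complex.exp (-((β : ℂ) + y * Complex.I)))⁻¹).re) / 4)) := by
  have hq := norm_exp_neg_add_lt_one hβ y
  have h := norm_eul_ge hq
  have h0 : 0 < ‖eul 1 (Complex.exp (-((β : ℂ) + y * Complex.I)))‖ :=
    norm_pos_iff.2 (eul_ne_zero hq (by simpa using hq))
  rw [norm_exp_neg_add] at h
  rw [eulRatio, norm_div, div_le_iff₀ h0, Real.exp_neg, ← div_eq_inv_mul, le_div_iff₀ (Real.exp_pos _)]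
  simpa using h

lemma norm_eulRatio_le {β y : ℝ} (hβ : 0 < β) (hβ1 : β ≤ 1 / 2) (hy : |y| ≤ Real.pi) :
    (|y| ≤ β → ‖eulRatio β y‖ ≤ Real.exp (-(y ^ 2 / (56 * β ^ 3)))) ∧
    (β ≤ |y| → ‖eulRatio β y‖ ≤ Real.exp (-(1 / (56 * β)))) := by
  have h := norm_eulRatio_le_exp (y := y) hβ
  have hE := re_inv_one_sub_exp_ge hβ hβ1 hy
  refine ⟨fun hyβ => h.trans (Real.exp_le_exp.2 (neg_le_neg ?_)),
    fun hyβ => h.trans (Real.exp_le_exp.2 (neg_le_neg ?_))⟩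
  · refine le_trans (le_of_eq ?_) (div_le_div_of_nonneg_right (hE.1 hyβ) (by norm_num : (0:ℝ) ≤ 4))
    rw [div_div]
    ring
  · refine le_trans (le_of_eq ?_) (div_le_div_of_nonneg_right (hE.2 hyβ) (by norm_num : (0:ℝ) ≤ 4))
    rw [div_div]
    ring

lemma norm_eulRatio_le_one {β y : ℝ} (hβ : 0 < β) (hβ1 : β ≤ 1 / 2) (hy : |y| ≤ Real.pi) :
    ‖eulRatio β y‖ ≤ 1 := by
  obtain ⟨h1, h2⟩ := norm_eulRatio_le hβ hβ1 hy
  rcases le_total |y| β with h | h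
  · exact (h1 h).trans (Real.exp_le_one_iff.2 (neg_nonpos.2 (by positivity)))
  · exact (h2 h).trans (Real.exp_le_one_iff.2 (neg_nonpos.2 (by positivity)))

lemma measurable_eulRatio {β : ℝ} (hβ : 0 < β) : Measurable (eulRatio β) := by
  have h : Measurable fun y : ℝ => eul 1 (Complex.exp (-((β : ℂ) + y * Complex.I))) := by
    refine measurable_of_tendsto_metrizable (f := fun (N : ℕ) (y : ℝ) =>
      ∏ j ∈ Finset.Icc 1 N, (1 - 1 * Complex.exp (-((β : ℂ) + y * Complex.I)) ^ j))
      (fun N => ?_) ?_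
    · exact Continuous.measurable (by fun_prop)
    · exact tendsto_pi_nhds.2 fun y => tendsto_prod_eul 1 (norm_exp_neg_add_lt_one hβ y)
  exact measurable_const.div h

/-! ### The η-transformation and the Gaussian limit -/

lemma tendsto_eul_zero : Tendsto (eul 1) (𝓝 0) (𝓝 1) := by
  have := tendsto_tprod_one_add_of_dominated_convergence (𝓕 := 𝓝 0) (g := 0)
    (f := fun (q : ℂ) (n : ℕ) ↦ -q ^ (n + 1)) (bound := fun n ↦ (1 / 2 : ℝ) ^ (n + 1))
  simp only [Pi.zero_apply, norm_neg, norm_pow, add_zero, tprod_one] at this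
  have h := this
    (by simpa only [pow_succ'] using (summable_geometric_of_abs_lt_one (by norm_num)).mul_left _)
    (fun k ↦ by simpa using ((continuous_pow (M := ℂ) (k + 1)).tendsto 0).neg) (by
      filter_upwards [Metric.ball_mem_nhds (0 : ℂ) (by norm_num : (0 : ℝ) < 1 / 2)] with q hq k
      exact pow_le_pow_left₀ (norm_nonneg _) (mem_ball_zero_iff.mp hq).le _)
  refine h.congr fun q => ?_
  simp only [eul, one_mul, sub_eq_add_neg]

/-- The transformation `τ ↦ -1/τ` for the Euler product, with `τ = iz/2π`. -/
lemma eul_transform {z : ℂ} (hz : 0 < z.re) :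
    eul 1 (Complex.exp (-z)) * Complex.sqrt (Complex.I * (z / (2 * Real.pi))) =
      Complex.sqrt Complex.I * Complex.exp (z / 24 - Real.pi ^ 2 / (6 * z)) *
        eul 1 (Complex.exp (-(4 * Real.pi ^ 2 / z))) := by
  have hz0 : z ≠ 0 := fun h => by simp [h] at hz
  have hpi : (Real.pi : ℂ) ≠ 0 := Complex.ofReal_ne_zero.2 Real.pi_ne_zero
  have hτ : 0 < (Complex.I * (z / (2 * Real.pi))).im := by
    have : z / (2 * Real.pi) = z * ((1 / (2 * Real.pi) : ℝ) : ℂ) := by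
      push_cast
      ring
    rw [Complex.I_mul_im, this, Complex.re_mul_ofReal]
    have := Real.pi_pos
    positivity
  have h := ModularForm.eta_comp_eq_csqrt_I_inv (x := Complex.I * (z / (2 * Real.pi))) hτ
  simp only [Function.comp_apply, Pi.smul_apply, Pi.mul_apply, smul_eq_mul, eta_eq] at h
  have n1 : nome (Complex.I * (z / (2 * Real.pi))) = Complex.exp (-z) := by
    rw [nome]
    congr 1
    field_simp
    rw [Complex.I_sq]
  have n2 : nome (-1 / (Complex.I * (z / (2 * Real.pi)))) = Complex.exp (-(4 * Real.pi ^ 2 / z)) := by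
    rw [nome]
    congr 1
    field_simp
    norm_num
  have n3 : Function.Periodic.qParam 24 (Complex.I * (z / (2 * Real.pi))) =
      Complex.exp (-(z / 24)) := by
    rw [Function.Periodic.qParam]
    congr 1
    push_cast
    field_simp
    rw [Complex.I_sq]
  have n4 : Function.Periodic.qParam 24 (-1 / (Complex.I * (z / (2 * Real.pi)))) =
      Complex.exp (-(Real.pi ^ 2 / (6 * z))) := by
    rw [Function.Periodic.qParam]
    congr 1
    push_cast
    field_simp
    norm_num
  rw [n1, n2, n3, n4] at h
  have hI : Complex.sqrt Complex.I ≠ 0 := by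
    simp [Complex.sqrt]
  have he : Complex.exp (z / 24 - Real.pi ^ 2 / (6 * z)) =
      (Complex.exp (-(z / 24)))⁻¹ * Complex.exp (-(Real.pi ^ 2 / (6 * z))) := by
    rw [← Complex.exp_neg, neg_neg, ← Complex.exp_add]
    congr 1
  have he0 := Complex.exp_ne_zero (-(z / 24))
  rw [he, mul_assoc, mul_assoc, h]
  generalize Complex.exp (-(z / 24)) = e at *
  generalize Complex.sqrt (Complex.I * (z / (2 * Real.pi))) = s at *
  field_simp

/-- Quotient of two instances of `eul_transform`. The transformed Euler products tend to 1 on the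
scale of interest, so the exponential factor carries all the asymptotics. -/
lemma eulRatio_eq {β y : ℝ} (hβ : 0 < β) : eulRatio β y =
    Complex.sqrt (Complex.I * (1 + y / β * Complex.I)) / Complex.sqrt Complex.I *
      Complex.exp (-(y * Complex.I / 24) -
        Real.pi ^ 2 / 6 * (1 / β - 1 / (β + y * Complex.I))) *
      (eul 1 (Complex.exp (-(4 * Real.pi ^ 2 / β))) /
        eul 1 (Complex.exp (-(4 * Real.pi ^ 2 / (β + y * Complex.I))))) := by
  have hβ0 : (β : ℂ) ≠ 0 := Complex.ofReal_ne_zero.2 hβ.ne'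
  have hz : 0 < ((β : ℂ) + y * Complex.I).re := by simpa using hβ
  have h1 := eul_transform hz
  have h2 := eul_transform (z := (β : ℂ)) (by simpa using hβ)
  have hq : ‖Complex.exp (-(4 * (Real.pi : ℂ) ^ 2 / (β + y * Complex.I)))‖ < 1 := by
    rw [Complex.norm_exp, Real.exp_lt_one_iff, Complex.neg_re, neg_lt_zero]
    rw [show 4 * (Real.pi : ℂ) ^ 2 / (β + y * Complex.I) =
      ((4 * Real.pi ^ 2 : ℝ) : ℂ) * (β + y * Complex.I)⁻¹ by push_cast; rfl,
      Complex.re_ofReal_mul, Complex.inv_re]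
    have h3 : 0 < Complex.normSq ((β : ℂ) + y * Complex.I) := by
      rw [Complex.normSq_pos]
      intro h
      rw [h] at hz
      simp at hz
    have := Real.pi_pos
    positivity
  have hne := eul_ne_zero hq (c := 1) (by simpa using hq)
  have hq' := norm_exp_neg_add_lt_one hβ y
  have hne' := eul_ne_zero hq' (c := 1) (by simpa using hq')
  have hI : Complex.sqrt Complex.I ≠ 0 := by simp [Complex.sqrt]
  have hs : ∀ w : ℂ, w ≠ 0 → Complex.sqrt (Complex.I * ((β * w) / (2 * Real.pi))) =
      Complex.sqrt ((β / (2 * Real.pi) : ℝ) : ℂ) * Complex.sqrt (Complex.I * w) := fun w hw => by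
    have e : Complex.I * ((β * w) / (2 * Real.pi)) =
        ((β / (2 * Real.pi) : ℝ) : ℂ) * (Complex.I * w) := by
      push_cast
      ring
    have hp : 0 < β / (2 * Real.pi) := div_pos hβ (by positivity)
    have hp' : ((β / (2 * Real.pi) : ℝ) : ℂ) ≠ 0 := Complex.ofReal_ne_zero.2 hp.ne'
    have hIw : Complex.I * w ≠ 0 := mul_ne_zero Complex.I_ne_zero hw
    rw [e, Complex.sqrt, Complex.sqrt, Complex.sqrt,
      Complex.cpow_def_of_ne_zero (mul_ne_zero hp' hIw), Complex.cpow_def_of_ne_zero hp',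
      Complex.cpow_def_of_ne_zero hIw, ← Complex.exp_add, Complex.log_ofReal_mul hp hIw,
      Complex.ofReal_log hp.le, add_mul]
  have hs0 : Complex.sqrt ((β / (2 * Real.pi) : ℝ) : ℂ) ≠ 0 := by
    have hp : β / (2 * Real.pi) ≠ 0 := div_ne_zero hβ.ne' (by positivity)
    rw [Complex.sqrt, Ne, Complex.cpow_eq_zero_iff, Complex.ofReal_eq_zero]
    tauto
  have hw : (β : ℂ) + y * Complex.I = β * (1 + y / β * Complex.I) := by
    field_simp
  have hw0 : (1 : ℂ) + y / β * Complex.I ≠ 0 := fun h => by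
    rw [hw, h] at hz
    simp at hz
  have hs1 := hs 1 one_ne_zero
  have hs2 := hs _ hw0
  rw [mul_one, mul_one] at hs1
  rw [← hw] at hs2
  rw [hs1] at h2
  rw [hs2] at h1
  have hE : Complex.exp (β / 24 - Real.pi ^ 2 / (6 * β)) =
      Complex.exp ((β + y * Complex.I) / 24 - Real.pi ^ 2 / (6 * (β + y * Complex.I))) *
      Complex.exp (-(y * Complex.I / 24) -
        Real.pi ^ 2 / 6 * (1 / β - 1 / (β + y * Complex.I))) := by
    rw [← Complex.exp_add]
    congr 1
    generalize hZ : (β : ℂ) + y * Complex.I = Z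
    rw [show (y : ℂ) * Complex.I = Z - β by rw [← hZ]; ring]
    ring
  rw [hE] at h2
  rw [eulRatio]
  generalize Complex.exp (-(y * Complex.I / 24) -
        Real.pi ^ 2 / 6 * (1 / β - 1 / (β + y * Complex.I))) = E at *
  generalize Complex.exp ((β + y * Complex.I) / 24 - Real.pi ^ 2 / (6 * (β + y * Complex.I))) = Ez
    at *
  generalize eul 1 (Complex.exp (-(4 * (Real.pi : ℂ) ^ 2 / β))) = B' at *
  generalize eul 1 (Complex.exp (-(4 * (Real.pi : ℂ) ^ 2 / (β + y * Complex.I)))) = A' at *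
  generalize eul 1 (Complex.exp (-(β : ℂ))) = b at *
  generalize eul 1 (Complex.exp (-((β : ℂ) + y * Complex.I))) = a' at *
  generalize Complex.sqrt (Complex.I * (1 + y / β * Complex.I)) = sz at *
  generalize Complex.sqrt ((β / (2 * Real.pi) : ℝ) : ℂ) = s0 at *
  generalize Complex.sqrt Complex.I = sI at *
  have key : s0 * (b * sI * A') = s0 * (sz * E * B' * a') := by
    linear_combination A' * h2 - E * B' * h1
  have key2 := mul_left_cancel₀ hs0 key
  field_simp
  linear_combination key2

/-- The limit of the `k`-th power of the ratio of Euler products on the scale `y = β^{3/2} u`. -/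
lemma tendsto_eulRatio (k : ℕ) (u : ℝ) :
    Tendsto (fun β : ℝ => eulRatio β (β * √β * u) ^ k *
      Complex.exp (k * Real.pi ^ 2 / (6 * β ^ 2) * (β * √β * u) * Complex.I)) (𝓝[>] 0)
      (𝓝 (Complex.exp (-(k * Real.pi ^ 2 / 6 * u ^ 2)))) := by
  have hr : Tendsto (fun β : ℝ => √β) (𝓝[>] 0) (𝓝 0) := by
    simpa using (Real.continuous_sqrt.tendsto 0).mono_left nhdsWithin_le_nhds
  have hrc : Tendsto (fun β : ℝ => ((√β : ℝ) : ℂ)) (𝓝[>] 0) (𝓝 0) := by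
    exact (Complex.continuous_ofReal.tendsto' 0 0 (by simp)).comp hr
  have hβc : Tendsto (fun β : ℝ => (β : ℂ)) (𝓝[>] 0) (𝓝 0) := by
    simpa using (Complex.continuous_ofReal.tendsto 0).mono_left nhdsWithin_le_nhds
  have hw : Tendsto (fun β : ℝ => 1 + ((√β : ℝ) : ℂ) * u * Complex.I) (𝓝[>] 0) (𝓝 1) := by
    simpa using ((hrc.mul_const (u : ℂ)).mul_const Complex.I).const_add 1
  have hsI : Complex.sqrt Complex.I ≠ 0 := by simp [Complex.sqrt]
  have f1 : Tendsto (fun β : ℝ => Complex.sqrt (Complex.I * (1 + ((√β : ℝ) : ℂ) * u * Complex.I)) /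
      Complex.sqrt Complex.I) (𝓝[>] 0) (𝓝 1) := by
    have hc : ContinuousAt Complex.sqrt Complex.I :=
      continuousAt_id.cpow continuousAt_const (Or.inr (by simp))
    have := (hc.tendsto.comp (by simpa using hw.const_mul Complex.I)).div_const
      (Complex.sqrt Complex.I)
    rwa [div_self hsI] at this
  have hq : ∀ v : ℝ, Tendsto (fun β : ℝ => eul 1 (Complex.exp (-(4 * Real.pi ^ 2 /
      (β * (1 + ((√β : ℝ) : ℂ) * v * Complex.I)))))) (𝓝[>] 0) (𝓝 1) := fun v => by
    refine tendsto_eul_zero.comp (tendsto_zero_iff_norm_tendsto_zero.2 ?_)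
    have e : ∀ β : ℝ, ‖Complex.exp (-(4 * Real.pi ^ 2 /
      (β * (1 + ((√β : ℝ) : ℂ) * v * Complex.I))))‖ =
        Real.exp (-(β⁻¹ * (4 * Real.pi ^ 2 * ((1 + ((√β : ℝ) : ℂ) * v * Complex.I)⁻¹).re))) := by
      intro β
      rw [Complex.norm_exp, Complex.neg_re]
      congr 2
      rw [show 4 * (Real.pi : ℂ) ^ 2 / (β * (1 + ((√β : ℝ) : ℂ) * v * Complex.I)) =
        ((β⁻¹ : ℝ) : ℂ) * (((4 * Real.pi ^ 2 : ℝ) : ℂ) *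
          (1 + ((√β : ℝ) : ℂ) * v * Complex.I)⁻¹) by push_cast; rw [div_eq_mul_inv, mul_inv]; ring,
        Complex.re_ofReal_mul, Complex.re_ofReal_mul]
    simp only [e]
    have h1 : Tendsto (fun β : ℝ => 1 + ((√β : ℝ) : ℂ) * v * Complex.I) (𝓝[>] 0) (𝓝 1) := by
      simpa using ((hrc.mul_const (v : ℂ)).mul_const Complex.I).const_add 1
    have h2 : Tendsto (fun β : ℝ => 4 * Real.pi ^ 2 *
        ((1 + ((√β : ℝ) : ℂ) * v * Complex.I)⁻¹).re) (𝓝[>] 0) (𝓝 (4 * Real.pi ^ 2)) := by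
      simpa using ((Complex.continuous_re.tendsto _).comp (h1.inv₀ one_ne_zero)).const_mul
        (4 * Real.pi ^ 2)
    have h3 : Tendsto (fun β : ℝ => β⁻¹ * (4 * Real.pi ^ 2 *
        ((1 + ((√β : ℝ) : ℂ) * v * Complex.I)⁻¹).re)) (𝓝[>] 0) atTop :=
      tendsto_inv_nhdsGT_zero.atTop_mul_pos (by positivity) h2
    exact Real.tendsto_exp_neg_atTop_nhds_zero.comp h3
  have f3 := (hq 0).div (hq u) one_ne_zero
  -- The phase cancels the linear term of k·(π²/6)(1/z - 1/β), z = β + iy; for y = β^{3/2}u what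
  -- remains is exactly -(kπ²/6)u²/(1 + i√β u).
  have f4 : Tendsto (fun β : ℝ => Complex.exp (k * -(((√β : ℝ) : ℂ) * β * u * Complex.I / 24) -
      k * Real.pi ^ 2 / 6 * u ^ 2 / (1 + ((√β : ℝ) : ℂ) * u * Complex.I))) (𝓝[>] 0)
      (𝓝 (Complex.exp (-(k * Real.pi ^ 2 / 6 * u ^ 2)))) := by
    refine (Complex.continuous_exp.tendsto _).comp ?_
    have := ((((((hrc.mul hβc).mul_const (u : ℂ)).mul_const Complex.I).div_const 24).neg).const_mul
      (k : ℂ)).sub ((tendsto_const_nhds (x := (k : ℂ) * Real.pi ^ 2 / 6 * u ^ 2)).div hw one_ne_zero)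
    simpa using this
  have F := (((f1.mul f3).pow k).mul f4)
  rw [div_one, one_mul, one_pow, one_mul] at F
  refine F.congr' ?_
  filter_upwards [self_mem_nhdsWithin] with β hβ
  simp only [Pi.div_apply]
  have hβ' : (0 : ℝ) < β := hβ
  have hβ0 : (β : ℂ) ≠ 0 := Complex.ofReal_ne_zero.2 hβ'.ne'
  have hy : ((β * √β * u : ℝ) : ℂ) = β * ((√β : ℝ) : ℂ) * u := by push_cast; ring
  have hsq : ((√β : ℝ) : ℂ) ^ 2 = β := by
    rw [← Complex.ofReal_pow, Real.sq_sqrt hβ'.le]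
  have hd : (1 : ℂ) + ((√β : ℝ) : ℂ) * u * Complex.I ≠ 0 := fun h => by
    have := congrArg Complex.re h
    simp at this
  have e1 : (β : ℂ) + β * ((√β : ℝ) : ℂ) * u * Complex.I =
      β * (1 + ((√β : ℝ) : ℂ) * u * Complex.I) := by ring
  have e2 : β * ((√β : ℝ) : ℂ) * u / β = ((√β : ℝ) : ℂ) * u := by field_simp
  have e3 : (β : ℂ) * (1 + ((√β : ℝ) : ℂ) * (0 : ℝ) * Complex.I) = β := by simp
  rw [eulRatio_eq hβ', hy, e1, e2, e3]
  have e4 : Complex.exp (k * -(((√β : ℝ) : ℂ) * β * u * Complex.I / 24) -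
      k * Real.pi ^ 2 / 6 * u ^ 2 / (1 + ((√β : ℝ) : ℂ) * u * Complex.I)) =
      Complex.exp (-(β * ((√β : ℝ) : ℂ) * u * Complex.I / 24) - Real.pi ^ 2 / 6 *
        (1 / β - 1 / (β * (1 + ((√β : ℝ) : ℂ) * u * Complex.I)))) ^ k *
      Complex.exp (k * Real.pi ^ 2 / (6 * β ^ 2) * (β * ((√β : ℝ) : ℂ) * u) * Complex.I) := by
    rw [← Complex.exp_nat_mul, ← Complex.exp_add]
    congr 1
    generalize ((√β : ℝ) : ℂ) = s at *
    rw [← hsq] at hβ0 ⊢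
    have hs0 : s ≠ 0 := fun h => hβ0 (by rw [h]; ring)
    field_simp
    ring_nf
    simp only [Complex.I_sq]
    ring
  rw [e4]
  ring

/-! ### Circle integrals for p_k(n) and a_{m,k}(n) -/

lemma integral_coeff {b : ℕ → ℂ} {S : ℂ → ℂ}
    (h : ∀ q : ℂ, ‖q‖ < 1 → HasSum (fun n : ℕ => b n * q ^ n) (S q)) {β : ℝ} (hβ : 0 < β) (n : ℕ) :
    ∫ y in (-Real.pi)..Real.pi, S (Complex.exp (-((β : ℂ) + y * Complex.I))) *
      Complex.exp (n * y * Complex.I) = 2 * Real.pi * (b n * Complex.exp (-(β : ℂ)) ^ n) := by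
  have hκ : Function.Injective fun l : ℕ => -(l : ℤ) := fun i j hij => by simpa using hij
  have hs : Summable fun l : ℕ => ‖b l * Complex.exp (-(β : ℂ)) ^ l‖ := by
    refine (h _ ?_).summable.norm
    simpa using norm_exp_neg_add_lt_one hβ 0
  rw [← integral_fourier_series hκ hs n]
  refine intervalIntegral.integral_congr fun y _ => ?_
  congr 1
  · rw [← (h _ (norm_exp_neg_add_lt_one hβ y)).tsum_eq]
    refine tsum_congr fun l => ?_
    rw [neg_add, Complex.exp_add, mul_pow, ← Complex.exp_nat_mul (-(y * Complex.I)), mul_assoc]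
    congr 3
    push_cast
    ring
  · congr 1
    push_cast
    ring

lemma a_natAbs (m : ℤ) (k n : ℕ) : a m.natAbs k n = a m k n := by
  rcases Int.natAbs_eq m with h | h
  · rw [← h]
  · have h1 := integral_coeff (fun q hq => hasSum_A k m hq) one_pos n
    have h2 := integral_coeff (fun q hq => hasSum_A k m.natAbs hq) one_pos n
    have h3 : ∫ y in (-Real.pi)..Real.pi, A k m (Complex.exp (-(((1 : ℝ) : ℂ) + y * Complex.I))) *
        Complex.exp (n * y * Complex.I) = ∫ y in (-Real.pi)..Real.pi,
        A k m.natAbs (Complex.exp (-(((1 : ℝ) : ℂ) + y * Complex.I))) *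
        Complex.exp (n * y * Complex.I) := by
      refine intervalIntegral.integral_congr fun y _ => ?_
      have := A_neg k m.natAbs (norm_exp_neg_add_lt_one one_pos y)
      rw [← h] at this
      simp only [this]
    rw [h3, h2] at h1
    have hpi : (2 * Real.pi : ℂ) ≠ 0 := by
      simp [Real.pi_ne_zero]
    have h4 := mul_right_cancel₀ (pow_ne_zero n (Complex.exp_ne_zero _)) (mul_left_cancel₀ hpi h1)
    exact_mod_cast h4

lemma sq_mul_sqrt {β : ℝ} (hβ : 0 ≤ β) : (β * √β) ^ 2 = β ^ 3 := by
  rw [mul_pow, Real.sq_sqrt hβ]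
  ring

lemma exp_neg_inv_le {β : ℝ} (hβ : 0 < β) (i : ℕ) :
    Real.exp (-(1 / (56 * β))) ≤ i.factorial * 56 ^ i * β ^ i := by
  have h := Real.pow_div_factorial_le_exp (1 / (56 * β)) (by positivity) i
  rw [Real.exp_neg, inv_le_comm₀ (Real.exp_pos _) (by positivity)]
  refine le_trans (le_of_eq ?_) h
  rw [div_pow, one_pow, mul_pow]
  field_simp

/-- One integrable majorant, independent of β, that covers both regimes of `norm_eulRatio_le`. -/
lemma norm_eulRatio_le_inv {β u : ℝ} (hβ : 0 < β) (hβ1 : β ≤ 1 / 2) (hu : |β * √β * u| ≤ Real.pi) :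
    ‖eulRatio β (β * √β * u)‖ ≤ 66 * 56 ^ 3 * (1 + u ^ 2)⁻¹ := by
  obtain ⟨h1, h2⟩ := norm_eulRatio_le hβ hβ1 hu
  have hsq : (β * √β * u) ^ 2 = β ^ 3 * u ^ 2 := by rw [mul_pow, sq_mul_sqrt hβ.le]
  have hu1 : 0 < 1 + u ^ 2 := by positivity
  rcases le_total |β * √β * u| β with h | h
  · refine (h1 h).trans ?_
    have e : (β * √β * u) ^ 2 / (56 * β ^ 3) = u ^ 2 / 56 := by
      rw [hsq]
      field_simp
    rw [e, Real.exp_neg, ← div_eq_mul_inv, inv_eq_one_div, div_le_div_iff₀ (Real.exp_pos _) hu1]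
    have := Real.add_one_le_exp (u ^ 2 / 56)
    nlinarith [sq_nonneg u]
  -- The third power of β is what |y| ≤ π turns into decay: β³u² = y² ≤ π² ≤ 10, whence 3!·56³·(1 +
  -- 10) = 66·56³.
  · refine (h2 h).trans ((exp_neg_inv_le hβ 3).trans ?_)
    rw [← div_eq_mul_inv, le_div_iff₀ hu1]
    have h3 : β ^ 3 * u ^ 2 ≤ Real.pi ^ 2 := by
      rw [← hsq, ← sq_abs]
      gcongr
    have h4 : β ^ 3 ≤ 1 := pow_le_one₀ hβ.le (by linarith)
    have h5 : Real.pi ^ 2 ≤ 10 := by nlinarith [Real.pi_lt_d2, Real.pi_pos]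
    norm_num [Nat.factorial]
    nlinarith

/-- Dominated convergence after y = β^{3/2}u, with the integrand extended by 0 to the whole line. -/
lemma tendsto_integral_eulRatio {k : ℕ} (hk : 1 ≤ k) :
    Tendsto (fun β : ℝ => ((β * √β)⁻¹ : ℝ) • ∫ y in (-Real.pi)..Real.pi, eulRatio β y ^ k *
      Complex.exp (k * Real.pi ^ 2 / (6 * β ^ 2) * y * Complex.I)) (𝓝[>] 0)
      (𝓝 (∫ u : ℝ, Complex.exp (-(k * Real.pi ^ 2 / 6 * u ^ 2)))) := by
  have hpi := Real.pi_pos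
  set F : ℝ → ℝ → ℂ := fun β u =>
    (Ioc (-(Real.pi / (β * √β))) (Real.pi / (β * √β))).indicator
      (fun u : ℝ => eulRatio β (β * √β * u) ^ k *
        Complex.exp (k * Real.pi ^ 2 / (6 * β ^ 2) * (β * √β * u) * Complex.I)) u with hF
  have hsmall : ∀ᶠ β : ℝ in 𝓝[>] 0, 0 < β ∧ β ≤ 1 / 2 := by
    filter_upwards [Ioc_mem_nhdsGT (show (0 : ℝ) < 1 / 2 by norm_num)] with β hβ using hβ
  have hmain : Tendsto (fun β => ∫ u, F β u) (𝓝[>] 0)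
      (𝓝 (∫ u : ℝ, Complex.exp (-(k * Real.pi ^ 2 / 6 * u ^ 2)))) := by
    refine tendsto_integral_filter_of_dominated_convergence
      (fun u : ℝ => 66 * 56 ^ 3 * (1 + u ^ 2)⁻¹) ?_ ?_ (integrable_inv_one_add_sq.const_mul _) ?_
    · filter_upwards [hsmall] with β hβ
      refine (Measurable.indicator ?_ measurableSet_Ioc).aestronglyMeasurable
      refine Measurable.mul (((measurable_eulRatio hβ.1).comp (measurable_const_mul _)).pow_const k) ?_
      exact Continuous.measurable (by fun_prop)
    · filter_upwards [hsmall] with β hβ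
      refine Eventually.of_forall fun u => ?_
      simp only [hF]
      by_cases hu : u ∈ Ioc (-(Real.pi / (β * √β))) (Real.pi / (β * √β))
      · rw [indicator_of_mem hu]
        have hc : 0 < β * √β := mul_pos hβ.1 (Real.sqrt_pos.2 hβ.1)
        have hy : |β * √β * u| ≤ Real.pi := by
          rw [abs_mul, abs_of_pos hc, ← le_div_iff₀' hc]
          exact abs_le.2 ⟨hu.1.le, hu.2⟩
        have he : ‖Complex.exp (k * Real.pi ^ 2 / (6 * β ^ 2) * (β * √β * u) * Complex.I)‖ = 1 := by
          rw [show (k * Real.pi ^ 2 / (6 * β ^ 2) * (β * √β * u) * Complex.I : ℂ) =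
            ((k * Real.pi ^ 2 / (6 * β ^ 2) * (β * √β * u) : ℝ) : ℂ) * Complex.I by push_cast; rfl,
            Complex.norm_exp_ofReal_mul_I]
        rw [norm_mul, he, mul_one, norm_pow]
        exact (pow_le_of_le_one (norm_nonneg _) (norm_eulRatio_le_one hβ.1 hβ.2 hy)
          (by omega)).trans (norm_eulRatio_le_inv hβ.1 hβ.2 hy)
      · rw [indicator_of_notMem hu, norm_zero]
        positivity
    · refine Eventually.of_forall fun u => ?_
      refine (tendsto_eulRatio k u).congr' ?_
      have hlim : Tendsto (fun β : ℝ => β * √β * |u|) (𝓝[>] 0) (𝓝 0) := by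
        have : Continuous fun β : ℝ => β * √β * |u| := by fun_prop
        simpa using (this.tendsto 0).mono_left nhdsWithin_le_nhds
      filter_upwards [hsmall, hlim.eventually (gt_mem_nhds hpi)] with β hβ hu
      have hc : 0 < β * √β := mul_pos hβ.1 (Real.sqrt_pos.2 hβ.1)
      rw [mul_comm, ← lt_div_iff₀ hc] at hu
      have hmem : u ∈ Ioc (-(Real.pi / (β * √β))) (Real.pi / (β * √β)) :=
        ⟨(abs_lt.1 hu).1, (abs_lt.1 hu).2.le⟩
      simp only [hF]
      rw [indicator_of_mem hmem]
  refine hmain.congr' ?_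
  filter_upwards [hsmall] with β hβ
  have hc : 0 < β * √β := mul_pos hβ.1 (Real.sqrt_pos.2 hβ.1)
  have hle : -(Real.pi / (β * √β)) ≤ Real.pi / (β * √β) := by
    have : 0 < Real.pi / (β * √β) := by positivity
    linarith
  have hcv := intervalIntegral.integral_comp_mul_left (a := -(Real.pi / (β * √β)))
    (b := Real.pi / (β * √β)) (fun y : ℝ => eulRatio β y ^ k *
      Complex.exp (k * Real.pi ^ 2 / (6 * β ^ 2) * y * Complex.I)) hc.ne'
  rw [mul_neg, mul_div_cancel₀ _ hc.ne'] at hcv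
  rw [← hcv, intervalIntegral.integral_of_le hle, ← integral_indicator measurableSet_Ioc]
  refine integral_congr_ae (Eventually.of_forall fun u => ?_)
  simp only [hF]
  push_cast
  rfl

lemma exists_norm_integral_eulRatio_ge {k : ℕ} (hk : 1 ≤ k) : ∃ c : ℝ, 0 < c ∧
    ∀ᶠ β : ℝ in 𝓝[>] 0, c * (β * √β) ≤ ‖∫ y in (-Real.pi)..Real.pi, eulRatio β y ^ k *
      Complex.exp (k * Real.pi ^ 2 / (6 * β ^ 2) * y * Complex.I)‖ := by
  have hpi := Real.pi_pos
  have hk0 : (0 : ℝ) < k := by exact_mod_cast hk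
  have hG : ∫ u : ℝ, Complex.exp (-(k * Real.pi ^ 2 / 6 * u ^ 2)) =
      ((√(Real.pi / (k * Real.pi ^ 2 / 6)) : ℝ) : ℂ) := by
    rw [← integral_gaussian, ← integral_complex_ofReal]
    refine integral_congr_ae (Eventually.of_forall fun u => ?_)
    simp only
    push_cast
    congr 1
    ring
  have hpos : 0 < √(Real.pi / (k * Real.pi ^ 2 / 6)) := Real.sqrt_pos.2 (by positivity)
  have h := (tendsto_integral_eulRatio hk).norm
  rw [hG, Complex.norm_real, Real.norm_eq_abs, abs_of_pos hpos] at h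
  refine ⟨√(Real.pi / (k * Real.pi ^ 2 / 6)) / 2, by positivity, ?_⟩
  filter_upwards [h.eventually (lt_mem_nhds (half_lt_self hpos)), self_mem_nhdsWithin] with β hβ hβ0
  have hc : 0 < β * √β := mul_pos hβ0 (Real.sqrt_pos.2 hβ0)
  rw [norm_smul, Real.norm_eq_abs, abs_of_pos (inv_pos.2 hc), ← div_eq_inv_mul, lt_div_iff₀ hc] at hβ
  exact hβ.le

/-- For |y| ≤ β the kernel error β^{3/2} + |y| meets a Gaussian of width β^{3/2}, so both height and
width contribute β^{3/2}. For |y| ≥ β exponential smallness beats the crude bounds for A and P. -/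
lemma exists_norm_integral_diff_le : ∃ C : ℝ, 0 < C ∧ ∀ (β : ℝ) (k m n : ℕ), 1 ≤ k → 0 < β →
    β ≤ 1 / 2 → 1 ≤ m → m * β ^ 2 ≤ 1 →
    ‖∫ y in (-Real.pi)..Real.pi, (A 0 m (Complex.exp (-((β : ℂ) + y * Complex.I))) - P m β) *
      eulRatio β y ^ k * Complex.exp (n * y * Complex.I)‖ ≤ C * β ^ 3 := by
  have hpi := Real.pi_pos
  obtain ⟨C₁, hC₁, hker⟩ := kernel_estimate
  -- The exponent is 7 = 4 + 3: since m ≤ β^{-2}, the crude bound is O(β^{-4}), and O(β³) is wanted.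
  set K : ℝ := (96 + C₁) * ((Nat.factorial 7 : ℕ) * 56 ^ 7) with hK
  refine ⟨C₁ * 112 * √(112 * Real.pi) + 2 * Real.pi * K, by positivity,
    fun β k m n hk hβ hβ1 hm hmβ => ?_⟩
  have hc : 0 < β * √β := mul_pos hβ (Real.sqrt_pos.2 hβ)
  have hc2 := sq_mul_sqrt hβ.le
  have hbound : ∀ y : ℝ, |y| ≤ Real.pi →
      ‖(A 0 m (Complex.exp (-((β : ℂ) + y * Complex.I))) - P m β) *
        eulRatio β y ^ k * Complex.exp (n * y * Complex.I)‖ ≤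
      C₁ * 112 * (β * √β) * Real.exp (-(1 / (112 * β ^ 3)) * y ^ 2) + K * β ^ 3 := by
    intro y hy
    have he : ‖Complex.exp (n * y * Complex.I)‖ = 1 := by
      rw [show (n * y * Complex.I : ℂ) = ((n * y : ℝ) : ℂ) * Complex.I by push_cast; rfl,
        Complex.norm_exp_ofReal_mul_I]
    have hR : ‖eulRatio β y‖ ^ k ≤ ‖eulRatio β y‖ :=
      pow_le_of_le_one (norm_nonneg _) (norm_eulRatio_le_one hβ hβ1 hy) (by omega)
    rw [norm_mul, he, mul_one, norm_mul, norm_pow]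
    obtain ⟨h1, h2⟩ := norm_eulRatio_le hβ hβ1 hy
    rcases le_total |y| β with h | h
    · have hv : |y| = β * √β * (|y| / (β * √β)) := by field_simp
      have hv2 : y ^ 2 = β ^ 3 * (|y| / (β * √β)) ^ 2 := by
        rw [← hc2, ← mul_pow, ← hv, sq_abs]
      have hv0 : 0 ≤ |y| / (β * √β) := by positivity
      have hk1 := hker β y m hβ hβ1 h hm
      have hR1 := hR.trans (h1 h)
      rw [hv2] at hR1 ⊢
      rw [hv] at hk1
      generalize |y| / (β * √β) = v at *
      have e1 : β ^ 3 * v ^ 2 / (56 * β ^ 3) = v ^ 2 / 112 + v ^ 2 / 112 := by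
        field_simp
        ring
      have e2 : -(1 / (112 * β ^ 3)) * (β ^ 3 * v ^ 2) = -(v ^ 2 / 112) := by field_simp
      rw [e1, neg_add, Real.exp_add] at hR1
      rw [e2]
      have hexp := Real.add_one_le_exp (v ^ 2 / 112)
      have h3 : (1 + v) * Real.exp (-(v ^ 2 / 112)) ≤ 112 := by
        rw [Real.exp_neg, ← div_eq_mul_inv, div_le_iff₀ (Real.exp_pos _)]
        nlinarith [sq_nonneg (v - 1)]
      have hKp : 0 ≤ K * β ^ 3 := by positivity
      calc _ ≤ C₁ * (β * √β + β * √β * v) *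
            (Real.exp (-(v ^ 2 / 112)) * Real.exp (-(v ^ 2 / 112))) := by gcongr
        _ = C₁ * (β * √β) * ((1 + v) * Real.exp (-(v ^ 2 / 112))) *
            Real.exp (-(v ^ 2 / 112)) := by ring
        _ ≤ C₁ * (β * √β) * 112 * Real.exp (-(v ^ 2 / 112)) := by gcongr
        _ ≤ _ := by linarith
    · have hA := norm_A_le (y := y) hβ (by linarith) hm
      have hA0 := norm_A_le (y := 0) hβ (by linarith) hm
      -- P itself is bounded through its closeness to A at y = 0.
      have hk0 := hker β 0 m hβ hβ1 (by simpa using hβ.le) hm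
      have hmm : 48 * (m : ℝ) / β ^ 2 ≤ 48 / β ^ 4 := by
        rw [div_le_div_iff₀ (by positivity) (by positivity)]
        have : 0 < β ^ 2 := by positivity
        nlinarith
      have hs1 : β * √β ≤ 1 := by
        have : √β ≤ 1 := Real.sqrt_le_one.2 (by linarith)
        nlinarith [Real.sqrt_nonneg β]
      have hP : ‖((P m β : ℝ) : ℂ)‖ ≤ 48 / β ^ 4 + C₁ := by
        have := norm_sub_norm_le ((P m β : ℝ) : ℂ)
          (A 0 m (Complex.exp (-((β : ℂ) + (0 : ℝ) * Complex.I))))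
        rw [norm_sub_rev] at this
        rw [abs_zero, add_zero] at hk0
        nlinarith
      have hone : C₁ ≤ C₁ / β ^ 4 := by
        rw [le_div_iff₀ (by positivity)]
        have : β ^ 4 ≤ 1 := pow_le_one₀ hβ.le (by linarith)
        nlinarith
      have hAP : ‖A 0 m (Complex.exp (-((β : ℂ) + y * Complex.I))) - P m β‖ ≤
          (96 + C₁) / β ^ 4 := by
        refine (norm_sub_le _ _).trans ?_
        have : (96 + C₁) / β ^ 4 = 48 / β ^ 4 + (48 / β ^ 4 + C₁ / β ^ 4) := by ring
        linarith
      have hR2 := hR.trans ((h2 h).trans (exp_neg_inv_le hβ 7))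
      have hpos : 0 ≤ C₁ * 112 * (β * √β) * Real.exp (-(1 / (112 * β ^ 3)) * y ^ 2) := by positivity
      calc _ ≤ (96 + C₁) / β ^ 4 * ((Nat.factorial 7 : ℕ) * 56 ^ 7 * β ^ 7) := by gcongr
        _ = K * β ^ 3 := by
          rw [hK]
          field_simp
        _ ≤ _ := by linarith
  have hgi : Integrable fun y : ℝ => Real.exp (-(1 / (112 * β ^ 3)) * y ^ 2) :=
    integrable_exp_neg_mul_sq (by positivity)
  have hle : -Real.pi ≤ Real.pi := by linarith
  have hg1 : ∫ y in (-Real.pi)..Real.pi, Real.exp (-(1 / (112 * β ^ 3)) * y ^ 2) ≤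
      √(112 * Real.pi) * (β * √β) := by
    rw [intervalIntegral.integral_of_le hle]
    refine (setIntegral_le_integral hgi (Eventually.of_forall fun y => (Real.exp_pos _).le)).trans ?_
    rw [integral_gaussian]
    have e : Real.pi / (1 / (112 * β ^ 3)) = 112 * Real.pi * (β * √β) ^ 2 := by
      rw [hc2]
      field_simp
    rw [e, Real.sqrt_mul (by positivity), Real.sqrt_sq hc.le]
  have hgint : IntervalIntegrable (fun y : ℝ => C₁ * 112 * (β * √β) *
      Real.exp (-(1 / (112 * β ^ 3)) * y ^ 2)) volume (-Real.pi) Real.pi :=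
    (hgi.const_mul _).intervalIntegrable
  have hmain := intervalIntegral.norm_integral_le_of_norm_le hle
    (Eventually.of_forall fun y hy => hbound y (abs_le.2 ⟨hy.1.le, hy.2⟩))
    (hgint.add intervalIntegrable_const)
  refine hmain.trans ?_
  rw [intervalIntegral.integral_add hgint intervalIntegrable_const,
    intervalIntegral.integral_const_mul, intervalIntegral.integral_const, smul_eq_mul]
  calc _ ≤ C₁ * 112 * (β * √β) * (√(112 * Real.pi) * (β * √β)) +
        (Real.pi - -Real.pi) * (K * β ^ 3) := by gcongr
    _ = C₁ * 112 * √(112 * Real.pi) * (β * √β) ^ 2 + 2 * Real.pi * K * β ^ 3 := by ring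
    _ = _ := by
      rw [hc2]
      ring

lemma integral_eulRatio_eq (k n : ℕ) {β : ℝ} (hβ : 0 < β) :
    ∫ y in (-Real.pi)..Real.pi, eulRatio β y ^ k * Complex.exp (n * y * Complex.I) =
      2 * Real.pi * (p k n * Complex.exp (-(β : ℂ)) ^ n) * eul 1 (Complex.exp (-(β : ℂ))) ^ k := by
  rw [← integral_coeff (fun q hq => hasSum_p k hq) hβ n, ← intervalIntegral.integral_mul_const]
  refine intervalIntegral.integral_congr fun y _ => ?_
  simp only [eulRatio, div_pow, inv_pow]
  ring

lemma integral_diff_eq (k m n : ℕ) {β : ℝ} (hβ : 0 < β) (c : ℂ) :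
    ∫ y in (-Real.pi)..Real.pi, (A 0 m (Complex.exp (-((β : ℂ) + y * Complex.I))) - c) *
      eulRatio β y ^ k * Complex.exp (n * y * Complex.I) =
      2 * Real.pi * ((a m k n - c * p k n) * Complex.exp (-(β : ℂ)) ^ n) *
        eul 1 (Complex.exp (-(β : ℂ))) ^ k := by
  have h : ∀ q : ℂ, ‖q‖ < 1 → HasSum (fun n : ℕ => ((a m k n : ℂ) - c * p k n) * q ^ n)
      ((A 0 m q - c) * (eul 1 q)⁻¹ ^ k) := fun q hq => by
    have h1 := (hasSum_A k m hq).sub ((hasSum_p k hq).mul_left c)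
    rw [A_eq k m hq, mul_comm _ (A 0 m q), ← sub_mul] at h1
    exact hasSum_of_eq (fun n => by ring) h1
  rw [← integral_coeff h hβ n, ← intervalIntegral.integral_mul_const]
  refine intervalIntegral.integral_congr fun y _ => ?_
  simp only [eulRatio, div_pow, inv_pow]
  ring

/-! ### The saddle point β_k and the range of m -/

lemma betaK_pos {k n : ℕ} (hk : 1 ≤ k) (hn : 1 ≤ n) : 0 < betaK k n := by
  have : (0 : ℝ) < k := by exact_mod_cast hk
  have : (0 : ℝ) < n := by exact_mod_cast hn
  have := Real.pi_pos
  unfold betaK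
  positivity

lemma betaK_eq (k n : ℕ) : betaK k n = Real.pi * √(k / 6) / √n := by
  rw [betaK, mul_div_assoc, ← Real.sqrt_div (by positivity), div_div]

lemma tendsto_betaK {k : ℕ} (hk : 1 ≤ k) : Tendsto (betaK k) atTop (𝓝[>] 0) := by
  refine tendsto_nhdsWithin_iff.2 ⟨?_, ?_⟩
  · have h : Tendsto (fun n : ℕ => √(n : ℝ)) atTop atTop :=
      Real.tendsto_sqrt_atTop.comp tendsto_natCast_atTop_atTop
    exact (h.const_div_atTop _).congr fun n => (betaK_eq k n).symm
  · filter_upwards [eventually_ge_atTop 1] with n hn using betaK_pos hk hn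

lemma tendsto_log_mul_betaK (k : ℕ) :
    Tendsto (fun n : ℕ => Real.log n * betaK k n) atTop (𝓝 0) := by
  have h := ((isLittleO_log_rpow_atTop (show (0 : ℝ) < 1 / 2 by norm_num)).tendsto_div_nhds_zero.comp
    tendsto_natCast_atTop_atTop).mul_const (Real.pi * √(k / 6))
  rw [zero_mul] at h
  refine h.congr fun n => ?_
  rw [betaK_eq, Real.sqrt_eq_rpow (n : ℝ)]
  simp only [Function.comp_apply]
  ring

lemma eq_div_betaK_sq {k n : ℕ} (hk : 1 ≤ k) (hn : 1 ≤ n) :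
    (n : ℝ) = k * Real.pi ^ 2 / (6 * betaK k n ^ 2) := by
  have hk0 : (0 : ℝ) < k := by exact_mod_cast hk
  have hn0 : (0 : ℝ) < n := by exact_mod_cast hn
  have hpi := Real.pi_pos
  rw [betaK, mul_pow, Real.sq_sqrt (by positivity)]
  field_simp

/-- `a_{m,k}(n) / p_k(n) = P(m, β_k) + O(β_k^{3/2})` uniformly in `1 ≤ m ≤ β_k^{-2}`. -/
lemma exists_abs_ratio_sub_le {k : ℕ} (hk : 1 ≤ k) : ∃ C : ℝ, 0 < C ∧ ∀ᶠ n : ℕ in atTop,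
    ∀ m : ℕ, 1 ≤ m → m * betaK k n ^ 2 ≤ 1 →
      |(a m k n : ℝ) / p k n - P m (betaK k n)| ≤ C * (betaK k n * √(betaK k n)) := by
  obtain ⟨c, hc, hlow⟩ := exists_norm_integral_eulRatio_ge hk
  obtain ⟨C, hC, hup⟩ := exists_norm_integral_diff_le
  refine ⟨C / c, by positivity, ?_⟩
  have hsmall : ∀ᶠ β : ℝ in 𝓝[>] 0, 0 < β ∧ β ≤ 1 / 2 := by
    filter_upwards [Ioc_mem_nhdsGT (show (0 : ℝ) < 1 / 2 by norm_num)] with β hβ using hβ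
  filter_upwards [(tendsto_betaK hk).eventually (hlow.and hsmall), eventually_ge_atTop 1] with n hn hn1
    m hm hmβ
  obtain ⟨hl, hβ, hβ1⟩ := hn
  have hu := hup _ k m n hk hβ hβ1 hm hmβ
  -- β_k is defined so that the phase frequency kπ²/(6β²) of the Gaussian limit is exactly n; the
  -- limit integral is then the Cauchy integral for p_k(n).
  have hne : ((k : ℂ) * Real.pi ^ 2 / (6 * (betaK k n : ℂ) ^ 2)) = n := by
    exact_mod_cast (eq_div_betaK_sq hk hn1).symm
  rw [hne, integral_eulRatio_eq k n hβ] at hl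
  rw [integral_diff_eq k m n hβ] at hu
  generalize betaK k n = β at *
  have hc0 : 0 < β * √β := mul_pos hβ (Real.sqrt_pos.2 hβ)
  rw [norm_mul, norm_mul (2 * (Real.pi : ℂ)), norm_mul ((p k n : ℕ) : ℂ)] at hl
  rw [norm_mul, norm_mul (2 * (Real.pi : ℂ)), norm_mul (_ - _)] at hu
  -- The common normalisation of both integrals. It cancels in the quotient, and the lower bound
  -- also supplies p_k(n) > 0.
  set E : ℝ := ‖(2 * Real.pi : ℂ)‖ * ‖Complex.exp (-(β : ℂ)) ^ n‖ *
    ‖eul 1 (Complex.exp (-(β : ℂ))) ^ k‖ with hE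
  have hpn : ‖((p k n : ℕ) : ℂ)‖ = p k n := Complex.norm_natCast _
  have han : ‖(a m k n : ℂ) - (P m β : ℝ) * (p k n : ℂ)‖ = |(a m k n : ℝ) - P m β * p k n| := by
    rw [← Real.norm_eq_abs, ← Complex.norm_real]
    push_cast
    rfl
  rw [hpn] at hl
  rw [han] at hu
  have hl' : c * (β * √β) ≤ p k n * E := hl.trans_eq (by rw [hE]; ring)
  have hu' : |(a m k n : ℝ) - P m β * p k n| * E ≤ C * β ^ 3 := le_trans (le_of_eq (by rw [hE]; ring)) hu
  have hE0 : 0 ≤ E := by positivity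
  have hpE : 0 < p k n * E := lt_of_lt_of_le (by positivity) hl'
  have hp0 : (0 : ℝ) < p k n := pos_of_mul_pos_left hpE hE0
  have hEp : 0 < E := pos_of_mul_pos_right hpE hp0.le
  have e : (a m k n : ℝ) / p k n - P m β = ((a m k n : ℝ) - P m β * p k n) / p k n := by
    field_simp
  rw [e, abs_div, abs_of_pos hp0]
  calc _ = |(a m k n : ℝ) - P m β * p k n| * E / (p k n * E) := by field_simp
    _ ≤ C * β ^ 3 / (c * (β * √β)) := by gcongr
    _ = _ := by
      rw [← sq_mul_sqrt hβ.le]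
      field_simp

/-- In the range `β_k M ≤ log n / 6` one has `e^{β_k M} ≪ M^{1/3}`. -/
lemma exp_betaK_mul_le {k n : ℕ} (hk : 1 ≤ k) (hn : 1 ≤ n) {M : ℝ} (hM : 1 ≤ M)
    (h : betaK k n * M ≤ Real.log n / 6) :
    Real.exp (betaK k n * M) ≤
      (Real.exp 1 + (Real.pi * √(k / 6)) ^ (1 / 3 : ℝ)) * M ^ (1 / 3 : ℝ) := by
  have hpi := Real.pi_pos
  have hn0 : (0 : ℝ) < n := by exact_mod_cast hn
  have hβ := betaK_pos hk hn
  have hM3 : 1 ≤ M ^ (1 / 3 : ℝ) := Real.one_le_rpow hM (by norm_num)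
  have hκ : 0 ≤ (Real.pi * √(k / 6)) ^ (1 / 3 : ℝ) := by positivity
  rw [add_mul]
  rcases le_total (betaK k n * M) 1 with h1 | h1
  · have := Real.exp_le_exp.2 h1
    have : 0 ≤ (Real.pi * √(k / 6)) ^ (1 / 3 : ℝ) * M ^ (1 / 3 : ℝ) := by positivity
    nlinarith [Real.exp_pos 1]
  -- Here e^{βM} ≤ n^{1/6} = (√n)^{1/3}, and βM ≥ 1 says precisely that √n ≤ π√(k/6)·M.
  · have h2 : Real.exp (betaK k n * M) ≤ (√(n : ℝ)) ^ (1 / 3 : ℝ) := by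
      rw [Real.sqrt_eq_rpow, ← Real.rpow_mul hn0.le, Real.rpow_def_of_pos hn0, Real.exp_le_exp]
      linarith
    have h3 : √(n : ℝ) ≤ Real.pi * √(k / 6) * M := by
      rw [betaK_eq, div_mul_eq_mul_div, le_div_iff₀ (Real.sqrt_pos.2 hn0), one_mul] at h1
      exact h1
    have h4 : (√(n : ℝ)) ^ (1 / 3 : ℝ) ≤ (Real.pi * √(k / 6) * M) ^ (1 / 3 : ℝ) := by gcongr
    rw [Real.mul_rpow (by positivity) (by positivity)] at h4
    have := Real.exp_pos 1
    nlinarith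

end
end ChiGenus

/-- The integers `a_{m,k}(n)` are the coefficients of the expansion of `f_k` in the annulus
`|q| < |ζ| < |q|⁻¹` (away from the removable singularities `ζ = 1` of the quotient defining `f_k`),
and for fixed `k ≥ 1` the ratio `a_{m,k}(n) / p_k(n)` equals
`P(m, β_k) (1 + O(β_k^{1/2} |m|^{1/3}))` as `n → ∞`, uniformly in the nonzero integers `m` with
`|m| ≤ √(n / (6 k)) log n / π`. -/
theorem theorem1p3 (k : ℕ) (hk : 1 ≤ k) :
    (∀ w τ : ℂ, 0 < τ.im → |w.im| < τ.im → ChiGenus.zeta w ≠ 1 →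
      HasSum
        (fun x : ℤ × ℕ => (ChiGenus.a x.1 k x.2 : ℂ) * ChiGenus.zeta w ^ x.1 *
          Complex.exp (2 * Real.pi * Complex.I * τ * ((x.2 : ℂ) - (k : ℂ) / 24)))
        (ChiGenus.f k w τ)) ∧
    ∃ C : ℝ, ∃ N : ℕ, ∀ n : ℕ, N ≤ n → ∀ m : ℤ, m ≠ 0 →
      |(m : ℝ)| ≤ Real.sqrt ((n : ℝ) / (6 * k)) * (Real.log n / Real.pi) →
      ∃ ε : ℝ,
        |ε| ≤ C * (ChiGenus.betaK k n ^ (1 / 2 : ℝ) * |(m : ℝ)| ^ (1 / 3 : ℝ)) ∧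
        (ChiGenus.a m k n : ℝ) / (ChiGenus.p k n : ℝ) =
          ChiGenus.P m (ChiGenus.betaK k n) * (1 + ε) := by
  refine ⟨fun w τ hτ hw hz => ChiGenus.hasSum_f k hτ hw hz, ?_⟩
  obtain ⟨C, hC, hev⟩ := ChiGenus.exists_abs_ratio_sub_le hk
  have hsmall : ∀ᶠ n : ℕ in Filter.atTop, Real.log n * ChiGenus.betaK k n < 6 :=
    (ChiGenus.tendsto_log_mul_betaK k).eventually (gt_mem_nhds (by norm_num))
  obtain ⟨N, hN⟩ := Filter.eventually_atTop.1
    (hev.and (hsmall.and (Filter.eventually_ge_atTop 1)))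
  refine ⟨6 * C * (Real.exp 1 + (Real.pi * √(k / 6)) ^ (1 / 3 : ℝ)), N, fun n hn m hm hle => ?_⟩
  obtain ⟨hratio, hlog, hn1⟩ := hN n hn
  have hpi := Real.pi_pos
  have hk0 : (0 : ℝ) < k := by exact_mod_cast hk
  have hn0 : (0 : ℝ) < n := by exact_mod_cast hn1
  have hβ := ChiGenus.betaK_pos hk hn1
  have hM1 : 1 ≤ m.natAbs := Int.natAbs_pos.2 hm
  have hM1' : (1 : ℝ) ≤ m.natAbs := by exact_mod_cast hM1
  have habs : |(m : ℝ)| = (m.natAbs : ℝ) := by rw [Nat.cast_natAbs, Int.cast_abs]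
  have hβM : ChiGenus.betaK k n * m.natAbs ≤ Real.log n / 6 := by
    rw [← habs]
    have hs : √((k : ℝ) / (6 * n)) * √((n : ℝ) / (6 * k)) = 1 / 6 := by
      rw [← Real.sqrt_mul (by positivity)]
      have e : (k : ℝ) / (6 * n) * (n / (6 * k)) = (1 / 6) ^ 2 := by
        field_simp
      rw [e, Real.sqrt_sq (by norm_num)]
    calc ChiGenus.betaK k n * |(m : ℝ)| ≤ ChiGenus.betaK k n *
          (√((n : ℝ) / (6 * k)) * (Real.log n / Real.pi)) := by gcongr
      _ = √((k : ℝ) / (6 * n)) * √((n : ℝ) / (6 * k)) * Real.log n := by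
        rw [ChiGenus.betaK]
        field_simp
      _ = _ := by rw [hs]; ring
  -- Mβ² ≤ (β log n)/6, and β log n < 6 for n ≥ N because β log n → 0.
  have hMβ : m.natAbs * ChiGenus.betaK k n ^ 2 ≤ 1 := by nlinarith
  have h1 := hratio m.natAbs hM1 hMβ
  have hexp := ChiGenus.exp_betaK_mul_le hk hn1 hM1' hβM
  have hP := ChiGenus.P_lower (m := (m.natAbs : ℝ)) (by linarith) hβ
  rw [ChiGenus.a_natAbs] at h1
  rw [← ChiGenus.P_abs, habs, ← Real.sqrt_eq_rpow]
  generalize ChiGenus.betaK k n = β at *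
  generalize (m.natAbs : ℝ) = M at *
  generalize Real.exp 1 + (Real.pi * √(k / 6)) ^ (1 / 3 : ℝ) = D at *
  have hP0 : 0 < ChiGenus.P M β := lt_of_lt_of_le (by positivity) hP
  -- ε is the exact relative error; the lower bound for P converts Cβ^{3/2} into 6Cβ^{1/2}e^{βM}.
  refine ⟨(ChiGenus.a m k n : ℝ) / ChiGenus.p k n / ChiGenus.P M β - 1, ?_, ?_⟩
  · have e : (ChiGenus.a m k n : ℝ) / ChiGenus.p k n / ChiGenus.P M β - 1 =
        ((ChiGenus.a m k n : ℝ) / ChiGenus.p k n - ChiGenus.P M β) / ChiGenus.P M β := by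
      rw [sub_div, div_self hP0.ne']
    rw [e, abs_div, abs_of_pos hP0]
    calc _ ≤ C * (β * √β) / (β / 6 * Real.exp (-(β * M))) := by gcongr
      _ = 6 * C * √β * Real.exp (β * M) := by
        rw [Real.exp_neg]
        field_simp
      _ ≤ 6 * C * √β * (D * M ^ (1 / 3 : ℝ)) := by gcongr
      _ = _ := by ring
  · rw [add_sub_cancel, mul_div_cancel₀ _ hP0.ne']
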